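/- Let $(M,\Lambda,E)$ be a Jacobi manifold of dimension $m$: $\Lambda$ is a smooth bivector field and $E$ a smooth vector field (the Reeb field) with $[\Lambda,\Lambda]_S=2E\wedge\Lambda$ and $\mathscr L_E\Lambda=0$, i.e. in coordinates $\Lambda^{pi}\partial_p\Lambda^{jk}+\mathrm{cycl}(ijk)=E^i\Lambda^{jk}+\mathrm{cycl}(ijk)$ and $E^k\partial_k\Lambda^{ij}-\Lambda^{kj}\partial_kE^i-\Lambda^{ik}\partial_kE^j=0$. Assume that $E$ vanishes nowhere. Let $I=[0,1]$, and let the constraint manifold $\mathcal C$ of the Jacobi sigma model on $\mathbb R\times I$ be the set of triples $(X,\zeta,\lambda_u)$ consisting of a $C^1$ path $X:I\to M$, a continuous section $\zeta$ of $X^*T^*M$ and a continuous function $\lambda_u:I\to\mathbb R$ such that $$X'^i+\Lambda^{ij}(X)\zeta_j-E^i(X)\lambda_u=0,\qquad E^i(X)\zeta_i=0 .$$ Its tangent space $T_c\mathcal C$ at $c=(X,\zeta,\lambda_u)$ is the space of continuous variations $(\tilde X,\tilde\zeta,\tilde\lambda_u)$, $(\tilde X,\tilde\zeta)(u)\in T_{(X(u),\zeta(u))}T^*M$,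 with $\tilde X$ of class $C^1$, that solve the linearised constraints, with the topology of uniform convergence (on $T_c\mathcal C$ the same as that of $C^1$ convergence of $\tilde X$ and uniform convergence of $\tilde\zeta,\tilde\lambda_u$). The gauge parameters are the pairs $(\beta,\lambda_t)$ of a $C^1$ section $\beta$ of $X^*T^*M$ with $E^i\beta_i=0$ and $\beta(0)=\beta(1)=0$, and a $C^1$ function $\lambda_t:I\to\mathbb R$ without boundary condition. The Hamiltonian vector field $\xi_{\beta,\lambda_t}$ of $K(\beta,\lambda_t)=\int_I \big[\beta_i(X'^i+\Lambda^{ij}\zeta_j-E^i\lambda_u)+\lambda_tE^i\zeta_i\big]du$ has at $c$ the components $$\tilde X^i=\Lambda^{ij}\beta_j-E^i\lambda_t,\qquad \tilde\zeta_i=-\beta_i'+\beta_j\,\partial_i\Lambda^{jk}\zeta_k-\lambda_u\beta_j\,\partial_iE^j+\lambda_t\zeta_j\,\partial_iE^j,\qquad \tilde\lambda_u=-(\lambda_t'+\Lambda^{ij}\beta_i\zeta_j)$$ in every chart (it is well defined at every $c\in\mathcal C$). Then, for every $c\in\mathcal C$, the subspace of $T_c\mathcal C$ spanned by the Hamiltonian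 vector fields $\xi_{\beta,\lambda_t}$ is a closed subspace of codimension $2m-2$. The same holds at fixed $\lambda_u$: in $\{\tilde\lambda_u=0\}\subset T_c\mathcal C$, the subspace spanned by those $\xi_{\beta,\lambda_t}$ that have $\tilde\lambda_u=0$, i.e. $\lambda_t'=-\Lambda^{ij}\beta_i\zeta_j$, is closed and of codimension $2m-2$. In this sense the reduced phase space, the quotient of $\mathcal C$ by the gauge transformations, is finite-dimensional of dimension $2\dim M-2$: the quotient of $T_c\mathcal C$ by the gauge directions has dimension $2\dim M-2$. -/

import Mathlib

open Set Topology Manifold ContDiff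

noncomputable section

namespace JacobiSigma

variable (F : Type*) [NormedAddCommGroup F] [NormedSpace ℝ F]
variable (M : Type*) [TopologicalSpace M] [ChartedSpace F M] [IsManifold 𝓘(ℝ, F) ∞ M]

/-! ### The cotangent bundle and coordinates -/

/-- The cotangent space of `M` at `x`. -/
abbrev Cotangent (x : M) : Type _ := TangentSpace 𝓘(ℝ, F) x →L[ℝ] ℝ

/-- The total space of the cotangent bundle `T*M` (with Mathlib's manifold structure). -/
abbrev CotangentBundle : Type _ :=
  Bundle.TotalSpace (F →L[ℝ] ℝ) (fun x : M => TangentSpace 𝓘(ℝ, F) x →L[ℝ] ℝ)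

/-- The model with corners of `T*M`; the model space is `F × F*`. -/
abbrev cotModel : ModelWithCorners ℝ (F × (F →L[ℝ] ℝ)) (ModelProd F (F →L[ℝ] ℝ)) :=
  𝓘(ℝ, F).prod 𝓘(ℝ, F →L[ℝ] ℝ)

variable {M}

/-- Canonical coordinates on `T*M` over the domain of the chart of `M` around `p`:
`(x, ζ) ↦ (xⁱ, ζᵢ)`. -/
def cotChart (p : M) : PartialEquiv (CotangentBundle F M) (F × (F →L[ℝ] ℝ)) :=
  extChartAt (cotModel F) (⟨p, 0⟩ : CotangentBundle F M)

/-- The differential at `x` of the chart of `M` around `p`: components of tangent vectors. -/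
def tangentCoord (p x : M) : TangentSpace 𝓘(ℝ, F) x →L[ℝ] F :=
  mfderiv 𝓘(ℝ, F) 𝓘(ℝ, F) (extChartAt 𝓘(ℝ, F) p) x

/-- Components of a vector field `E` in the chart around `p`: the functions `Eⁱ`. -/
def vectorRep (E : ∀ x : M, TangentSpace 𝓘(ℝ, F) x) (p : M) (y : F) : F :=
  tangentCoord F p ((extChartAt 𝓘(ℝ, F) p).symm y) (E ((extChartAt 𝓘(ℝ, F) p).symm y))

/-- Components of a contravariant 2-tensor field `Λ`, seen as the bundle map
`T*M → TM`, `ζ ↦ Λⁱʲ ζⱼ ∂ᵢ`, in the chart around `p`: the functions `Λⁱʲ`. -/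
def bivectorRep (L : ∀ x : M, Cotangent F M x →L[ℝ] TangentSpace 𝓘(ℝ, F) x) (p : M) (y : F) :
    (F →L[ℝ] ℝ) →L[ℝ] F :=
  (tangentCoord F p ((extChartAt 𝓘(ℝ, F) p).symm y)).comp
    ((L ((extChartAt 𝓘(ℝ, F) p).symm y)).comp
      (ContinuousLinearMap.precomp ℝ (tangentCoord F p ((extChartAt 𝓘(ℝ, F) p).symm y))))

/-! ### Jacobi manifolds -/

variable (M)

/-- A Jacobi structure `(Λ, E)` on `M`: a smooth bivector field `Λ` (as the skew bundle map
`ζ ↦ Λⁱʲ ζⱼ ∂ᵢ`) and a smooth vector field `E` (the Reeb vector field) such that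
`[Λ, Λ] = 2 E ∧ Λ` and `L_E Λ = 0`. The two identities are written in every chart as
`Λᵖⁱ ∂ₚ Λʲᵏ + cycl(ijk) = Eⁱ Λʲᵏ + cycl(ijk)`, contracted with covectors `a, b, c`, and
`Eᵏ ∂ₖ Λⁱʲ - Λᵏʲ ∂ₖ Eⁱ - Λⁱᵏ ∂ₖ Eʲ = 0`, contracted with a covector `c` in the slot `j`. -/
structure JacobiStructure where
  /-- the bivector field -/
  Λ : ∀ x : M, Cotangent F M x →L[ℝ] TangentSpace 𝓘(ℝ, F) x
  /-- the Reeb vector field -/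
  E : ∀ x : M, TangentSpace 𝓘(ℝ, F) x
  skew : ∀ (x : M) (a b : Cotangent F M x), a (Λ x b) = -b (Λ x a)
  smooth_Λ : ∀ p : M, ContDiffOn ℝ ∞ (bivectorRep F Λ p) (extChartAt 𝓘(ℝ, F) p).target
  smooth_E : ∀ p : M, ContDiffOn ℝ ∞ (vectorRep F E p) (extChartAt 𝓘(ℝ, F) p).target
  jacobi : ∀ p : M, ∀ y ∈ (extChartAt 𝓘(ℝ, F) p).target, ∀ a b c : F →L[ℝ] ℝ,
    b (fderiv ℝ (bivectorRep F Λ p) y (bivectorRep F Λ p y a) c)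
      + c (fderiv ℝ (bivectorRep F Λ p) y (bivectorRep F Λ p y b) a)
      + a (fderiv ℝ (bivectorRep F Λ p) y (bivectorRep F Λ p y c) b)
    = a (vectorRep F E p y) * b (bivectorRep F Λ p y c)
      + b (vectorRep F E p y) * c (bivectorRep F Λ p y a)
      + c (vectorRep F E p y) * a (bivectorRep F Λ p y b)
  lie : ∀ p : M, ∀ y ∈ (extChartAt 𝓘(ℝ, F) p).target, ∀ c : F →L[ℝ] ℝ,
    fderiv ℝ (bivectorRep F Λ p) y (vectorRep F E p y) c
      - fderiv ℝ (vectorRep F E p) y (bivectorRep F Λ p y c)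
      - bivectorRep F Λ p y (c.comp (fderiv ℝ (vectorRep F E p) y)) = 0

/-! ### Fields on the interval and the constraint manifold -/

/-- The fields `(X, ζ, λ_u)` of the model on the interval `I = [0,1]` (only the values on `I`
matter): a path `X` in `M`, a covector `ζ` along `X`, and a function `λ_u`. -/
structure Fields where
  X : ℝ → M
  ζ : ∀ u : ℝ, Cotangent F M (X u)
  lam : ℝ → ℝ

variable {F M}

/-- The path `u ↦ (X(u), ζ(u))` in `T*M`. -/
def Fields.path (c : Fields F M) (u : ℝ) : CotangentBundle F M := ⟨c.X u, c.ζ u⟩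

/-- The constraint manifold `𝒞`: `X` is `C¹`, `ζ` and `λ_u` are continuous, and
`X' + Λ ζ - λ_u E = 0` and `ζ(E) = 0` hold on `I`. -/
structure InConstraintManifold (J : JacobiStructure F M) (c : Fields F M) : Prop where
  contMDiffOn_X : ContMDiffOn 𝓘(ℝ, ℝ) 𝓘(ℝ, F) 1 c.X (Icc 0 1)
  continuousOn_ζ : ContinuousOn c.path (Icc 0 1)
  continuousOn_lam : ContinuousOn c.lam (Icc 0 1)
  eq_X : ∀ u ∈ Icc (0 : ℝ) 1,
    mfderivWithin 𝓘(ℝ, ℝ) 𝓘(ℝ, F) c.X (Icc 0 1) u (1 : ℝ)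
      + J.Λ (c.X u) (c.ζ u) - c.lam u • J.E (c.X u) = 0
  eq_ζ : ∀ u ∈ Icc (0 : ℝ) 1, c.ζ u (J.E (c.X u)) = 0

/-! ### The tangent space of the constraint manifold -/

/-- Infinitesimal variations of `c`: for every `u` a tangent vector `(X̃, ζ̃)(u)` to `T*M` at
`(X(u), ζ(u))` and a number `λ̃_u(u)`. -/
abbrev Variation (c : Fields F M) : Type _ :=
  (∀ u : ℝ, TangentSpace (cotModel F) (c.path u)) × (ℝ → ℝ)

/-- The part of `I` that `X` maps into the domain of the chart around `p`. -/
def chartPart (c : Fields F M) (p : M) : Set ℝ :=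
  {u | u ∈ Icc (0 : ℝ) 1 ∧ c.X u ∈ (extChartAt 𝓘(ℝ, F) p).source}

/-- The components `(X̃ⁱ, ζ̃ᵢ)(u)` of a variation in the canonical coordinates of `T*M` over the
chart around `p` (meaningful for `u ∈ chartPart c p`). -/
def Variation.rep {c : Fields F M} (v : Variation c) (p : M) (u : ℝ) : F × (F →L[ℝ] ℝ) :=
  mfderiv (cotModel F) 𝓘(ℝ, F × (F →L[ℝ] ℝ)) (cotChart F p) (c.path u) (v.1 u)

/-- The zeroth order part of the first constraint in coordinates:
`(x, ζ, λ) ↦ Λⁱʲ(x) ζⱼ - Eⁱ(x) λ`. -/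
def JacobiStructure.drift (J : JacobiStructure F M) (p : M) (z : F × (F →L[ℝ] ℝ) × ℝ) : F :=
  bivectorRep F J.Λ p z.1 z.2.1 - z.2.2 • vectorRep F J.E p z.1

/-- The second constraint in coordinates: `(x, ζ) ↦ Eⁱ(x) ζᵢ`. -/
def JacobiStructure.reebPairing (J : JacobiStructure F M) (p : M) (z : F × (F →L[ℝ] ℝ)) : ℝ :=
  z.2 (vectorRep F J.E p z.1)

/-- `v` is tangent to the constraint manifold at `c`: `X̃` is differentiable, `ζ̃` and `λ̃_u` are
continuous, and in every chart the linearised constraints hold on `I`. Variations are normalised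
to vanish outside `I`. (By the first linearised constraint, `X̃` is then `C¹`.) -/
structure IsTangent (J : JacobiStructure F M) (c : Fields F M) (v : Variation c) : Prop where
  zero_fst : ∀ u ∉ Icc (0 : ℝ) 1, v.1 u = 0
  zero_snd : ∀ u ∉ Icc (0 : ℝ) 1, v.2 u = 0
  continuousOn_rep : ∀ p : M, ContinuousOn (v.rep p) (chartPart c p)
  continuousOn_snd : ContinuousOn v.2 (Icc 0 1)
  lin_X : ∀ p : M, ∀ u ∈ chartPart c p,
    HasDerivWithinAt (fun s => (v.rep p s).1)
      (-(fderiv ℝ (J.drift p)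
          ((cotChart F p (c.path u)).1, (cotChart F p (c.path u)).2, c.lam u)
          ((v.rep p u).1, (v.rep p u).2, v.2 u)))
      (Icc 0 1) u
  lin_ζ : ∀ p : M, ∀ u ∈ chartPart c p,
    fderiv ℝ (J.reebPairing p) (cotChart F p (c.path u)) (v.rep p u) = 0

lemma Variation.rep_add {c : Fields F M} (v w : Variation c) (p : M) (u : ℝ) :
    (v + w).rep p u = v.rep p u + w.rep p u := by
  simp only [Variation.rep, Prod.fst_add, Pi.add_apply]
  exact map_add _ _ _

lemma Variation.rep_smul {c : Fields F M} (r : ℝ) (v : Variation c) (p : M) (u : ℝ) :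
    (r • v).rep p u = r • v.rep p u := by
  simp only [Variation.rep, Prod.smul_fst, Pi.smul_apply]
  exact map_smul _ _ _

lemma Variation.rep_zero {c : Fields F M} (p : M) (u : ℝ) :
    (0 : Variation c).rep p u = 0 := by
  simp only [Variation.rep, Prod.fst_zero, Pi.zero_apply]
  exact map_zero _

/-- The tangent space `T_c 𝒞`. -/
def tangentSpaceC (J : JacobiStructure F M) (c : Fields F M) : Submodule ℝ (Variation c) where
  carrier := {v | IsTangent J c v}
  zero_mem' := by
    refine ⟨fun _ _ => rfl, fun _ _ => rfl, fun p => ?_, continuousOn_const, fun p u _ => ?_,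
      fun p u _ => ?_⟩
    · have : (0 : Variation c).rep p = fun _ => 0 := funext (Variation.rep_zero p)
      rw [this]; exact continuousOn_const
    · simp only [Variation.rep_zero]
      have h0 : (((0 : F × (F →L[ℝ] ℝ)).1, (0 : F × (F →L[ℝ] ℝ)).2, (0 : Variation c).2 u) :
          F × (F →L[ℝ] ℝ) × ℝ) = 0 := rfl
      rw [h0, map_zero, neg_zero]
      exact hasDerivWithinAt_const _ _ _
    · rw [Variation.rep_zero, map_zero]
  add_mem' := by
    intro v w hv hw
    refine ⟨fun u hu => ?_, fun u hu => ?_, fun p => ?_, ?_, fun p u hu => ?_, fun p u hu => ?_⟩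
    · simp [hv.zero_fst u hu, hw.zero_fst u hu]
    · simp [hv.zero_snd u hu, hw.zero_snd u hu]
    · have : (v + w).rep p = fun u => v.rep p u + w.rep p u := funext (Variation.rep_add v w p)
      rw [this]; exact (hv.continuousOn_rep p).add (hw.continuousOn_rep p)
    · exact hv.continuousOn_snd.add hw.continuousOn_snd
    · simp only [Variation.rep_add]
      have h0 : (((v.rep p u + w.rep p u).1, (v.rep p u + w.rep p u).2, (v + w).2 u) :
          F × (F →L[ℝ] ℝ) × ℝ) = ((v.rep p u).1, (v.rep p u).2, v.2 u)
            + ((w.rep p u).1, (w.rep p u).2, w.2 u) := rfl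
      rw [h0, map_add, neg_add]
      exact (hv.lin_X p u hu).add (hw.lin_X p u hu)
    · rw [Variation.rep_add, map_add, hv.lin_ζ p u hu, hw.lin_ζ p u hu, add_zero]
  smul_mem' := by
    intro r v hv
    refine ⟨fun u hu => ?_, fun u hu => ?_, fun p => ?_, ?_, fun p u hu => ?_, fun p u hu => ?_⟩
    · simp [hv.zero_fst u hu]
    · simp [hv.zero_snd u hu]
    · have : (r • v).rep p = fun u => r • v.rep p u := funext (Variation.rep_smul r v p)
      rw [this]; exact (hv.continuousOn_rep p).const_smul r
    · exact hv.continuousOn_snd.const_smul r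
    · simp only [Variation.rep_smul]
      have h0 : (((r • v.rep p u).1, (r • v.rep p u).2, (r • v).2 u) :
          F × (F →L[ℝ] ℝ) × ℝ) = r • ((v.rep p u).1, (v.rep p u).2, v.2 u) := rfl
      rw [h0, map_smul, ← smul_neg]
      exact (hv.lin_X p u hu).const_smul r
    · rw [Variation.rep_smul, map_smul, hv.lin_ζ p u hu, smul_zero]

/-- The variations that leave `λ_u` fixed, `λ̃_u = 0`. -/
def fixedLam (c : Fields F M) : Submodule ℝ (Variation c) :=
  LinearMap.ker (LinearMap.snd ℝ (∀ u : ℝ, TangentSpace (cotModel F) (c.path u)) (ℝ → ℝ))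

/-- The topology of uniform convergence on `I`: a net of variations converges if its `λ̃_u` converge
uniformly on `I` and its components in each chart converge uniformly on the compact
subsets of `I` that `X` maps into the chart. On `T_c 𝒞` the linearised constraint makes this the
same as `C¹` convergence of `X̃` with uniform convergence of `ζ̃` and `λ̃_u`. -/
@[reducible] def variationTopology (c : Fields F M) : TopologicalSpace (Variation c) :=
  (⨅ p : M, TopologicalSpace.induced
      (fun v : Variation c =>
        UniformOnFun.ofFun {K : Set ℝ | IsCompact K ∧ K ⊆ chartPart c p} (v.rep p))
      inferInstance)
    ⊓ TopologicalSpace.induced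
      (fun v : Variation c => UniformOnFun.ofFun {Icc (0 : ℝ) 1} v.2) inferInstance

/-- `S` is contained in `T`, is closed in `T` and has codimension `d` in `T`. -/
def IsClosedOfCodim {c : Fields F M} (T S : Submodule ℝ (Variation c)) (d : ℕ) : Prop :=
  S ≤ T ∧
  IsClosed[(variationTopology c).induced (Subtype.val : T → Variation c)]
    {v : T | (v : Variation c) ∈ S} ∧
  Module.rank ℝ (T ⧸ S.submoduleOf T) = d

/-! ### Gauge generators -/

/-- Gauge parameters `(β, λ_t)` at the fields `c`: a covector `β` along `X` and a function `λ_t`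
on `I` (only the values on `I` matter). -/
structure GaugeParam (c : Fields F M) where
  β : ∀ u : ℝ, Cotangent F M (c.X u)
  lamt : ℝ → ℝ

/-- The path `u ↦ (X(u), β(u))` in `T*M`. -/
def GaugeParam.path {c : Fields F M} (g : GaugeParam c) (u : ℝ) : CotangentBundle F M :=
  ⟨c.X u, g.β u⟩

/-- Admissible gauge parameters: `β` and `λ_t` are `C¹`, `β(E) = 0`, and `β` vanishes at the
endpoints of `I`; there is no boundary condition on `λ_t`. -/
structure GaugeParam.Admissible (J : JacobiStructure F M) {c : Fields F M} (g : GaugeParam c) :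
    Prop where
  contMDiffOn_β : ContMDiffOn 𝓘(ℝ, ℝ) (cotModel F) 1 g.path (Icc 0 1)
  contDiffOn_lamt : ContDiffOn ℝ 1 g.lamt (Icc 0 1)
  reeb : ∀ u ∈ Icc (0 : ℝ) 1, g.β u (J.E (c.X u)) = 0
  β_zero : g.β 0 = 0
  β_one : g.β 1 = 0

/-- `v` is the value at `c` of the Hamiltonian vector field `ξ_{β, λ_t}` of
`K(β, λ_t) = ∫ βᵢ (X'ⁱ + Λⁱʲ ζⱼ - Eⁱ λ_u) + λ_t Eⁱ ζᵢ`. In every chart,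
* `X̃ⁱ = {K, Xⁱ} = Λⁱʲ βⱼ - Eⁱ λ_t`,
* `ζ̃ᵢ = {K, ζᵢ} = - βᵢ' + βⱼ ∂ᵢΛʲᵏ ζₖ - λ_u βⱼ ∂ᵢEʲ + λ_t ζⱼ ∂ᵢEʲ`,
* `λ̃_u = -(λ_t' + Λⁱʲ βᵢ ζⱼ)`.
The last line is the variation of `λ_u` forced by the second class constraints. -/
structure IsGaugeVariation (J : JacobiStructure F M) {c : Fields F M} (g : GaugeParam c)
    (v : Variation c) : Prop where
  zero_fst : ∀ u ∉ Icc (0 : ℝ) 1, v.1 u = 0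
  zero_snd : ∀ u ∉ Icc (0 : ℝ) 1, v.2 u = 0
  eq_X : ∀ p : M, ∀ u ∈ chartPart c p,
    (v.rep p u).1 =
      bivectorRep F J.Λ p (cotChart F p (c.path u)).1 (cotChart F p (g.path u)).2
        - g.lamt u • vectorRep F J.E p (cotChart F p (c.path u)).1
  eq_ζ : ∀ p : M, ∀ u ∈ chartPart c p,
    (v.rep p u).2 =
      -derivWithin (fun s => (cotChart F p (g.path s)).2) (Icc 0 1) u
        + fderiv ℝ (fun y : F =>
            (cotChart F p (g.path u)).2
                (J.drift p (y, (cotChart F p (c.path u)).2, c.lam u))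
              + g.lamt u * J.reebPairing p (y, (cotChart F p (c.path u)).2))
          (cotChart F p (c.path u)).1
  eq_lam : ∀ u ∈ Icc (0 : ℝ) 1,
    v.2 u = -(derivWithin g.lamt (Icc 0 1) u + g.β u (J.Λ (c.X u) (c.ζ u)))

/-- The space spanned by the Hamiltonian vector fields `ξ_{β, λ_t}` at `c`. -/
def gaugeSpan (J : JacobiStructure F M) (c : Fields F M) : Submodule ℝ (Variation c) :=
  Submodule.span ℝ {v | ∃ g : GaugeParam c, g.Admissible J ∧ IsGaugeVariation J g v}

/-- The space spanned by those `ξ_{β, λ_t}` that leave `λ_u` fixed, that is, by those with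
`λ_t' = -Λⁱʲ βᵢ ζⱼ`. -/
def gaugeSpanFixedLam (J : JacobiStructure F M) (c : Fields F M) : Submodule ℝ (Variation c) :=
  Submodule.span ℝ {v | ∃ g : GaugeParam c, g.Admissible J ∧ IsGaugeVariation J g v ∧
    v ∈ fixedLam c}

end JacobiSigma

end

/-!
Fix `c = (X, ζ, λ_u)` on the constraint manifold. In a chart let `D` and `B` be the derivatives,
with respect to the base point, of the drift `Λζ - λ_u E` and of the pairing `ζ(E)`. Tangent vectors
satisfy
`X̃' = -D X̃ - Λζ̃ + λ̃_u E` and `ζ̃(E) + B(X̃) = 0`,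
and the formulas for the gauge variation of `(β, λ_t)` read `X̃ = Λβ - λ_t E` together with
`β' = -ζ̃ + β ∘ D + λ_t B` and `λ_t' = -λ̃_u - β(Λζ)`,
a linear differential equation for the gauge parameter (`GaugeEq`, `LamEq`).

The two identities of a Jacobi structure say how `Λ` and `E` are transported along the path
(`bivector_transport`, `reeb_transport`). They imply that the defects `W = X̃ - (Λβ - λ_t E)` and
`q = β(E)` of a solution `(β, λ_t)` of the differential equation satisfy a homogeneous linear
system. Hence gauge variations are tangent vectors (`isTangent_of_isGaugeVariation`), and a
tangent vector whose `X̃(0)` is a multiple of `E` is the gauge variation of some `(β, λ_t)` with `β(0) = 0` and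
`β(E) = 0`: solve the equation with `β(0) = 0` and the value of `λ_t(0)` that makes `W(0) = 0`
(`exists_gauge_of_isTangent`). Conversely `β(0) = 0` makes `X̃(0)` a multiple of `E`, and such a
gauge parameter is determined by the tangent vector; the only condition for admissibility that is
left is `β(1) = 0`. So there are exactly two obstructions for a tangent vector to be a gauge
direction:
* the class of `X̃(0)` modulo `E`, which is arbitrary (`exists_isTangent_initial`);
* if that class vanishes, the covector `β(1)`, an arbitrary element of the annihilator of `E`
  (`exists_gauge_final`).

Each of the two takes values in a space of dimension `m - 1`, since `E ≠ 0`, which gives the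
codimension `2m - 2` (`rank_quotient_of_relation`). The surjectivity statements produce vectors with
`λ̃_u = 0`, so the count is the same at fixed `λ_u`. Closedness holds because both obstructions are
stable under small perturbations: for `X̃(0)` this is evident, and for `β(1)` it is the Grönwall
estimate `eventually_bc_one_le`.

The charts are dealt with as follows. All the equations above are invariant under changes of charts
(`TangentEq.trans`, `GaugeEq.trans`), although the components of `ζ̃` are not tensorial, and
solutions are continued along the path over a subdivision of the interval whose pieces are mapped
into single charts (`path_induction`).
-/

set_option linter.unusedSectionVars false

noncomputable section

namespace JacobiSigma

variable {F : Type*} [NormedAddCommGroup F] [NormedSpace ℝ F]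
variable {M : Type*} [TopologicalSpace M] [ChartedSpace F M] [IsManifold 𝓘(ℝ, F) ∞ M]

/-! ### The canonical coordinates of the cotangent bundle -/

/-- The chart of `T*M` gives the coordinates of the base point and the components of the
covector. -/
lemma cotChart_eq (p : M) (z : CotangentBundle F M) (hz : z.1 ∈ (extChartAt 𝓘(ℝ, F) p).source) :
    (cotChart F p z).1 = extChartAt 𝓘(ℝ, F) p z.1 ∧
      ((cotChart F p z).2).comp (tangentCoord F p z.1) = z.2 := by
  have hz' : z.1 ∈ (chartAt F p).source := by simpa using hz
  have h1 : cotChart F p = (trivializationAt (F →L[ℝ] ℝ)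
      (fun x : M => TangentSpace 𝓘(ℝ, F) x →L[ℝ] ℝ) p).toPartialEquiv ≫
        (extChartAt 𝓘(ℝ, F) p).prod (PartialEquiv.refl (F →L[ℝ] ℝ)) :=
    FiberBundle.extChartAt _
  rw [h1]
  constructor
  · rfl
  · have h2 := TangentBundle.symmL_trivializationAt (I := 𝓘(ℝ, F)) hz'
    have h3 := TangentBundle.continuousLinearMapAt_trivializationAt (I := 𝓘(ℝ, F)) hz'
    have h4 : (((trivializationAt (F →L[ℝ] ℝ)
      (fun x : M => TangentSpace 𝓘(ℝ, F) x →L[ℝ] ℝ) p).toPartialEquiv ≫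
        (extChartAt 𝓘(ℝ, F) p).prod (PartialEquiv.refl (F →L[ℝ] ℝ))) z).2 =
        ContinuousLinearMap.inCoordinates F (TangentSpace 𝓘(ℝ, F)) ℝ
          (fun _ : M => ℝ) p z.1 p z.1 z.2 := rfl
    rw [h4]
    ext v
    have h5 : (trivializationAt F (TangentSpace 𝓘(ℝ, F)) p).symmL ℝ z.1
        (tangentCoord F p z.1 v) = v := by
      rw [tangentCoord, ← h3]
      exact Bundle.Trivialization.symmL_continuousLinearMapAt _ (by simpa using hz') v
    simp only [ContinuousLinearMap.inCoordinates, ContinuousLinearMap.comp_apply]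
    rw [h5]
    simp

lemma tangentCoord_isInvertible (p x : M) (hx : x ∈ (extChartAt 𝓘(ℝ, F) p).source) :
    (tangentCoord F p x).IsInvertible := isInvertible_mfderiv_extChartAt hx

/-- The transition map from the chart around `p` to the chart around `q`. -/
def chartTrans (p q : M) : F → F := extChartAt 𝓘(ℝ, F) q ∘ (extChartAt 𝓘(ℝ, F) p).symm

/-- The domain of the transition map from the chart around `p` to the chart around `q`. -/
def overlap (p q : M) : Set F := ((extChartAt 𝓘(ℝ, F) p).symm ≫ extChartAt 𝓘(ℝ, F) q).source

/-- The Jacobian `∂x_q / ∂x_p` of the transition map, at the point with coordinates `y` in the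
chart around `p`. -/
def jac (p q : M) (y : F) : F →L[ℝ] F := fderiv ℝ (chartTrans p q) y

/-- The inverse Jacobian `∂x_p / ∂x_q`, as a function of the coordinates in the chart
around `p`. -/
def invJac (p q : M) (y : F) : F →L[ℝ] F := jac q p (chartTrans p q y)

lemma isOpen_overlap (p q : M) : IsOpen (overlap (F := F) p q) := by
  have := (continuousOn_extChartAt_symm (I := 𝓘(ℝ, F)) p).isOpen_inter_preimage
    (isOpen_extChartAt_target p) (isOpen_extChartAt_source (I := 𝓘(ℝ, F)) q)
  simpa [overlap, PartialEquiv.trans_source] using this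

lemma mem_overlap {p q x : M} (hp : x ∈ (extChartAt 𝓘(ℝ, F) p).source)
    (hq : x ∈ (extChartAt 𝓘(ℝ, F) q).source) : extChartAt 𝓘(ℝ, F) p x ∈ overlap (F := F) p q := by
  refine ⟨(extChartAt 𝓘(ℝ, F) p).map_source hp, ?_⟩
  change (extChartAt 𝓘(ℝ, F) p).symm (extChartAt 𝓘(ℝ, F) p x) ∈ (extChartAt 𝓘(ℝ, F) q).source
  rwa [(extChartAt 𝓘(ℝ, F) p).left_inv hp]

lemma chartTrans_extChartAt {p : M} (q : M) {x : M} (hp : x ∈ (extChartAt 𝓘(ℝ, F) p).source) :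
    chartTrans p q (extChartAt 𝓘(ℝ, F) p x) = extChartAt 𝓘(ℝ, F) q x := by
  rw [chartTrans, Function.comp_apply, (extChartAt 𝓘(ℝ, F) p).left_inv hp]

lemma exists_of_mem_overlap {p q : M} {y : F} (hy : y ∈ overlap p q) :
    ∃ x : M, x ∈ (extChartAt 𝓘(ℝ, F) p).source ∧ x ∈ (extChartAt 𝓘(ℝ, F) q).source ∧
      extChartAt 𝓘(ℝ, F) p x = y :=
  ⟨(extChartAt 𝓘(ℝ, F) p).symm y, (extChartAt 𝓘(ℝ, F) p).map_target hy.1, hy.2,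
    (extChartAt 𝓘(ℝ, F) p).right_inv hy.1⟩

lemma chartTrans_mem_overlap {p q : M} {y : F} (hy : y ∈ overlap p q) :
    chartTrans p q y ∈ overlap q p := by
  obtain ⟨x, hp, hq, rfl⟩ := exists_of_mem_overlap hy
  rw [chartTrans_extChartAt q hp]
  exact mem_overlap hq hp

lemma chartTrans_chartTrans {p q : M} {y : F} (hy : y ∈ overlap p q) :
    chartTrans q p (chartTrans p q y) = y := by
  obtain ⟨x, hp, hq, rfl⟩ := exists_of_mem_overlap hy
  rw [chartTrans_extChartAt q hp, chartTrans_extChartAt p hq]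

lemma contDiffAt_chartTrans {p q : M} {y : F} (hy : y ∈ overlap p q) :
    ContDiffAt ℝ ∞ (chartTrans p q) y :=
  (contDiffOn_ext_coord_change (I := 𝓘(ℝ, F)) q p).contDiffAt ((isOpen_overlap p q).mem_nhds hy)

lemma hasFDerivAt_chartTrans {p q : M} {y : F} (hy : y ∈ overlap p q) :
    HasFDerivAt (chartTrans p q) (jac p q y) y :=
  ((contDiffAt_chartTrans hy).differentiableAt (by simp)).hasFDerivAt

lemma contDiffAt_jac {p q : M} {y : F} (hy : y ∈ overlap p q) : ContDiffAt ℝ ∞ (jac p q) y :=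
  (contDiffAt_chartTrans hy).fderiv_right (by simp)

lemma contDiffAt_invJac {p q : M} {y : F} (hy : y ∈ overlap p q) :
    ContDiffAt ℝ ∞ (invJac p q) y :=
  (contDiffAt_jac (chartTrans_mem_overlap hy)).comp y (contDiffAt_chartTrans hy)

lemma hasFDerivAt_jac {p q : M} {y : F} (hy : y ∈ overlap p q) :
    HasFDerivAt (jac p q) (fderiv ℝ (jac p q) y) y :=
  ((contDiffAt_jac hy).differentiableAt (by simp)).hasFDerivAt

lemma hasFDerivAt_invJac {p q : M} {y : F} (hy : y ∈ overlap p q) :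
    HasFDerivAt (invJac p q) (fderiv ℝ (invJac p q) y) y :=
  ((contDiffAt_invJac hy).differentiableAt (by simp)).hasFDerivAt

lemma invJac_comp_jac {p q : M} {y : F} (hy : y ∈ overlap p q) :
    (invJac p q y).comp (jac p q y) = .id ℝ F := by
  have h := (hasFDerivAt_chartTrans (chartTrans_mem_overlap hy)).comp y (hasFDerivAt_chartTrans hy)
  refine h.unique ((hasFDerivAt_id y).congr_of_eventuallyEq ?_)
  filter_upwards [(isOpen_overlap p q).mem_nhds hy] with z hz
  exact chartTrans_chartTrans hz

lemma invJac_jac_apply {p q : M} {y : F} (hy : y ∈ overlap p q) (w : F) :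
    invJac p q y (jac p q y w) = w :=
  DFunLike.congr_fun (invJac_comp_jac hy) w

lemma jac_invJac_apply {p q : M} {y : F} (hy : y ∈ overlap p q) (w : F) :
    jac p q y (invJac p q y w) = w := by
  have h := DFunLike.congr_fun (invJac_comp_jac (chartTrans_mem_overlap hy)) w
  rwa [invJac, chartTrans_chartTrans hy] at h

/-- Differentiating `invJac ∘ jac = id`. -/
lemma fderiv_invJac_jac {p q : M} {y : F} (hy : y ∈ overlap p q) (v w : F) :
    fderiv ℝ (invJac p q) y v (jac p q y w) = -invJac p q y (fderiv ℝ (jac p q) y v w) := by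
  have h := (hasFDerivAt_invJac hy).clm_apply ((hasFDerivAt_jac hy).clm_apply
    (hasFDerivAt_const w y))
  have h0 : HasFDerivAt (fun z => invJac p q z (jac p q z w)) (0 : F →L[ℝ] F) y := by
    refine (hasFDerivAt_const w y).congr_of_eventuallyEq ?_
    filter_upwards [(isOpen_overlap p q).mem_nhds hy] with z hz
    exact invJac_jac_apply hz w
  have := DFunLike.congr_fun (h.unique h0) v
  simp at this
  rw [eq_neg_iff_add_eq_zero, add_comm]
  exact this

/-- The second derivative of the transition map is symmetric. -/
lemma fderiv_jac_symm {p q : M} {y : F} (hy : y ∈ overlap p q) (v w : F) :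
    fderiv ℝ (jac p q) y v w = fderiv ℝ (jac p q) y w v :=
  (contDiffAt_chartTrans hy).isSymmSndFDerivAt
    (by simpa using WithTop.coe_le_coe.2 (le_top : (2 : ℕ∞) ≤ ⊤)) v w

lemma tangentCoord_trans {p q x : M} (hp : x ∈ (extChartAt 𝓘(ℝ, F) p).source)
    (hq : x ∈ (extChartAt 𝓘(ℝ, F) q).source) (v : TangentSpace 𝓘(ℝ, F) x) :
    tangentCoord F q x v = jac p q (extChartAt 𝓘(ℝ, F) p x) (tangentCoord F p x v) := by
  have hy := mem_overlap hp hq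
  have h1 : HasMFDerivAt 𝓘(ℝ, F) 𝓘(ℝ, F) (extChartAt 𝓘(ℝ, F) p) x (tangentCoord F p x) :=
    (mdifferentiableAt_extChartAt (by simpa using hp)).hasMFDerivAt
  have h2 := (hasFDerivAt_chartTrans hy).hasMFDerivAt.comp x h1
  have h3 : HasMFDerivAt 𝓘(ℝ, F) 𝓘(ℝ, F) (extChartAt 𝓘(ℝ, F) q) x (tangentCoord F q x) :=
    (mdifferentiableAt_extChartAt (by simpa using hq)).hasMFDerivAt
  have h4 : extChartAt 𝓘(ℝ, F) q =ᶠ[𝓝 x] chartTrans p q ∘ extChartAt 𝓘(ℝ, F) p := by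
    filter_upwards [(isOpen_extChartAt_source (I := 𝓘(ℝ, F)) p).mem_nhds hp] with z hz
    exact (chartTrans_extChartAt q hz).symm
  have h5 := (h2.congr_of_eventuallyEq h4)
  exact DFunLike.congr_fun (hasMFDerivAt_unique h3 h5) v

lemma vectorRep_extChartAt (E : ∀ x : M, TangentSpace 𝓘(ℝ, F) x) {p x : M}
    (hp : x ∈ (extChartAt 𝓘(ℝ, F) p).source) :
    vectorRep F E p (extChartAt 𝓘(ℝ, F) p x) = tangentCoord F p x (E x) := by
  simp only [vectorRep]
  rw [(extChartAt 𝓘(ℝ, F) p).left_inv hp]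

lemma bivectorRep_extChartAt (L : ∀ x : M, Cotangent F M x →L[ℝ] TangentSpace 𝓘(ℝ, F) x) {p x : M}
    (hp : x ∈ (extChartAt 𝓘(ℝ, F) p).source) (a : F →L[ℝ] ℝ) :
    bivectorRep F L p (extChartAt 𝓘(ℝ, F) p x) a =
      tangentCoord F p x (L x (a.comp (tangentCoord F p x))) := by
  simp only [bivectorRep]
  rw [(extChartAt 𝓘(ℝ, F) p).left_inv hp]
  rfl

lemma vectorRep_trans (E : ∀ x : M, TangentSpace 𝓘(ℝ, F) x) {p q : M} {y : F}
    (hy : y ∈ overlap p q) :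
    vectorRep F E q (chartTrans p q y) = jac p q y (vectorRep F E p y) := by
  obtain ⟨x, hp, hq, rfl⟩ := exists_of_mem_overlap hy
  rw [chartTrans_extChartAt q hp, vectorRep_extChartAt E hp, vectorRep_extChartAt E hq,
    tangentCoord_trans hp hq]

lemma bivectorRep_trans (L : ∀ x : M, Cotangent F M x →L[ℝ] TangentSpace 𝓘(ℝ, F) x) {p q : M}
    {y : F} (hy : y ∈ overlap p q) (a : F →L[ℝ] ℝ) :
    bivectorRep F L q (chartTrans p q y) (a.comp (invJac p q y)) =
      jac p q y (bivectorRep F L p y a) := by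
  obtain ⟨x, hp, hq, rfl⟩ := exists_of_mem_overlap hy
  rw [chartTrans_extChartAt q hp, bivectorRep_extChartAt L hp, bivectorRep_extChartAt L hq,
    ← tangentCoord_trans hp hq]
  congr 2
  ext v
  simp only [ContinuousLinearMap.comp_apply]
  rw [tangentCoord_trans hp hq, invJac_jac_apply hy]

/-- Covector components transform with the inverse Jacobian. -/
lemma cotChart_trans {p q : M} (z : CotangentBundle F M)
    (hp : z.1 ∈ (extChartAt 𝓘(ℝ, F) p).source) (hq : z.1 ∈ (extChartAt 𝓘(ℝ, F) q).source) :
    (cotChart F q z).2 =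
      (cotChart F p z).2.comp (invJac p q (extChartAt 𝓘(ℝ, F) p z.1)) := by
  have hy := mem_overlap hp hq
  obtain ⟨-, h1⟩ := cotChart_eq p z hp
  obtain ⟨-, h2⟩ := cotChart_eq q z hq
  ext v
  obtain ⟨w, hw⟩ := (tangentCoord_isInvertible p z.1 hp).surjective
    (invJac p q (extChartAt 𝓘(ℝ, F) p z.1) v)
  have e1 := (DFunLike.congr_fun h1 w).trans (DFunLike.congr_fun h2 w).symm
  simp only [ContinuousLinearMap.comp_apply] at e1 ⊢
  rw [tangentCoord_trans hp hq, hw, jac_invJac_apply hy] at e1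
  exact e1.symm

/-- The transition map of `T*M` from the canonical coordinates over the chart around `p` to those
over the chart around `q`. -/
def cotTrans (p q : M) (z : F × (F →L[ℝ] ℝ)) : F × (F →L[ℝ] ℝ) :=
  (chartTrans p q z.1, z.2.comp (invJac p q z.1))

lemma hasFDerivAt_cotTrans {p q : M} {z : F × (F →L[ℝ] ℝ)} (hz : z.1 ∈ overlap p q) :
    ∃ G : (F × (F →L[ℝ] ℝ)) →L[ℝ] (F × (F →L[ℝ] ℝ)), HasFDerivAt (cotTrans p q) G z ∧
      ∀ v, G v = (jac p q z.1 v.1,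
        v.2.comp (invJac p q z.1) + z.2.comp (fderiv ℝ (invJac p q) z.1 v.1)) := by
  have h1 := (hasFDerivAt_chartTrans hz).comp z (hasFDerivAt_fst (𝕜 := ℝ))
  have h2 := (hasFDerivAt_snd (𝕜 := ℝ) (p := z)).clm_comp
    ((hasFDerivAt_invJac hz).comp z (hasFDerivAt_fst (𝕜 := ℝ)))
  refine ⟨_, h1.prodMk h2, fun v => ?_⟩
  ext <;> simp [add_comm]

lemma cotChart_eq_cotTrans {p q : M} (z : CotangentBundle F M)
    (hp : z.1 ∈ (extChartAt 𝓘(ℝ, F) p).source) (hq : z.1 ∈ (extChartAt 𝓘(ℝ, F) q).source) :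
    cotChart F q z = cotTrans p q (cotChart F p z) := by
  refine Prod.ext ?_ ?_
  · simp only [cotTrans]
    rw [(cotChart_eq p z hp).1, (cotChart_eq q z hq).1, chartTrans_extChartAt q hp]
  · rw [cotChart_trans z hp hq]
    simp only [cotTrans]
    rw [(cotChart_eq p z hp).1]

lemma mem_cotChart_source {p : M} {z : CotangentBundle F M}
    (hp : z.1 ∈ (extChartAt 𝓘(ℝ, F) p).source) : z ∈ (cotChart F p).source := by
  have hp' : z.1 ∈ (chartAt F p).source := by simpa using hp
  simp only [cotChart, extChartAt_source, FiberBundle.chartedSpace_chartAt]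
  simp [hp']

/-- Transformation law of the components of a variation: `X̃_q = ∂φ X̃_p` and
`ζ̃_q = ζ̃_p (∂φ)⁻¹ + ζ_p d(∂φ)⁻¹(X̃_p)`, with `φ` the transition map. -/
lemma Variation.rep_trans {c : Fields F M} (v : Variation c) {p q : M} {u : ℝ}
    (hp : c.X u ∈ (extChartAt 𝓘(ℝ, F) p).source) (hq : c.X u ∈ (extChartAt 𝓘(ℝ, F) q).source) :
    v.rep q u = (jac p q (extChartAt 𝓘(ℝ, F) p (c.X u)) (v.rep p u).1,
      (v.rep p u).2.comp (invJac p q (extChartAt 𝓘(ℝ, F) p (c.X u))) +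
        (cotChart F p (c.path u)).2.comp
          (fderiv ℝ (invJac p q) (extChartAt 𝓘(ℝ, F) p (c.X u)) (v.rep p u).1)) := by
  have hy := mem_overlap hp hq
  obtain ⟨e1, -⟩ := cotChart_eq p (c.path u) hp
  change (cotChart F p (c.path u)).1 = extChartAt 𝓘(ℝ, F) p (c.X u) at e1
  rw [← e1] at hy ⊢
  obtain ⟨G, hG, hG'⟩ := hasFDerivAt_cotTrans hy
  rw [← hG']
  have h1 : HasMFDerivAt (cotModel F) 𝓘(ℝ, F × (F →L[ℝ] ℝ)) (cotChart F p) (c.path u)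
      (mfderiv (cotModel F) 𝓘(ℝ, F × (F →L[ℝ] ℝ)) (cotChart F p) (c.path u)) :=
    (mdifferentiableAt_extChartAt (by simpa [cotChart] using mem_cotChart_source hp)).hasMFDerivAt
  have h3 : HasMFDerivAt (cotModel F) 𝓘(ℝ, F × (F →L[ℝ] ℝ)) (cotChart F q) (c.path u)
      (mfderiv (cotModel F) 𝓘(ℝ, F × (F →L[ℝ] ℝ)) (cotChart F q) (c.path u)) :=
    (mdifferentiableAt_extChartAt (by simpa [cotChart] using mem_cotChart_source hq)).hasMFDerivAt
  have h2 := hG.hasMFDerivAt.comp (c.path u) h1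
  have h4 : cotChart F q =ᶠ[𝓝 (c.path u)] cotTrans p q ∘ cotChart F p := by
    have c1 : Continuous (fun z : CotangentBundle F M => z.1) :=
      FiberBundle.continuous_proj (F →L[ℝ] ℝ) (fun x : M => TangentSpace 𝓘(ℝ, F) x →L[ℝ] ℝ)
    filter_upwards [((isOpen_extChartAt_source (I := 𝓘(ℝ, F)) p).preimage c1).mem_nhds hp,
      ((isOpen_extChartAt_source (I := 𝓘(ℝ, F)) q).preimage c1).mem_nhds hq] with z hz hz'
    exact cotChart_eq_cotTrans z hz hz'
  exact DFunLike.congr_fun (hasMFDerivAt_unique h3 (h2.congr_of_eventuallyEq h4)) (v.1 u)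

/-! ### Derivatives of the constraints, and the Jacobi identities along a solution -/

namespace JacobiStructure

variable (J : JacobiStructure F M)

/-- The derivative of the drift `Λⁱʲ ζⱼ - λ Eⁱ` with respect to the base point. -/
def driftD (p : M) (y : F) (z : F →L[ℝ] ℝ) (l : ℝ) : F →L[ℝ] F :=
  (fderiv ℝ (bivectorRep F J.Λ p) y).flip z - l • fderiv ℝ (vectorRep F J.E p) y

/-- The derivative of the pairing `Eⁱ ζᵢ` with respect to the base point. -/
def reebD (p : M) (y : F) (z : F →L[ℝ] ℝ) : F →L[ℝ] ℝ :=
  z.comp (fderiv ℝ (vectorRep F J.E p) y)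

lemma driftD_apply (p : M) (y : F) (z : F →L[ℝ] ℝ) (l : ℝ) (v : F) :
    J.driftD p y z l v = fderiv ℝ (bivectorRep F J.Λ p) y v z
      - l • fderiv ℝ (vectorRep F J.E p) y v := by
  simp [driftD]

lemma reebD_apply (p : M) (y : F) (z : F →L[ℝ] ℝ) (v : F) :
    J.reebD p y z v = z (fderiv ℝ (vectorRep F J.E p) y v) := rfl

variable {p : M} {y : F}

lemma contDiffAt_bivectorRep (hy : y ∈ (extChartAt 𝓘(ℝ, F) p).target) :
    ContDiffAt ℝ ∞ (bivectorRep F J.Λ p) y :=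
  (J.smooth_Λ p).contDiffAt ((isOpen_extChartAt_target p).mem_nhds hy)

lemma contDiffAt_vectorRep (hy : y ∈ (extChartAt 𝓘(ℝ, F) p).target) :
    ContDiffAt ℝ ∞ (vectorRep F J.E p) y :=
  (J.smooth_E p).contDiffAt ((isOpen_extChartAt_target p).mem_nhds hy)

lemma hasFDerivAt_bivectorRep (hy : y ∈ (extChartAt 𝓘(ℝ, F) p).target) :
    HasFDerivAt (bivectorRep F J.Λ p) (fderiv ℝ (bivectorRep F J.Λ p) y) y :=
  ((J.contDiffAt_bivectorRep hy).differentiableAt (by simp)).hasFDerivAt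

lemma hasFDerivAt_vectorRep (hy : y ∈ (extChartAt 𝓘(ℝ, F) p).target) :
    HasFDerivAt (vectorRep F J.E p) (fderiv ℝ (vectorRep F J.E p) y) y :=
  ((J.contDiffAt_vectorRep hy).differentiableAt (by simp)).hasFDerivAt

lemma bivectorRep_skew (p : M) (y : F) (a b : F →L[ℝ] ℝ) :
    a (bivectorRep F J.Λ p y b) = -b (bivectorRep F J.Λ p y a) :=
  J.skew ((extChartAt 𝓘(ℝ, F) p).symm y) (a.comp (tangentCoord F p _)) (b.comp (tangentCoord F p _))

lemma fderiv_bivectorRep_skew (hy : y ∈ (extChartAt 𝓘(ℝ, F) p).target) (v : F)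
    (a b : F →L[ℝ] ℝ) :
    a (fderiv ℝ (bivectorRep F J.Λ p) y v b) = -b (fderiv ℝ (bivectorRep F J.Λ p) y v a) := by
  have h (a b : F →L[ℝ] ℝ) := a.hasFDerivAt.comp y
    ((J.hasFDerivAt_bivectorRep hy).clm_apply (hasFDerivAt_const b y))
  have h1 := h a b
  rw [show (a ∘ fun x => bivectorRep F J.Λ p x b) =
      fun x => -(b ∘ fun x => bivectorRep F J.Λ p x a) x
    from funext fun x => J.bivectorRep_skew p x a b] at h1
  simpa using DFunLike.congr_fun (h1.unique (h b a).neg) v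

lemma hasFDerivAt_drift (hy : y ∈ (extChartAt 𝓘(ℝ, F) p).target) (z : F →L[ℝ] ℝ) (l : ℝ) :
    ∃ G : F × (F →L[ℝ] ℝ) × ℝ →L[ℝ] F, HasFDerivAt (J.drift p) G (y, z, l) ∧ ∀ v, G v =
      J.driftD p y z l v.1 + bivectorRep F J.Λ p y v.2.1 - v.2.2 • vectorRep F J.E p y := by
  have h1 : HasFDerivAt (fun w : F × (F →L[ℝ] ℝ) × ℝ => w.1)
    (.fst ℝ F ((F →L[ℝ] ℝ) × ℝ)) (y, z, l) := hasFDerivAt_fst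
  have h2 : HasFDerivAt (fun w : F × (F →L[ℝ] ℝ) × ℝ => w.2)
    (.snd ℝ F ((F →L[ℝ] ℝ) × ℝ)) (y, z, l) := hasFDerivAt_snd
  have h := ((HasFDerivAt.comp (y, z, l) (J.hasFDerivAt_bivectorRep hy) h1).clm_apply h2.fst).sub
    (h2.snd.smul (HasFDerivAt.comp (y, z, l) (J.hasFDerivAt_vectorRep hy) h1))
  refine ⟨_, h, fun v => ?_⟩
  simp [driftD_apply]
  abel

lemma fderiv_drift (hy : y ∈ (extChartAt 𝓘(ℝ, F) p).target) (z : F →L[ℝ] ℝ) (l : ℝ)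
    (v : F × (F →L[ℝ] ℝ) × ℝ) :
    fderiv ℝ (J.drift p) (y, z, l) v =
      J.driftD p y z l v.1 + bivectorRep F J.Λ p y v.2.1 - v.2.2 • vectorRep F J.E p y := by
  obtain ⟨G, hG, h⟩ := J.hasFDerivAt_drift hy z l
  rw [hG.fderiv, h]

lemma hasFDerivAt_reebPairing (hy : y ∈ (extChartAt 𝓘(ℝ, F) p).target) (z : F →L[ℝ] ℝ) :
    ∃ G : F × (F →L[ℝ] ℝ) →L[ℝ] ℝ, HasFDerivAt (J.reebPairing p) G (y, z) ∧ ∀ v, G v =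
      v.2 (vectorRep F J.E p y) + J.reebD p y z v.1 := by
  have h1 : HasFDerivAt (fun w : F × (F →L[ℝ] ℝ) => w.1)
    (.fst ℝ F (F →L[ℝ] ℝ)) (y, z) := hasFDerivAt_fst
  have h2 : HasFDerivAt (fun w : F × (F →L[ℝ] ℝ) => w.2)
    (.snd ℝ F (F →L[ℝ] ℝ)) (y, z) := hasFDerivAt_snd
  refine ⟨_, h2.clm_apply (HasFDerivAt.comp (y, z) (J.hasFDerivAt_vectorRep hy) h1), fun v => ?_⟩
  simp [reebD_apply, add_comm]

lemma fderiv_reebPairing (hy : y ∈ (extChartAt 𝓘(ℝ, F) p).target) (z : F →L[ℝ] ℝ)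
    (v : F × (F →L[ℝ] ℝ)) :
    fderiv ℝ (J.reebPairing p) (y, z) v = v.2 (vectorRep F J.E p y) + J.reebD p y z v.1 := by
  obtain ⟨G, hG, h⟩ := J.hasFDerivAt_reebPairing hy z
  rw [hG.fderiv, h]

lemma fderiv_hamiltonian (hy : y ∈ (extChartAt 𝓘(ℝ, F) p).target) (z b : F →L[ℝ] ℝ) (l m : ℝ) :
    fderiv ℝ (fun y : F => b (J.drift p (y, z, l)) + m * J.reebPairing p (y, z)) y =
      b.comp (J.driftD p y z l) + m • J.reebD p y z := by
  obtain ⟨G, hG, hG'⟩ := J.hasFDerivAt_drift hy z l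
  obtain ⟨H, hH, hH'⟩ := J.hasFDerivAt_reebPairing hy z
  have h1 := HasFDerivAt.comp (f := fun y : F => (y, z, l)) y hG
    ((hasFDerivAt_id y).prodMk (hasFDerivAt_const (z, l) y))
  have h2 := HasFDerivAt.comp (f := fun y : F => (y, z)) y hH
    ((hasFDerivAt_id y).prodMk (hasFDerivAt_const z y))
  have h := (b.hasFDerivAt.comp y h1).add (h2.const_mul m)
  refine (HasFDerivAt.fderiv h).trans ?_
  ext v
  simp [hG', hH']

/-- Along a solution `x' = -(Λζ - λE)`, `ζ(E) = 0` of the constraints, the bivector field is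
parallel up to terms in the direction of `E`. -/
lemma bivector_transport (hy : y ∈ (extChartAt 𝓘(ℝ, F) p).target) {z : F →L[ℝ] ℝ}
    (hz : z (vectorRep F J.E p y) = 0) (l : ℝ) (c : F →L[ℝ] ℝ) :
    fderiv ℝ (bivectorRep F J.Λ p) y (-J.drift p (y, z, l)) c =
      -J.driftD p y z l (bivectorRep F J.Λ p y c)
      - bivectorRep F J.Λ p y (c.comp (J.driftD p y z l))
      - c (bivectorRep F J.Λ p y z) • vectorRep F J.E p y
      + c (vectorRep F J.E p y) • bivectorRep F J.Λ p y z := by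
  refine (SeparatingDual.eq_iff_forall_dual_eq (R := ℝ)).2 fun a => ?_
  have hl := congrArg a (J.lie p y hy c)
  have hj := J.jacobi p y hy a z c
  have s1 := J.fderiv_bivectorRep_skew hy (bivectorRep F J.Λ p y z) a c
  have s2 := J.fderiv_bivectorRep_skew hy (bivectorRep F J.Λ p y a) z c
  have s3 := J.bivectorRep_skew p y a (c.comp (J.driftD p y z l))
  have s4 := J.bivectorRep_skew p y a (c.comp (fderiv ℝ (vectorRep F J.E p) y))
  have s5 := J.bivectorRep_skew p y a z
  have s6 := J.bivectorRep_skew p y a c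
  have s7 := J.bivectorRep_skew p y c z
  simp only [ContinuousLinearMap.comp_apply, driftD_apply, map_sub, map_smul, smul_eq_mul,
    map_zero] at hl s3 s4
  simp only [drift, map_neg, map_sub, map_add, map_smul, neg_apply,
    sub_apply, smul_apply, smul_eq_mul, driftD_apply, s3]
  rw [hz] at hj
  rw [s4] at hl
  linear_combination l * hl - s1 + hj - s2 + a (vectorRep F J.E p y) * s7

/-- Along a solution of the constraints, the Reeb field is transported into `Λ(ζ ∘ ∂E)`. -/
lemma reeb_transport (hy : y ∈ (extChartAt 𝓘(ℝ, F) p).target) (z : F →L[ℝ] ℝ) (l : ℝ) :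
    fderiv ℝ (vectorRep F J.E p) y (-J.drift p (y, z, l)) =
      -J.driftD p y z l (vectorRep F J.E p y) + bivectorRep F J.Λ p y (J.reebD p y z) := by
  have hl := J.lie p y hy z
  simp only [drift, map_neg, map_sub, map_smul, driftD_apply, reebD]
  rw [sub_sub, sub_eq_zero] at hl
  rw [hl]
  abel

end JacobiStructure

/-! ### Linear differential equations on an interval -/

section ODE

variable {V : Type*} [NormedAddCommGroup V] [NormedSpace ℝ V]

lemma hasDerivWithinAt_Icc_glue {f : ℝ → V} {f' : V} {a s b u : ℝ} (has : a ≤ s) (hsb : s ≤ b)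
    (h1 : u ∈ Icc a s → HasDerivWithinAt f f' (Icc a s) u)
    (h2 : u ∈ Icc s b → HasDerivWithinAt f f' (Icc s b) u) :
    HasDerivWithinAt f f' (Icc a b) u := by
  have aux {c d : ℝ} (h : u ∈ Icc c d → HasDerivWithinAt f f' (Icc c d) u) :
      HasDerivWithinAt f f' (Icc c d) u := by
    by_cases hu : u ∈ Icc c d
    · exact h hu
    · exact HasFDerivWithinAt.of_notMem_closure (by rwa [isClosed_Icc.closure_eq])
  rw [← Icc_union_Icc_eq_Icc has hsb]
  exact (aux h1).union (aux h2)

lemma continuousWithinAt_Icc_glue {X : Type*} [TopologicalSpace X] {f : ℝ → X} {a s b u : ℝ}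
    (has : a ≤ s) (hsb : s ≤ b)
    (h1 : u ∈ Icc a s → ContinuousWithinAt f (Icc a s) u)
    (h2 : u ∈ Icc s b → ContinuousWithinAt f (Icc s b) u) :
    ContinuousWithinAt f (Icc a b) u := by
  have aux {c d : ℝ} (h : u ∈ Icc c d → ContinuousWithinAt f (Icc c d) u) :
      ContinuousWithinAt f (Icc c d) u := by
    by_cases hu : u ∈ Icc c d
    · exact h hu
    · exact continuousWithinAt_of_notMem_closure (by rwa [isClosed_Icc.closure_eq])
  rw [← Icc_union_Icc_eq_Icc has hsb]
  exact (aux h1).union (aux h2)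

/-- A differential equation with continuous, globally Lipschitz right-hand side has a solution on
a short interval, whose length depends only on the Lipschitz constant. -/
lemma exists_solution_of_lipschitz_short [CompleteSpace V] {f : ℝ → V → V} {a b : ℝ} {K : NNReal}
    (hab : a ≤ b) (hK : ∀ t ∈ Icc a b, LipschitzWith K (f t))
    (hf : ∀ x, ContinuousOn (fun t => f t x) (Icc a b)) (hs : (b - a) * K ≤ 1 / 2) (x : V) :
    ∃ y : ℝ → V, y a = x ∧ ∀ t ∈ Icc a b, HasDerivWithinAt y (f t (y t)) (Icc a b) t := by
  obtain ⟨G, hG⟩ := isCompact_Icc.exists_bound_of_continuousOn (hf x)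
  have hG0 : 0 ≤ G := (norm_nonneg _).trans (hG a ⟨le_rfl, hab⟩)
  lift G to NNReal using hG0
  set h : NNReal := ⟨b - a, sub_nonneg.2 hab⟩ with hh
  have hba : b - a = (h : ℝ) := rfl
  have hp : IsPicardLindelof f (⟨a, le_rfl, hab⟩ : Icc a b) x (2 * G * h) 0
      (G + K * (2 * G * h)) K := by
    refine ⟨fun t ht => (hK t ht).lipschitzOnWith, fun z _ => hf z, fun t ht z hz => ?_, ?_⟩
    · have h1 : ‖f t z - f t x‖ ≤ K * ‖z - x‖ := by
        simpa [dist_eq_norm] using (hK t ht).dist_le_mul z x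
      have h2 : ‖z - x‖ ≤ (2 * G * h : NNReal) := by simpa [dist_eq_norm] using hz
      calc ‖f t z‖ = ‖f t x + (f t z - f t x)‖ := by congr 1; abel
        _ ≤ ‖f t x‖ + ‖f t z - f t x‖ := norm_add_le _ _
        _ ≤ G + K * (2 * G * h : NNReal) := by
          gcongr
          · exact hG t ht
          · exact h1.trans (by gcongr)
        _ = _ := by push_cast; ring
    · rw [hba] at hs
      have h3 : max (b - a) (a - a) = (h : ℝ) := by
        rw [sub_self, max_eq_left (sub_nonneg.2 hab), hba]
      simp only [h3]
      push_cast
      have : (0 : ℝ) ≤ G * h := by positivity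
      nlinarith
  exact hp.exists_eq_forall_mem_Icc_hasDerivWithinAt₀

/-- A differential equation with continuous, globally Lipschitz right-hand side has a solution on
the whole interval. -/
lemma exists_solution_of_lipschitz [CompleteSpace V] {f : ℝ → V → V} {a b : ℝ} {K : NNReal}
    (hab : a ≤ b) (hK : ∀ t ∈ Icc a b, LipschitzWith K (f t))
    (hf : ∀ x, ContinuousOn (fun t => f t x) (Icc a b)) (x : V) :
    ∃ y : ℝ → V, y a = x ∧ ∀ t ∈ Icc a b, HasDerivWithinAt y (f t (y t)) (Icc a b) t := by
  have key : ∀ n : ℕ, ∀ b' ∈ Icc a b, (b' - a) * K ≤ n * (1 / 2) →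
      ∃ y : ℝ → V, y a = x ∧ ∀ t ∈ Icc a b', HasDerivWithinAt y (f t (y t)) (Icc a b') t := by
    intro n
    induction n with
    | zero =>
      intro b' hb' h
      refine exists_solution_of_lipschitz_short hb'.1 (fun t ht => hK t ⟨ht.1, ht.2.trans hb'.2⟩)
        (fun z => (hf z).mono (Icc_subset_Icc_right hb'.2)) (h.trans (by norm_num)) x
    | succ n ih =>
      intro b' hb' h
      -- split `[a, b']` at the point that leaves the fraction `1 / (n + 1)` of it on the right
      set s : ℝ := b' - (b' - a) / (n + 1) with hs
      have hn : (0 : ℝ) < n + 1 := by positivity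
      have hba : 0 ≤ b' - a := sub_nonneg.2 hb'.1
      have hd : 0 ≤ (b' - a) / (n + 1) := by positivity
      have hd' : (b' - a) / (n + 1) * (n + 1) = b' - a := by field_simp
      have has : a ≤ s := by nlinarith [mul_nonneg hd (Nat.cast_nonneg (α := ℝ) n)]
      have hsb : s ≤ b' := by linarith
      have e1 : (b' - s) * K ≤ 1 / 2 := by
        have : (b' - s) * K = (b' - a) * K / (n + 1) := by rw [hs]; ring
        rw [this, div_le_iff₀ hn]
        push_cast at h; linarith
      have e2 : (s - a) * K ≤ n * (1 / 2) := by
        have : (s - a) * K = ((b' - s) * K) * n := by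
          have : s - a = (b' - s) * n := by rw [hs]; linear_combination (-1 : ℝ) * hd'
          rw [this]; ring
        rw [this, mul_comm]
        gcongr
      obtain ⟨y₁, hy₁, hy₁'⟩ := ih s ⟨has, hsb.trans hb'.2⟩ e2
      obtain ⟨y₂, hy₂, hy₂'⟩ := exists_solution_of_lipschitz_short hsb
        (fun t ht => hK t ⟨has.trans ht.1, ht.2.trans hb'.2⟩)
        (fun z => (hf z).mono (Icc_subset_Icc has hb'.2)) e1 (y₁ s)
      have g1 : EqOn (fun t => if t ≤ s then y₁ t else y₂ t) y₁ (Icc a s) := fun t ht => if_pos ht.2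
      have g2 : EqOn (fun t => if t ≤ s then y₁ t else y₂ t) y₂ (Icc s b') := by
        intro t ht
        by_cases h : t ≤ s
        · obtain rfl : t = s := le_antisymm h ht.1
          simp [hy₂]
        · exact if_neg h
      refine ⟨fun t => if t ≤ s then y₁ t else y₂ t, by simp [has, hy₁], fun t _ => ?_⟩
      refine hasDerivWithinAt_Icc_glue has hsb (fun h => ?_) (fun h => ?_)
      · rw [g1 h]
        exact (hy₁' t h).congr g1 (g1 h)
      · rw [g2 h]
        exact (hy₂' t h).congr g2 (g2 h)
  obtain ⟨n, hn⟩ := exists_nat_ge ((b - a) * K * 2)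
  exact key n b ⟨hab, le_rfl⟩ (by linarith)

/-- Linear differential equations have solutions on the whole interval. -/
lemma exists_solution_linear [CompleteSpace V] {A : ℝ → V →L[ℝ] V} {g : ℝ → V} {a b : ℝ}
    (hab : a ≤ b) (hA : ContinuousOn A (Icc a b)) (hg : ContinuousOn g (Icc a b)) (x : V) :
    ∃ y : ℝ → V, y a = x ∧ ∀ t ∈ Icc a b, HasDerivWithinAt y (A t (y t) + g t) (Icc a b) t := by
  obtain ⟨K, hK⟩ := isCompact_Icc.exists_bound_of_continuousOn hA
  have hK0 : 0 ≤ K := (norm_nonneg _).trans (hK a ⟨le_rfl, hab⟩)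
  lift K to NNReal using hK0
  refine exists_solution_of_lipschitz (f := fun t x => A t x + g t) (K := K) hab (fun t ht => ?_)
    (fun z => (hA.clm_apply continuousOn_const).add hg) x
  refine LipschitzWith.of_dist_le_mul fun z w => ?_
  rw [dist_add_right, dist_eq_norm, dist_eq_norm, ← map_sub]
  exact ((A t).le_opNorm _).trans (by gcongr; exact hK t ht)

/-- Solutions of a linear differential equation are bounded by a multiple of the initial value
and of the inhomogeneous term. -/
lemma exists_linear_bound {A : ℝ → V →L[ℝ] V} {a b : ℝ} (hab : a ≤ b)
    (hA : ContinuousOn A (Icc a b)) :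
    ∃ C : ℝ, 0 < C ∧ ∀ (y g : ℝ → V) (δ : ℝ), 0 ≤ δ →
      (∀ t ∈ Icc a b, HasDerivWithinAt y (A t (y t) + g t) (Icc a b) t) →
      ‖y a‖ ≤ δ → (∀ t ∈ Icc a b, ‖g t‖ ≤ δ) → ∀ t ∈ Icc a b, ‖y t‖ ≤ C * δ := by
  obtain ⟨K, hK⟩ := isCompact_Icc.exists_bound_of_continuousOn hA
  have hK0 : 0 ≤ K := (norm_nonneg _).trans (hK a ⟨le_rfl, hab⟩)
  have hK1 : 0 < K + 1 := by linarith
  have hE : 1 ≤ Real.exp ((K + 1) * (b - a)) :=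
    Real.one_le_exp (mul_nonneg hK1.le (sub_nonneg.2 hab))
  refine ⟨Real.exp ((K + 1) * (b - a)) + 1 / (K + 1) * (Real.exp ((K + 1) * (b - a)) - 1), ?_,
    fun y g δ hδ hy hya hg t ht => ?_⟩
  · have : 0 ≤ 1 / (K + 1) * (Real.exp ((K + 1) * (b - a)) - 1) :=
      mul_nonneg (by positivity) (by linarith)
    linarith
  have h1 := norm_le_gronwallBound_of_norm_deriv_right_le (f := y)
    (f' := fun t => A t (y t) + g t) (δ := δ) (K := K + 1) (ε := δ) (a := a) (b := b)
    (fun t ht => (hy t ht).continuousWithinAt)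
    (fun t ht => ((hy t ⟨ht.1, ht.2.le⟩).mono_of_mem_nhdsWithin
      (Icc_mem_nhdsGE_of_mem ht))) hya (fun t ht => ?_) t ht
  · refine h1.trans ((gronwallBound_mono hδ hδ hK1.le (sub_le_sub_right ht.2 a)).trans ?_)
    rw [gronwallBound_of_K_ne_0 hK1.ne']
    apply le_of_eq
    ring
  · have ht' : t ∈ Icc a b := ⟨ht.1, ht.2.le⟩
    calc ‖A t (y t) + g t‖ ≤ ‖A t (y t)‖ + ‖g t‖ := norm_add_le _ _
      _ ≤ K * ‖y t‖ + δ := by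
        gcongr
        · exact ((A t).le_opNorm _).trans (by gcongr; exact hK t ht')
        · exact hg t ht'
      _ ≤ (K + 1) * ‖y t‖ + δ := by gcongr; linarith

lemma linear_solution_eq_zero {A : ℝ → V →L[ℝ] V} {a b : ℝ}
    (hA : ContinuousOn A (Icc a b)) {y : ℝ → V}
    (hy : ∀ t ∈ Icc a b, HasDerivWithinAt y (A t (y t)) (Icc a b) t) (hya : y a = 0) :
    ∀ t ∈ Icc a b, y t = 0 := by
  intro t ht
  obtain ⟨C, -, h⟩ := exists_linear_bound (ht.1.trans ht.2) hA
  have := h y (fun _ => 0) 0 le_rfl (fun t ht => by simpa using hy t ht) (by simp [hya]) (by simp)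
    t ht
  simpa using this

end ODE

/-! ### Change of charts for the constraints -/

lemma fderiv_invJac_symm {p q : M} {y : F} (hy : y ∈ overlap p q) (v w : F) :
    fderiv ℝ (invJac p q) y v (jac p q y w) = fderiv ℝ (invJac p q) y w (jac p q y v) := by
  rw [fderiv_invJac_jac hy, fderiv_invJac_jac hy, fderiv_jac_symm hy]

lemma overlap_subset_target {p q : M} {y : F} (hy : y ∈ overlap p q) :
    y ∈ (extChartAt 𝓘(ℝ, F) p).target := hy.1

namespace JacobiStructure

variable (J : JacobiStructure F M)

lemma drift_trans {p q : M} {y : F} (hy : y ∈ overlap p q) (z : F →L[ℝ] ℝ) (l : ℝ) :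
    J.drift q (chartTrans p q y, z.comp (invJac p q y), l) = jac p q y (J.drift p (y, z, l)) := by
  simp only [drift, vectorRep_trans J.E hy, bivectorRep_trans J.Λ hy, map_sub, map_smul]

lemma reebPairing_trans {p q : M} {y : F} (hy : y ∈ overlap p q) (z : F →L[ℝ] ℝ) :
    J.reebPairing q (chartTrans p q y, z.comp (invJac p q y)) = J.reebPairing p (y, z) := by
  simp only [reebPairing, vectorRep_trans J.E hy, ContinuousLinearMap.comp_apply,
    invJac_jac_apply hy]

/-- The derivative of `drift_trans` with respect to the base point. -/
lemma driftD_trans {p q : M} {y : F} (hy : y ∈ overlap p q) (z : F →L[ℝ] ℝ) (l : ℝ) (v : F) :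
    J.driftD q (chartTrans p q y) (z.comp (invJac p q y)) l (jac p q y v) =
      fderiv ℝ (jac p q) y v (J.drift p (y, z, l)) + jac p q y (J.driftD p y z l v)
      - bivectorRep F J.Λ q (chartTrans p q y) (z.comp (fderiv ℝ (invJac p q) y v)) := by
  obtain ⟨G, hG, hG'⟩ := J.hasFDerivAt_drift
    (overlap_subset_target (chartTrans_mem_overlap hy)) (z.comp (invJac p q y)) l
  obtain ⟨H, hH, hH'⟩ := J.hasFDerivAt_drift (overlap_subset_target hy) z l
  have h1 := HasFDerivAt.comp (f := fun y => (chartTrans p q y, z.comp (invJac p q y), l)) y hG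
    ((hasFDerivAt_chartTrans hy).prodMk (((hasFDerivAt_const z y).clm_comp
      (hasFDerivAt_invJac hy)).prodMk (hasFDerivAt_const l y)))
  have h2 := (hasFDerivAt_jac hy).clm_apply
    (HasFDerivAt.comp (f := fun y => (y, z, l)) y hH
      ((hasFDerivAt_id y).prodMk (hasFDerivAt_const (z, l) y)))
  have h3 := h2.congr_of_eventuallyEq (f₁ := J.drift q ∘
      fun y => (chartTrans p q y, z.comp (invJac p q y), l)) (by
    filter_upwards [(isOpen_overlap p q).mem_nhds hy] with x hx
    exact J.drift_trans hx z l)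
  have h := DFunLike.congr_fun (h1.unique h3) v
  simp [hG', hH'] at h
  rw [eq_sub_iff_add_eq, h, add_comm]

/-- The derivative of `reebPairing_trans` with respect to the base point. -/
lemma reebD_trans {p q : M} {y : F} (hy : y ∈ overlap p q) (z : F →L[ℝ] ℝ) (v : F) :
    J.reebD q (chartTrans p q y) (z.comp (invJac p q y)) (jac p q y v) =
      J.reebD p y z v
        - z (fderiv ℝ (invJac p q) y v (vectorRep F J.E q (chartTrans p q y))) := by
  obtain ⟨G, hG, hG'⟩ := J.hasFDerivAt_reebPairing
    (overlap_subset_target (chartTrans_mem_overlap hy)) (z.comp (invJac p q y))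
  obtain ⟨H, hH, hH'⟩ := J.hasFDerivAt_reebPairing (overlap_subset_target hy) z
  have h1 := HasFDerivAt.comp (f := fun y => (chartTrans p q y, z.comp (invJac p q y))) y hG
    ((hasFDerivAt_chartTrans hy).prodMk ((hasFDerivAt_const z y).clm_comp
      (hasFDerivAt_invJac hy)))
  have h2 := HasFDerivAt.comp (f := fun y => (y, z)) y hH
      ((hasFDerivAt_id y).prodMk (hasFDerivAt_const z y))
  have h3 := h2.congr_of_eventuallyEq (f₁ := J.reebPairing q ∘
      fun y => (chartTrans p q y, z.comp (invJac p q y))) (by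
    filter_upwards [(isOpen_overlap p q).mem_nhds hy] with x hx
    exact J.reebPairing_trans hx z)
  have h := DFunLike.congr_fun (h1.unique h3) v
  simp [hG', hH'] at h
  rw [eq_sub_iff_add_eq, ← h, add_comm]

/-- The terms of order zero in the formula for `ζ̃` transform by the inhomogeneous law of a tangent
vector to `T*M`, up to the term that comes from the derivative of the transition map along
`x' = -(Λζ - λE)`; that term is the one that appears in `β'`. -/
lemma hamiltonian_trans {p q : M} {y : F} (hy : y ∈ overlap p q) (z b : F →L[ℝ] ℝ) (l m : ℝ) :
    (b.comp (invJac p q y)).comp (J.driftD q (chartTrans p q y) (z.comp (invJac p q y)) l)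
        + m • J.reebD q (chartTrans p q y) (z.comp (invJac p q y)) =
      (b.comp (J.driftD p y z l) + m • J.reebD p y z).comp (invJac p q y)
        + b.comp (fderiv ℝ (invJac p q) y (-J.drift p (y, z, l)))
        + z.comp (fderiv ℝ (invJac p q) y
          (bivectorRep F J.Λ p y b - m • vectorRep F J.E p y)) := by
  ext w
  obtain ⟨v, rfl⟩ : ∃ v, jac p q y v = w := ⟨_, jac_invJac_apply hy w⟩
  have s := J.bivectorRep_skew q (chartTrans p q y) (b.comp (invJac p q y))
    (z.comp (fderiv ℝ (invJac p q) y v))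
  have e1 : fderiv ℝ (invJac p q) y (-J.drift p (y, z, l)) (jac p q y v) =
      invJac p q y (fderiv ℝ (jac p q) y v (J.drift p (y, z, l))) := by
    rw [fderiv_invJac_jac hy, fderiv_jac_symm hy, map_neg, map_neg, neg_neg]
  have e2 : fderiv ℝ (invJac p q) y (bivectorRep F J.Λ p y b - m • vectorRep F J.E p y)
      (jac p q y v) = fderiv ℝ (invJac p q) y v
        (bivectorRep F J.Λ q (chartTrans p q y) (b.comp (invJac p q y))
          - m • vectorRep F J.E q (chartTrans p q y)) := by
    rw [fderiv_invJac_symm hy, bivectorRep_trans J.Λ hy, vectorRep_trans J.E hy, map_sub, map_smul]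
  simp only [ContinuousLinearMap.comp_apply, add_apply, e1, e2]
  simp only [ContinuousLinearMap.comp_apply, smul_apply, smul_eq_mul,
    driftD_trans J hy, reebD_trans J hy, map_add, map_sub, map_smul,
    invJac_jac_apply hy] at s ⊢
  linear_combination -s

end JacobiStructure

/-! ### Coordinates of the fields -/

namespace Fields

/-- The coordinates `Xⁱ` of the path in the chart around `p`. -/
def xc (c : Fields F M) (p : M) (u : ℝ) : F := extChartAt 𝓘(ℝ, F) p (c.X u)

/-- The components `ζᵢ` in the chart around `p`. -/
def zc (c : Fields F M) (p : M) (u : ℝ) : F →L[ℝ] ℝ := (cotChart F p (c.path u)).2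

end Fields

/-- The components `βᵢ` in the chart around `p`. -/
def GaugeParam.bc {c : Fields F M} (g : GaugeParam c) (p : M) (u : ℝ) : F →L[ℝ] ℝ :=
  (cotChart F p (g.path u)).2

variable {c : Fields F M} {p q : M} {u : ℝ}

lemma cotChart_path (hp : u ∈ chartPart c p) :
    cotChart F p (c.path u) = (c.xc p u, c.zc p u) :=
  Prod.ext (cotChart_eq p (c.path u) hp.2).1 rfl

lemma xc_mem_target (hp : u ∈ chartPart c p) : c.xc p u ∈ (extChartAt 𝓘(ℝ, F) p).target :=
  (extChartAt 𝓘(ℝ, F) p).map_source hp.2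

lemma xc_mem_overlap (hp : u ∈ chartPart c p) (hq : u ∈ chartPart c q) :
    c.xc p u ∈ overlap p q := mem_overlap hp.2 hq.2

lemma xc_trans (hp : u ∈ chartPart c p) : c.xc q u = chartTrans p q (c.xc p u) :=
  (chartTrans_extChartAt q hp.2).symm

lemma zc_comp (hp : u ∈ chartPart c p) : (c.zc p u).comp (tangentCoord F p (c.X u)) = c.ζ u :=
  (cotChart_eq p (c.path u) hp.2).2

lemma GaugeParam.bc_comp (g : GaugeParam c) (hp : u ∈ chartPart c p) :
    (g.bc p u).comp (tangentCoord F p (c.X u)) = g.β u :=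
  (cotChart_eq p (g.path u) hp.2).2

lemma zc_trans (hp : u ∈ chartPart c p) (hq : u ∈ chartPart c q) :
    c.zc q u = (c.zc p u).comp (invJac p q (c.xc p u)) :=
  cotChart_trans (c.path u) hp.2 hq.2

lemma GaugeParam.bc_trans (g : GaugeParam c) (hp : u ∈ chartPart c p) (hq : u ∈ chartPart c q) :
    g.bc q u = (g.bc p u).comp (invJac p q (c.xc p u)) :=
  cotChart_trans (g.path u) hp.2 hq.2

lemma comp_tangentCoord_injective (hp : u ∈ chartPart c p) {a b : F →L[ℝ] ℝ}
    (h : a.comp (tangentCoord F p (c.X u)) = b.comp (tangentCoord F p (c.X u))) : a = b := by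
  ext w
  obtain ⟨v, rfl⟩ := (tangentCoord_isInvertible p (c.X u) hp.2).surjective w
  exact DFunLike.congr_fun h v

lemma GaugeParam.bc_eq_of_comp (g : GaugeParam c) (hp : u ∈ chartPart c p) {b : F →L[ℝ] ℝ}
    (h : g.β u = b.comp (tangentCoord F p (c.X u))) : g.bc p u = b :=
  comp_tangentCoord_injective hp ((g.bc_comp hp).trans h)

lemma GaugeParam.bc_eq_zero_iff (g : GaugeParam c) (hp : u ∈ chartPart c p) :
    g.bc p u = 0 ↔ g.β u = 0 := by
  constructor
  · intro h
    rw [← g.bc_comp hp, h, ContinuousLinearMap.zero_comp]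
  · intro h
    refine g.bc_eq_of_comp hp ?_
    rw [h, ContinuousLinearMap.zero_comp]

lemma GaugeParam.β_reeb (J : JacobiStructure F M) (g : GaugeParam c) (hp : u ∈ chartPart c p) :
    g.β u (J.E (c.X u)) = g.bc p u (vectorRep F J.E p (c.xc p u)) := by
  rw [Fields.xc, vectorRep_extChartAt J.E hp.2, ← g.bc_comp hp]
  rfl

lemma GaugeParam.β_bivector (J : JacobiStructure F M) (g : GaugeParam c)
    (hp : u ∈ chartPart c p) :
    g.β u (J.Λ (c.X u) (c.ζ u)) = g.bc p u (bivectorRep F J.Λ p (c.xc p u) (c.zc p u)) := by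
  rw [Fields.xc, bivectorRep_extChartAt J.Λ hp.2, zc_comp hp, ← g.bc_comp hp]
  rfl

/-- `Variation.rep_trans` in terms of the coordinates along the path. -/
lemma Variation.rep_chart (v : Variation c) (hp : u ∈ chartPart c p) (hq : u ∈ chartPart c q) :
    (v.rep q u).1 = jac p q (c.xc p u) (v.rep p u).1 ∧
    (v.rep q u).2 = (v.rep p u).2.comp (invJac p q (c.xc p u)) +
        (c.zc p u).comp (fderiv ℝ (invJac p q) (c.xc p u) (v.rep p u).1) := by
  rw [v.rep_trans hp.2 hq.2]
  exact ⟨rfl, rfl⟩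

lemma mfderiv_cotChart_isInvertible (hp : u ∈ chartPart c p) :
    (mfderiv (cotModel F) 𝓘(ℝ, F × (F →L[ℝ] ℝ)) (cotChart F p) (c.path u)).IsInvertible :=
  isInvertible_mfderiv_extChartAt (mem_cotChart_source hp.2)

/-- A tangent vector to `T*M` with prescribed components. -/
lemma exists_tangent_of_rep (hp : u ∈ chartPart c p) (w : F × (F →L[ℝ] ℝ)) :
    ∃ t : TangentSpace (cotModel F) (c.path u), ∀ v : Variation c, v.1 u = t → v.rep p u = w := by
  obtain ⟨t, ht⟩ := (mfderiv_cotChart_isInvertible hp).surjective w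
  exact ⟨t, fun v hv => by rw [Variation.rep, hv]; exact ht⟩

lemma Variation.eq_of_rep_eq (v w : Variation c) (hp : u ∈ chartPart c p)
    (h : v.rep p u = w.rep p u) : v.1 u = w.1 u :=
  (mfderiv_cotChart_isInvertible hp).injective h

lemma mem_chartPart_self (hu : u ∈ Icc (0 : ℝ) 1) : u ∈ chartPart c (c.X u) :=
  ⟨hu, mem_extChartAt_source _⟩

namespace InConstraintManifold

variable {J : JacobiStructure F M} (hc : InConstraintManifold J c)
include hc

lemma continuousOn_X : ContinuousOn c.X (Icc 0 1) := hc.contMDiffOn_X.continuousOn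

lemma chartPart_mem (hp : u ∈ chartPart c p) : chartPart c p ∈ 𝓝[Icc 0 1] u := by
  have := (hc.continuousOn_X u hp.1).preimage_mem_nhdsWithin
    ((isOpen_extChartAt_source (I := 𝓘(ℝ, F)) p).mem_nhds hp.2)
  filter_upwards [this, self_mem_nhdsWithin] with s hs hs' using ⟨hs', hs⟩

lemma zc_reeb (hp : u ∈ chartPart c p) : c.zc p u (vectorRep F J.E p (c.xc p u)) = 0 := by
  rw [← hc.eq_ζ u hp.1, Fields.xc, vectorRep_extChartAt J.E hp.2, ← zc_comp hp]
  rfl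

lemma hasDerivWithinAt_xc (hp : u ∈ chartPart c p) :
    HasDerivWithinAt (c.xc p) (-J.drift p (c.xc p u, c.zc p u, c.lam u)) (Icc 0 1) u := by
  have h1 : HasMFDerivWithinAt 𝓘(ℝ, ℝ) 𝓘(ℝ, F) c.X (Icc 0 1) u
      (mfderivWithin 𝓘(ℝ, ℝ) 𝓘(ℝ, F) c.X (Icc 0 1) u) :=
    ((hc.contMDiffOn_X u hp.1).mdifferentiableWithinAt (by simp)).hasMFDerivWithinAt
  have h2 : HasMFDerivAt 𝓘(ℝ, F) 𝓘(ℝ, F) (extChartAt 𝓘(ℝ, F) p) (c.X u)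
      (tangentCoord F p (c.X u)) :=
    (mdifferentiableAt_extChartAt (by simpa using hp.2)).hasMFDerivAt
  have h3 := h2.comp_hasMFDerivWithinAt u h1
  let D : ℝ →L[ℝ] F := (tangentCoord F p (c.X u)).comp
    (mfderivWithin 𝓘(ℝ, ℝ) 𝓘(ℝ, F) c.X (Icc 0 1) u)
  have h5 : HasFDerivWithinAt (c.xc p) D (Icc 0 1) u := h3.hasFDerivWithinAt
  convert! h5.hasDerivWithinAt using 1
  have h4 := hc.eq_X u hp.1
  rw [sub_eq_zero, ← eq_sub_iff_add_eq] at h4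
  change _ = tangentCoord F p (c.X u)
    (mfderivWithin 𝓘(ℝ, ℝ) 𝓘(ℝ, F) c.X (Icc 0 1) u (1 : ℝ))
  rw [h4]
  simp only [JacobiStructure.drift, Fields.xc]
  rw [bivectorRep_extChartAt J.Λ hp.2, vectorRep_extChartAt J.E hp.2, zc_comp hp]
  refine Eq.trans ?_ ((tangentCoord F p (c.X u)).map_sub _ _).symm
  rw [(tangentCoord F p (c.X u)).map_smul]
  exact neg_sub _ _

lemma continuousOn_xc (p : M) : ContinuousOn (c.xc p) (chartPart c p) := fun _ hu =>
  (hc.hasDerivWithinAt_xc hu).continuousWithinAt.mono fun _ hs => hs.1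

lemma continuousOn_zc (p : M) : ContinuousOn (c.zc p) (chartPart c p) := by
  have h1 : ContinuousOn (cotChart F p) (cotChart F p).source :=
    continuousOn_extChartAt (I := cotModel F) _
  exact (h1.comp (hc.continuousOn_ζ.mono fun _ hs => hs.1)
    fun s hs => mem_cotChart_source hs.2).snd

end InConstraintManifold

-- the topologies on spaces of bilinear maps, such as `F →L[ℝ] (F →L[ℝ] ℝ) →L[ℝ] F`, are found only
-- with a larger search depth
set_option maxSynthPendingDepth 3

/-! ### The linearised constraints and the gauge variations in a chart -/

namespace Fields

/-- The bivector field along the path, in the chart around `p`. -/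
def Λc (J : JacobiStructure F M) (c : Fields F M) (p : M) (u : ℝ) : (F →L[ℝ] ℝ) →L[ℝ] F :=
  bivectorRep F J.Λ p (c.xc p u)

/-- The Reeb field along the path, in the chart around `p`. -/
def Ec (J : JacobiStructure F M) (c : Fields F M) (p : M) (u : ℝ) : F :=
  vectorRep F J.E p (c.xc p u)

/-- The derivative of the drift with respect to the base point, along the fields `c`. -/
def Dc (J : JacobiStructure F M) (c : Fields F M) (p : M) (u : ℝ) : F →L[ℝ] F :=
  J.driftD p (c.xc p u) (c.zc p u) (c.lam u)

/-- The derivative of the Reeb pairing with respect to the base point, along the fields `c`. -/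
def Bc (J : JacobiStructure F M) (c : Fields F M) (p : M) (u : ℝ) : F →L[ℝ] ℝ :=
  J.reebD p (c.xc p u) (c.zc p u)

end Fields

variable {J : JacobiStructure F M}

lemma Ec_trans (hp : u ∈ chartPart c p) (hq : u ∈ chartPart c q) :
    c.Ec J q u = jac p q (c.xc p u) (c.Ec J p u) := by
  rw [Fields.Ec, xc_trans hp, vectorRep_trans J.E (xc_mem_overlap hp hq), Fields.Ec]

lemma Λc_trans (hp : u ∈ chartPart c p) (hq : u ∈ chartPart c q) (b : F →L[ℝ] ℝ) :
    c.Λc J q u (b.comp (invJac p q (c.xc p u))) = jac p q (c.xc p u) (c.Λc J p u b) := by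
  rw [Fields.Λc, xc_trans hp, bivectorRep_trans J.Λ (xc_mem_overlap hp hq), Fields.Λc]

/-- The linearised constraints hold for `v` at the parameter `u`, in the chart around `p`; the
derivative of `X̃` is taken within `σ`. -/
structure TangentEq (J : JacobiStructure F M) {c : Fields F M} (v : Variation c) (p : M)
    (σ : Set ℝ) (u : ℝ) : Prop where
  deriv_X : HasDerivWithinAt (fun s => (v.rep p s).1)
    (-(c.Dc J p u (v.rep p u).1) - c.Λc J p u (v.rep p u).2 + v.2 u • c.Ec J p u) σ u
  eq_ζ : (v.rep p u).2 (c.Ec J p u) + c.Bc J p u (v.rep p u).1 = 0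

/-- The variation `v` is the gauge variation of `g` at the parameter `u`, in the chart around `p`;
the equation for `ζ̃` is read as a differential equation for `β`, with the derivative taken within
`σ`. -/
structure GaugeEq (J : JacobiStructure F M) {c : Fields F M} (g : GaugeParam c) (v : Variation c)
    (p : M) (σ : Set ℝ) (u : ℝ) : Prop where
  eq_X : (v.rep p u).1 = c.Λc J p u (g.bc p u) - g.lamt u • c.Ec J p u
  deriv_β : HasDerivWithinAt (g.bc p)
    (-(v.rep p u).2 + (g.bc p u).comp (c.Dc J p u) + g.lamt u • c.Bc J p u) σ u

/-- The equation for `λ̃_u` of a gauge variation, read as a differential equation for `λ_t`. -/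
def LamEq (J : JacobiStructure F M) {c : Fields F M} (g : GaugeParam c) (v : Variation c)
    (σ : Set ℝ) (u : ℝ) : Prop :=
  HasDerivWithinAt g.lamt (-v.2 u - g.β u (J.Λ (c.X u) (c.ζ u))) σ u

namespace InConstraintManifold

variable (hc : InConstraintManifold J c)
include hc

lemma continuousOn_rep_field {V : Type*} [TopologicalSpace V] {f : F → V}
    (hf : ∀ y ∈ (extChartAt 𝓘(ℝ, F) p).target, ContinuousAt f y) :
    ContinuousOn (fun u => f (c.xc p u)) (chartPart c p) := fun u hu =>
  ContinuousAt.comp_continuousWithinAt (hf _ (xc_mem_target hu)) (hc.continuousOn_xc p u hu)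

lemma continuousOn_Λc (p : M) : ContinuousOn (c.Λc J p) (chartPart c p) :=
  hc.continuousOn_rep_field fun _ hy => (J.contDiffAt_bivectorRep hy).continuousAt

lemma continuousOn_Ec (p : M) : ContinuousOn (c.Ec J p) (chartPart c p) :=
  hc.continuousOn_rep_field fun _ hy => (J.contDiffAt_vectorRep hy).continuousAt

lemma continuousOn_Dc (p : M) : ContinuousOn (c.Dc J p) (chartPart c p) := by
  have h1 : ContinuousOn (fun u => fderiv ℝ (bivectorRep F J.Λ p) (c.xc p u)) (chartPart c p) :=
    hc.continuousOn_rep_field fun _ hy =>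
      ((J.contDiffAt_bivectorRep hy).fderiv_right (m := ∞) (by simp)).continuousAt
  have h2 : ContinuousOn (fun u => fderiv ℝ (vectorRep F J.E p) (c.xc p u)) (chartPart c p) :=
    hc.continuousOn_rep_field fun _ hy =>
      ((J.contDiffAt_vectorRep hy).fderiv_right (m := ∞) (by simp)).continuousAt
  have h3 := (ContinuousLinearMap.flipₗᵢ ℝ F (F →L[ℝ] ℝ) F).continuous.comp_continuousOn h1
  exact (h3.clm_apply (hc.continuousOn_zc p)).sub
    ((hc.continuousOn_lam.mono fun _ hs => hs.1).smul h2)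

lemma continuousOn_Bc (p : M) : ContinuousOn (c.Bc J p) (chartPart c p) :=
  (hc.continuousOn_zc p).clm_comp (hc.continuousOn_rep_field fun _ hy =>
      ((J.contDiffAt_vectorRep hy).fderiv_right (m := ∞) (by simp)).continuousAt)

lemma hasDerivWithinAt_Ec (hp : u ∈ chartPart c p) :
    HasDerivWithinAt (c.Ec J p) (-c.Dc J p u (c.Ec J p u) + c.Λc J p u (c.Bc J p u))
      (Icc 0 1) u := by
  have h := (J.hasFDerivAt_vectorRep (xc_mem_target hp)).comp_hasDerivWithinAt u
    (hc.hasDerivWithinAt_xc hp)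
  rw [J.reeb_transport (xc_mem_target hp)] at h
  exact h

lemma hasDerivWithinAt_Λc (hp : u ∈ chartPart c p) {σ : Set ℝ} (hσ : σ ⊆ Icc 0 1)
    {b : ℝ → F →L[ℝ] ℝ} {b' : F →L[ℝ] ℝ} (hb : HasDerivWithinAt b b' σ u) :
    HasDerivWithinAt (fun s => c.Λc J p s (b s))
      (-c.Dc J p u (c.Λc J p u (b u)) - c.Λc J p u ((b u).comp (c.Dc J p u))
      - b u (c.Λc J p u (c.zc p u)) • c.Ec J p u + b u (c.Ec J p u) • c.Λc J p u (c.zc p u)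
      + c.Λc J p u b') σ u := by
  have h := ((J.hasFDerivAt_bivectorRep (xc_mem_target hp)).comp_hasDerivWithinAt u
    ((hc.hasDerivWithinAt_xc hp).mono hσ)).clm_apply hb
  rw [J.bivector_transport (xc_mem_target hp) (hc.zc_reeb hp)] at h
  exact h

/-- If `(β, λ_t)` solves the gauge equations for `ζ̃` and `λ̃_u`, then `Λβ - λ_t E` solves the first
linearised constraint for `ζ̃` and `λ̃_u`, up to a multiple of `β(E)`. -/
lemma hasDerivWithinAt_gauge (hp : u ∈ chartPart c p) {σ : Set ℝ} (hσ : σ ⊆ Icc 0 1)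
    {b : ℝ → F →L[ℝ] ℝ} {l : ℝ → ℝ} {z : F →L[ℝ] ℝ} {m : ℝ}
    (hb : HasDerivWithinAt b (-z + (b u).comp (c.Dc J p u) + l u • c.Bc J p u) σ u)
    (hl : HasDerivWithinAt l (-m - b u (c.Λc J p u (c.zc p u))) σ u) :
    HasDerivWithinAt (fun s => c.Λc J p s (b s) - l s • c.Ec J p s)
      (-c.Dc J p u (c.Λc J p u (b u) - l u • c.Ec J p u) - c.Λc J p u z + m • c.Ec J p u
        + b u (c.Ec J p u) • c.Λc J p u (c.zc p u)) σ u := by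
  have h := (hc.hasDerivWithinAt_Λc hp hσ hb).sub
    (hl.smul ((hc.hasDerivWithinAt_Ec hp).mono hσ))
  refine HasDerivWithinAt.congr_deriv h ?_
  simp only [map_add, map_sub, map_smul, map_neg]
  module

/-- If `(β, λ_t)` solves the gauge equation for `ζ̃`, then the derivative of `β(E)` is the defect of
the second linearised constraint for `Λβ - λ_t E` and `ζ̃`. -/
lemma hasDerivWithinAt_gauge_reeb (hp : u ∈ chartPart c p) {σ : Set ℝ} (hσ : σ ⊆ Icc 0 1)
    {b : ℝ → F →L[ℝ] ℝ} {l : ℝ → ℝ} {z : F →L[ℝ] ℝ}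
    (hb : HasDerivWithinAt b (-z + (b u).comp (c.Dc J p u) + l u • c.Bc J p u) σ u) :
    HasDerivWithinAt (fun s => b s (c.Ec J p s))
      (-z (c.Ec J p u) - c.Bc J p u (c.Λc J p u (b u) - l u • c.Ec J p u)) σ u := by
  refine HasDerivWithinAt.congr_deriv (hb.clm_apply ((hc.hasDerivWithinAt_Ec hp).mono hσ)) ?_
  have s := J.bivectorRep_skew p (c.xc p u) (c.Bc J p u) (b u)
  change c.Bc J p u (c.Λc J p u (b u)) = -b u (c.Λc J p u (c.Bc J p u)) at s
  simp only [map_add, map_sub, map_smul, map_neg, add_apply, neg_apply, smul_apply,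
    ContinuousLinearMap.comp_apply, smul_eq_mul]
  linear_combination s

end InConstraintManifold

lemma eventuallyEq_bc_trans (hc : InConstraintManifold J c) (g : GaugeParam c)
    (hp : u ∈ chartPart c p) (hq : u ∈ chartPart c q) {σ : Set ℝ} (hσ : σ ⊆ Icc 0 1) :
    g.bc q =ᶠ[𝓝[σ] u] fun s => (g.bc p s).comp (invJac p q (c.xc p s)) := by
  filter_upwards [nhdsWithin_mono u hσ (hc.chartPart_mem hp),
    nhdsWithin_mono u hσ (hc.chartPart_mem hq)] with s hs hs' using g.bc_trans hs hs'

/-- The equations of a gauge variation do not depend on the chart. -/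
lemma GaugeEq.trans (hc : InConstraintManifold J c) {g : GaugeParam c} {v : Variation c}
    {σ : Set ℝ} (hσ : σ ⊆ Icc 0 1) (hp : u ∈ chartPart c p) (hq : u ∈ chartPart c q)
    (h : GaugeEq J g v p σ u) : GaugeEq J g v q σ u := by
  have hy := xc_mem_overlap hp hq
  have ex : c.xc q u = chartTrans p q (c.xc p u) := xc_trans hp
  obtain ⟨hv1, hv2⟩ := v.rep_chart hp hq
  refine ⟨?_, ?_⟩
  · rw [hv1, h.eq_X, g.bc_trans hp hq, Λc_trans hp hq, Ec_trans hp hq, map_sub, map_smul]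
  · have h1 := h.deriv_β.clm_comp ((hasFDerivAt_invJac hy).comp_hasDerivWithinAt u
      ((hc.hasDerivWithinAt_xc hp).mono hσ))
    have h2 := h1.congr_of_eventuallyEq (eventuallyEq_bc_trans hc g hp hq hσ) (g.bc_trans hp hq)
    refine h2.congr_deriv (Eq.symm ?_)
    have h3 := J.hamiltonian_trans hy (c.zc p u) (g.bc p u) (c.lam u) (g.lamt u)
    rw [hv2, g.bc_trans hp hq, Fields.Dc, Fields.Bc, zc_trans hp hq, ex, add_assoc, h3,
      h.eq_X]
    simp only [Fields.Dc, Fields.Bc, Fields.Λc, Fields.Ec, ContinuousLinearMap.add_comp,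
      ContinuousLinearMap.neg_comp]
    rw [Function.comp_apply]
    abel

/-- The linearised constraints do not depend on the chart. -/
lemma TangentEq.trans (hc : InConstraintManifold J c) {v : Variation c}
    {σ : Set ℝ} (hσ : σ ⊆ Icc 0 1) (hp : u ∈ chartPart c p) (hq : u ∈ chartPart c q)
    (h : TangentEq J v p σ u) : TangentEq J v q σ u := by
  have hy := xc_mem_overlap hp hq
  have ex : c.xc q u = chartTrans p q (c.xc p u) := xc_trans hp
  obtain ⟨hv1, hv2⟩ := v.rep_chart hp hq
  refine ⟨?_, ?_⟩
  · have h1 := ((hasFDerivAt_jac hy).comp_hasDerivWithinAt u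
      ((hc.hasDerivWithinAt_xc hp).mono hσ)).clm_apply h.deriv_X
    have h2 := h1.congr_of_eventuallyEq (f₁ := fun s => (v.rep q s).1) (by
      filter_upwards [nhdsWithin_mono u hσ (hc.chartPart_mem hp),
        nhdsWithin_mono u hσ (hc.chartPart_mem hq)] with s hs hs' using (v.rep_chart hs hs').1) hv1
    refine h2.congr_deriv (Eq.symm ?_)
    have h3 := J.driftD_trans hy (c.zc p u) (c.lam u) (v.rep p u).1
    rw [hv1, hv2, map_add, Λc_trans hp hq, Ec_trans hp hq, Fields.Dc, zc_trans hp hq, ex,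
      h3]
    simp only [Fields.Dc, Fields.Λc, ex, Function.comp_apply, map_neg, map_add, map_sub, map_smul,
      neg_apply, fderiv_jac_symm hy (J.drift p _)]
    abel
  · rw [hv2, hv1, Fields.Bc, zc_trans hp hq, ex, J.reebD_trans hy, ← h.eq_ζ, ← ex]
    change _ + (c.Bc J p u (v.rep p u).1 - c.zc p u (fderiv ℝ (invJac p q) (c.xc p u) (v.rep p u).1
      (c.Ec J q u))) = _
    rw [Ec_trans hp hq]
    simp only [add_apply, ContinuousLinearMap.comp_apply, invJac_jac_apply hy]
    ring

/-! ### Gauge variations are tangent to the constraint manifold -/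

lemma contDiffWithinAt_one_of_hasDerivWithinAt {V : Type*} [NormedAddCommGroup V]
    [NormedSpace ℝ V] {f f' : ℝ → V} {I s : Set ℝ} {u : ℝ} (hs : s ∈ 𝓝[I] u) (hsI : s ⊆ I)
    (hu : u ∈ s) (hf : ∀ t ∈ s, HasDerivWithinAt f (f' t) I t) (hf' : ContinuousOn f' s) :
    ContDiffWithinAt ℝ 1 f I u := by
  rw [show (1 : ℕ∞ω) = 0 + 1 from (zero_add 1).symm,
    contDiffWithinAt_succ_iff_hasFDerivWithinAt (by simp)]
  refine ⟨s, by rwa [insert_eq_of_mem (hsI hu)], by simp, fun t =>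
    ContinuousLinearMap.toSpanSingleton ℝ (f' t),
    fun t ht => ((hf t ht).mono hsI).hasFDerivWithinAt,
    contDiffWithinAt_zero hu |>.2 ⟨s, self_mem_nhdsWithin, ?_⟩⟩
  rw [inter_self]
  exact (ContinuousLinearMap.toSpanSingletonCLE (𝕜 := ℝ) (E := V)).continuous.comp_continuousOn hf'


/-- A gauge parameter is `C¹` if and only if its components in the charts are. -/
lemma GaugeParam.contMDiffWithinAt_path_iff (hc : InConstraintManifold J c) (g : GaugeParam c)
    (hp : u ∈ chartPart c p) :
    ContMDiffWithinAt 𝓘(ℝ, ℝ) (cotModel F) 1 g.path (Icc 0 1) u ↔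
      ContDiffWithinAt ℝ 1 (g.bc p) (Icc 0 1) u := by
  have key : ∀ {p}, u ∈ chartPart c p →
      ContMDiffWithinAt 𝓘(ℝ, ℝ) (cotModel F) 1 g.path (Icc 0 1) u →
      ContDiffWithinAt ℝ 1 (g.bc p) (Icc 0 1) u := by
    intro p hp h
    have h1 : ContMDiffAt (cotModel F) 𝓘(ℝ, F × (F →L[ℝ] ℝ)) 1 (cotChart F p) (g.path u) :=
      contMDiffAt_extChartAt' (by simpa [cotChart] using mem_cotChart_source (z := g.path u) hp.2)
    exact (contMDiffWithinAt_iff_contDiffWithinAt.1 (h1.comp_contMDiffWithinAt u h)).snd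
  refine ⟨key hp, fun h => ?_⟩
  have hX := hc.contMDiffOn_X u hp.1
  refine Bundle.contMDiffWithinAt_totalSpace.2 ⟨hX, ?_⟩
  rw [contMDiffWithinAt_iff_contDiffWithinAt]
  have hq : u ∈ chartPart c (c.X u) := mem_chartPart_self hp.1
  change ContDiffWithinAt ℝ 1 (g.bc (c.X u)) (Icc 0 1) u
  have hx : ContDiffWithinAt ℝ 1 (c.xc p) (Icc 0 1) u := by
    have h1 : ContMDiffAt 𝓘(ℝ, F) 𝓘(ℝ, F) 1 (extChartAt 𝓘(ℝ, F) p) (c.X u) :=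
      contMDiffAt_extChartAt' (by simpa using hp.2)
    exact contMDiffWithinAt_iff_contDiffWithinAt.1 (h1.comp_contMDiffWithinAt u hX)
  have h2 : ContDiffWithinAt ℝ 1 (fun s => invJac p (c.X u) (c.xc p s)) (Icc 0 1) u :=
    ((contDiffAt_invJac (xc_mem_overlap hp hq)).of_le (by simp)).comp_contDiffWithinAt u hx
  exact (h.clm_comp h2).congr_of_eventuallyEq (eventuallyEq_bc_trans hc g hp hq subset_rfl)
    (g.bc_trans hp hq)

/-- `C¹` gauge parameters, without boundary conditions. -/
structure GaugeParam.IsC1 (g : GaugeParam c) : Prop where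
  contMDiffOn_β : ContMDiffOn 𝓘(ℝ, ℝ) (cotModel F) 1 g.path (Icc 0 1)
  contDiffOn_lamt : ContDiffOn ℝ 1 g.lamt (Icc 0 1)

lemma GaugeParam.IsC1.contDiffWithinAt_bc (hc : InConstraintManifold J c) {g : GaugeParam c}
    (hg : g.IsC1) (hp : u ∈ chartPart c p) : ContDiffWithinAt ℝ 1 (g.bc p) (Icc 0 1) u :=
  (g.contMDiffWithinAt_path_iff hc hp).1 (hg.contMDiffOn_β u hp.1)

lemma uniqueDiffWithinAt_Icc01 (hu : u ∈ Icc (0 : ℝ) 1) : UniqueDiffWithinAt ℝ (Icc (0 : ℝ) 1) u :=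
  uniqueDiffOn_Icc zero_lt_one u hu

lemma continuousWithinAt_derivWithin {V : Type*} [NormedAddCommGroup V] [NormedSpace ℝ V]
    {f : ℝ → V} (hu : u ∈ Icc (0 : ℝ) 1) (hf : ContDiffWithinAt ℝ 1 f (Icc 0 1) u) :
    ContinuousWithinAt (derivWithin f (Icc 0 1)) (Icc 0 1) u :=
  (hf.fderivWithin_right (m := 0) (uniqueDiffOn_Icc zero_lt_one) (by simp) hu).continuousWithinAt
    |>.clm_apply continuousWithinAt_const

/-- A function on `I` is continuous if it is so in the charts. -/
lemma continuousOn_of_chartPart (hc : InConstraintManifold J c) {V : Type*} [TopologicalSpace V]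
    {f : ℝ → V} (h : ∀ p : M, ContinuousOn f (chartPart c p)) : ContinuousOn f (Icc 0 1) :=
  fun u hu => (h (c.X u) u (mem_chartPart_self hu)).mono_of_mem_nhdsWithin
    (hc.chartPart_mem (mem_chartPart_self hu))

lemma continuousOn_pairing (hc : InConstraintManifold J c) (g : GaugeParam c)
    (hg : ∀ p : M, ContinuousOn (g.bc p) (chartPart c p)) :
    ContinuousOn (fun u => g.β u (J.Λ (c.X u) (c.ζ u))) (Icc 0 1) := by
  refine continuousOn_of_chartPart hc fun p => ?_
  refine ((hg p).clm_apply ((hc.continuousOn_Λc p).clm_apply (hc.continuousOn_zc p))).congr ?_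
  intro u hu
  exact g.β_bivector J hu

lemma GaugeParam.IsC1.continuousOn_bc (hc : InConstraintManifold J c) {g : GaugeParam c}
    (hg : g.IsC1) (p : M) : ContinuousOn (g.bc p) (chartPart c p) := fun _ hu =>
  (hg.contDiffWithinAt_bc hc hu).continuousWithinAt.mono fun _ hs => hs.1

lemma isTangent_iff {v : Variation c} :
    IsTangent J c v ↔ (∀ u ∉ Icc (0 : ℝ) 1, v.1 u = 0) ∧ (∀ u ∉ Icc (0 : ℝ) 1, v.2 u = 0) ∧
      (∀ p : M, ContinuousOn (v.rep p) (chartPart c p)) ∧ ContinuousOn v.2 (Icc 0 1) ∧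
      ∀ p : M, ∀ u ∈ chartPart c p, TangentEq J v p (Icc 0 1) u := by
  have e1 {p u} (hp : u ∈ chartPart c p) : -(fderiv ℝ (J.drift p)
          ((cotChart F p (c.path u)).1, (cotChart F p (c.path u)).2, c.lam u)
          ((v.rep p u).1, (v.rep p u).2, v.2 u)) =
      -(c.Dc J p u (v.rep p u).1) - c.Λc J p u (v.rep p u).2 + v.2 u • c.Ec J p u := by
    rw [cotChart_path hp, J.fderiv_drift (xc_mem_target hp)]
    simp only [Fields.Dc, Fields.Λc, Fields.Ec]
    abel
  have e2 {p u} (hp : u ∈ chartPart c p) :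
      fderiv ℝ (J.reebPairing p) (cotChart F p (c.path u)) (v.rep p u) =
        (v.rep p u).2 (c.Ec J p u) + c.Bc J p u (v.rep p u).1 := by
    rw [cotChart_path hp, J.fderiv_reebPairing (xc_mem_target hp)]
    rfl
  constructor
  · intro h
    refine ⟨h.zero_fst, h.zero_snd, h.continuousOn_rep, h.continuousOn_snd, fun p u hp => ⟨?_, ?_⟩⟩
    · rw [← e1 hp]; exact h.lin_X p u hp
    · rw [← e2 hp]; exact h.lin_ζ p u hp
  · rintro ⟨h1, h2, h3, h4, h5⟩
    refine ⟨h1, h2, h3, h4, fun p u hp => ?_, fun p u hp => ?_⟩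
    · rw [e1 hp]; exact (h5 p u hp).deriv_X
    · rw [e2 hp]; exact (h5 p u hp).eq_ζ

/-- For a `C¹` gauge parameter, the formula for a gauge variation amounts to a differential
equation for the gauge parameter. -/
lemma isGaugeVariation_iff (hc : InConstraintManifold J c) {g : GaugeParam c} (hg : g.IsC1)
    {v : Variation c} :
    IsGaugeVariation J g v ↔ (∀ u ∉ Icc (0 : ℝ) 1, v.1 u = 0) ∧ (∀ u ∉ Icc (0 : ℝ) 1, v.2 u = 0) ∧
      (∀ p : M, ∀ u ∈ chartPart c p, GaugeEq J g v p (Icc 0 1) u) ∧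
      ∀ u ∈ Icc (0 : ℝ) 1, LamEq J g v (Icc 0 1) u := by
  have e1 {p u} (hp : u ∈ chartPart c p) : fderiv ℝ (fun y : F =>
            (cotChart F p (g.path u)).2
                (J.drift p (y, (cotChart F p (c.path u)).2, c.lam u))
              + g.lamt u * J.reebPairing p (y, (cotChart F p (c.path u)).2))
          (cotChart F p (c.path u)).1 =
      (g.bc p u).comp (c.Dc J p u) + g.lamt u • c.Bc J p u := by
    rw [cotChart_path hp, J.fderiv_hamiltonian (xc_mem_target hp)]
    rfl
  have e2 {p u} (hp : u ∈ chartPart c p) : bivectorRep F J.Λ p (cotChart F p (c.path u)).1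
        (cotChart F p (g.path u)).2
        - g.lamt u • vectorRep F J.E p (cotChart F p (c.path u)).1 =
      c.Λc J p u (g.bc p u) - g.lamt u • c.Ec J p u := by
    rw [cotChart_path hp]
    rfl
  have d1 {p u} (hp : u ∈ chartPart c p) : HasDerivWithinAt (g.bc p)
      (derivWithin (g.bc p) (Icc 0 1) u) (Icc 0 1) u :=
    ((hg.contDiffWithinAt_bc hc hp).differentiableWithinAt (by simp)).hasDerivWithinAt
  have d2 {u} (hu : u ∈ Icc (0 : ℝ) 1) : HasDerivWithinAt g.lamt
      (derivWithin g.lamt (Icc 0 1) u) (Icc 0 1) u :=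
    ((hg.contDiffOn_lamt u hu).differentiableWithinAt (by simp)).hasDerivWithinAt
  constructor
  · intro h
    refine ⟨h.zero_fst, h.zero_snd, fun p u hp => ⟨?_, ?_⟩, fun u hu => ?_⟩
    · rw [← e2 hp]; exact h.eq_X p u hp
    · refine (d1 hp).congr_deriv ?_
      have := h.eq_ζ p u hp
      rw [e1 hp] at this
      rw [this]
      change derivWithin (g.bc p) (Icc 0 1) u = -(-derivWithin (g.bc p) (Icc 0 1) u + _) + _ + _
      abel
    · refine (d2 hu).congr_deriv ?_
      rw [h.eq_lam u hu]
      ring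
  · rintro ⟨h1, h2, h3, h4⟩
    refine ⟨h1, h2, fun p u hp => ?_, fun p u hp => ?_, fun u hu => ?_⟩
    · rw [e2 hp]; exact (h3 p u hp).eq_X
    · rw [e1 hp]
      have := (h3 p u hp).deriv_β.derivWithin (uniqueDiffWithinAt_Icc01 hp.1)
      change _ = -derivWithin (g.bc p) (Icc 0 1) u + _
      rw [this]
      abel
    · rw [(h4 u hu).derivWithin (uniqueDiffWithinAt_Icc01 hu)]
      ring

/-- The formulas for a gauge variation are consistent: they define a variation in every chart. -/
lemma existsUnique_isGaugeVariation (hc : InConstraintManifold J c) {g : GaugeParam c}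
    (hg : g.IsC1) : ∃! v : Variation c, IsGaugeVariation J g v := by
  classical
  have ht (u : ℝ) : ∃ t : TangentSpace (cotModel F) (c.path u), (u ∉ Icc (0 : ℝ) 1 → t = 0) ∧
      (u ∈ Icc (0 : ℝ) 1 → ∀ v : Variation c, v.1 u = t → v.rep (c.X u) u =
        (c.Λc J (c.X u) u (g.bc (c.X u) u) - g.lamt u • c.Ec J (c.X u) u,
          -derivWithin (g.bc (c.X u)) (Icc 0 1) u
            + (g.bc (c.X u) u).comp (c.Dc J (c.X u) u) + g.lamt u • c.Bc J (c.X u) u)) := by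
    by_cases hu : u ∈ Icc (0 : ℝ) 1
    · obtain ⟨t, ht⟩ := exists_tangent_of_rep (mem_chartPart_self (c := c) hu)
        (c.Λc J (c.X u) u (g.bc (c.X u) u) - g.lamt u • c.Ec J (c.X u) u,
          -derivWithin (g.bc (c.X u)) (Icc 0 1) u
            + (g.bc (c.X u) u).comp (c.Dc J (c.X u) u) + g.lamt u • c.Bc J (c.X u) u)
      exact ⟨t, fun h => absurd hu h, fun _ => ht⟩
    · exact ⟨0, fun _ => rfl, fun h => absurd h hu⟩
  choose t ht0 ht1 using ht
  let v : Variation c := (t, fun u => if u ∈ Icc (0 : ℝ) 1 then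
    -(derivWithin g.lamt (Icc 0 1) u + g.β u (J.Λ (c.X u) (c.ζ u))) else 0)
  have hv : IsGaugeVariation J g v := by
    refine (isGaugeVariation_iff hc hg).2 ⟨ht0, fun u hu => if_neg hu, fun p u hp => ?_,
      fun u hu => ?_⟩
    · refine GaugeEq.trans hc subset_rfl (mem_chartPart_self hp.1) hp ?_
      have h := ht1 u hp.1 v rfl
      refine ⟨by rw [h], ?_⟩
      refine ((hg.contDiffWithinAt_bc hc (mem_chartPart_self hp.1)).differentiableWithinAt
        (by simp)).hasDerivWithinAt.congr_deriv ?_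
      rw [h]
      simp only
      abel
    · refine ((hg.contDiffOn_lamt u hu).differentiableWithinAt (by simp)).hasDerivWithinAt
        |>.congr_deriv ?_
      simp only [v, if_pos hu]
      ring
  refine ⟨v, hv, fun w hw => ?_⟩
  refine Prod.ext (funext fun u => ?_) (funext fun u => ?_)
  · by_cases hu : u ∈ Icc (0 : ℝ) 1
    · have hp := mem_chartPart_self (c := c) hu
      refine Variation.eq_of_rep_eq w v hp (Prod.ext ?_ ?_)
      · rw [hw.eq_X _ _ hp, hv.eq_X _ _ hp]
      · rw [hw.eq_ζ _ _ hp, hv.eq_ζ _ _ hp]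
    · rw [hw.zero_fst u hu, hv.zero_fst u hu]
  · by_cases hu : u ∈ Icc (0 : ℝ) 1
    · rw [hw.eq_lam u hu, hv.eq_lam u hu]
    · rw [hw.zero_snd u hu, hv.zero_snd u hu]

/-- Gauge variations are tangent to the constraint manifold. -/
lemma isTangent_of_isGaugeVariation (hc : InConstraintManifold J c) {g : GaugeParam c}
    (hg : g.IsC1) (hE : ∀ u ∈ Icc (0 : ℝ) 1, g.β u (J.E (c.X u)) = 0) {v : Variation c}
    (hv : IsGaugeVariation J g v) : IsTangent J c v := by
  obtain ⟨h1, h2, h3, h4⟩ := (isGaugeVariation_iff hc hg).1 hv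
  have hb : ∀ p : M, ∀ u ∈ chartPart c p, g.bc p u (c.Ec J p u) = 0 := fun p u hu =>
    (g.β_reeb J hu).symm.trans (hE u hu.1)
  refine isTangent_iff.2 ⟨h1, h2, fun p => ?_, ?_, fun p u hp => ⟨?_, ?_⟩⟩
  · have hbc := hg.continuousOn_bc hc p
    have hl : ContinuousOn g.lamt (chartPart c p) :=
      hg.contDiffOn_lamt.continuousOn.mono fun _ hs => hs.1
    have hd : ContinuousOn (derivWithin (g.bc p) (Icc 0 1)) (chartPart c p) := fun u hu =>
      (continuousWithinAt_derivWithin hu.1 (hg.contDiffWithinAt_bc hc hu)).mono fun _ hs => hs.1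
    have c1 := ((hc.continuousOn_Λc p).clm_apply hbc).sub (hl.smul (hc.continuousOn_Ec p))
    have c2 := (hd.neg.add (hbc.clm_comp (hc.continuousOn_Dc p))).add
      (hl.smul (hc.continuousOn_Bc p))
    refine (c1.prodMk c2).congr fun u hu => ?_
    refine Prod.ext (h3 p u hu).eq_X ?_
    have := (h3 p u hu).deriv_β.derivWithin (uniqueDiffWithinAt_Icc01 hu.1)
    simp only [Pi.add_apply, Pi.neg_apply, Pi.smul_apply', this]
    abel
  · have hd : ContinuousOn (derivWithin g.lamt (Icc 0 1)) (Icc 0 1) := fun u hu =>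
      continuousWithinAt_derivWithin hu (hg.contDiffOn_lamt u hu)
    refine (hd.add (continuousOn_pairing hc g (hg.continuousOn_bc hc))).neg.congr fun u hu => ?_
    exact hv.eq_lam u hu
  · have h := hc.hasDerivWithinAt_gauge hp subset_rfl (h3 p u hp).deriv_β (m := v.2 u)
      (l := g.lamt) ((h4 u hp.1).congr_deriv (by rw [g.β_bivector J hp]; rfl))
    rw [hb p u hp, zero_smul, add_zero, ← (h3 p u hp).eq_X] at h
    refine h.congr_of_eventuallyEq ?_ (h3 p u hp).eq_X
    filter_upwards [hc.chartPart_mem hp] with s hs using (h3 p s hs).eq_X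
  · have h := hc.hasDerivWithinAt_gauge_reeb hp subset_rfl (h3 p u hp).deriv_β
    have h0 : HasDerivWithinAt (fun s => g.bc p s (c.Ec J p s)) 0 (Icc 0 1) u := by
      refine (hasDerivWithinAt_const u _ (0 : ℝ)).congr_of_eventuallyEq ?_ (hb p u hp)
      filter_upwards [hc.chartPart_mem hp] with s hs using hb p s hs
    have h' := (uniqueDiffWithinAt_Icc01 hp.1).eq_deriv _ h h0
    rw [← (h3 p u hp).eq_X] at h'
    linarith

/-- A solution of the gauge equations for a tangent vector is of class `C¹`. -/
lemma GaugeParam.isC1_of_gaugeEq (hc : InConstraintManifold J c) {g : GaugeParam c}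
    {v : Variation c} (hv : IsTangent J c v)
    (h : ∀ p : M, ∀ u ∈ chartPart c p, GaugeEq J g v p (Icc 0 1) u)
    (hl : ∀ u ∈ Icc (0 : ℝ) 1, LamEq J g v (Icc 0 1) u) : g.IsC1 := by
  have hbc (p : M) : ContinuousOn (g.bc p) (chartPart c p) := fun u hu =>
    (h p u hu).deriv_β.continuousWithinAt.mono fun _ hs => hs.1
  have hlc : ContinuousOn g.lamt (Icc 0 1) := fun u hu => (hl u hu).continuousWithinAt
  refine ⟨fun u hu => ?_, fun u hu => ?_⟩
  · have hp := mem_chartPart_self (c := c) hu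
    rw [g.contMDiffWithinAt_path_iff hc hp]
    refine contDiffWithinAt_one_of_hasDerivWithinAt (hc.chartPart_mem hp) (fun _ hs => hs.1) hp
      (fun t ht => (h _ t ht).deriv_β) ?_
    exact ((hv.continuousOn_rep _).snd.neg.add ((hbc _).clm_comp (hc.continuousOn_Dc _))).add
      ((hlc.mono fun _ hs => hs.1).smul (hc.continuousOn_Bc _))
  · exact contDiffWithinAt_one_of_hasDerivWithinAt self_mem_nhdsWithin subset_rfl hu hl
      (hv.continuousOn_snd.neg.sub (continuousOn_pairing hc g hbc))

/-! ### Induction along the path -/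

lemma Ec_ne_zero (hE : ∀ x : M, J.E x ≠ 0) (hp : u ∈ chartPart c p) : c.Ec J p u ≠ 0 := by
  rw [Fields.Ec, Fields.xc, vectorRep_extChartAt J.E hp.2]
  intro h
  refine hE (c.X u) ((tangentCoord_isInvertible p (c.X u) hp.2).injective ?_)
  rw [h, map_zero]

/-- Induction along the path, over intervals that are mapped into one chart and on which some
covector with constant components does not annihilate the Reeb field. -/
lemma path_induction (hc : InConstraintManifold J c) (hE : ∀ x : M, J.E x ≠ 0) {P : ℝ → Prop}
    (h0 : P 0)
    (step : ∀ s s' : ℝ, 0 ≤ s → s ≤ s' → s' ≤ 1 → ∀ p : M, Icc s s' ⊆ chartPart c p →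
      ∀ e : F →L[ℝ] ℝ, (∀ u ∈ Icc s s', e (c.Ec J p u) ≠ 0) → P s → P s') : P 1 := by
  let C : M × (F →L[ℝ] ℝ) → Set (Icc (0 : ℝ) 1) := fun i =>
    (↑) ⁻¹' {u : ℝ | u ∈ chartPart c i.1 ∧ i.2 (c.Ec J i.1 u) ≠ 0}
  have hC : ∀ i, IsOpen (C i) := by
    intro i
    rw [isOpen_iff_mem_nhds]
    rintro ⟨u, hu⟩ ⟨h1, h2⟩
    rw [preimage_coe_mem_nhds_subtype]
    have h3 : ContinuousWithinAt (fun u => i.2 (c.Ec J i.1 u)) (Icc 0 1) u :=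
      i.2.continuous.continuousAt.comp_continuousWithinAt
        ((hc.continuousOn_Ec i.1 u h1).mono_of_mem_nhdsWithin (hc.chartPart_mem h1))
    filter_upwards [hc.chartPart_mem h1, h3.eventually_ne h2] with s hs hs' using ⟨hs, hs'⟩
  have hC' : univ ⊆ ⋃ i, C i := by
    rintro ⟨u, hu⟩ -
    have hp := mem_chartPart_self (c := c) hu
    obtain ⟨e, he⟩ := SeparatingDual.exists_ne_zero (R := ℝ) (Ec_ne_zero hE hp)
    exact mem_iUnion.2 ⟨(c.X u, e), hp, he⟩
  obtain ⟨t, ht0, htm, ⟨n, hn⟩, ht⟩ := exists_monotone_Icc_subset_open_cover_Icc zero_le_one hC hC'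
  have key : ∀ k, P (t k) := by
    intro k
    induction k with
    | zero => rw [ht0]; exact h0
    | succ k ih =>
      obtain ⟨⟨p, e⟩, hpe⟩ := ht k
      have hsub : ∀ u ∈ Icc (t k : ℝ) (t (k + 1)), u ∈ chartPart c p ∧ e (c.Ec J p u) ≠ 0 := by
        intro u hu
        have hu' : u ∈ Icc (0 : ℝ) 1 := ⟨(t k).2.1.trans hu.1, hu.2.trans (t (k + 1)).2.2⟩
        exact hpe (show (⟨u, hu'⟩ : Icc (0 : ℝ) 1) ∈ Icc (t k) (t (k + 1)) from hu)
      exact step _ _ (t k).2.1 (htm k.le_succ) (t (k + 1)).2.2 p (fun u hu => (hsub u hu).1) e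
        (fun u hu => (hsub u hu).2) ih
  have := key n
  rwa [hn n le_rfl] at this

/-! ### Solving for the gauge parameter -/

/-- `g` solves on `[a, b]` the equations that make `v` its gauge variation, and `β(E) = 0`. -/
structure GaugeSolOn (J : JacobiStructure F M) (g : GaugeParam c) (v : Variation c) (a b : ℝ) :
    Prop where
  reeb : ∀ u ∈ Icc a b, g.β u (J.E (c.X u)) = 0
  gaugeEq : ∀ u ∈ Icc a b, ∀ p : M, u ∈ chartPart c p → GaugeEq J g v p (Icc a b) u
  lamEq : ∀ u ∈ Icc a b, LamEq J g v (Icc a b) u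

lemma GaugeParam.bc_congr {g g' : GaugeParam c} (h : g.β u = g'.β u) (p : M) :
    g.bc p u = g'.bc p u := by
  simp only [GaugeParam.bc, GaugeParam.path, h]

lemma GaugeSolOn.congr {g g' : GaugeParam c} {v : Variation c} {a b : ℝ}
    (h : GaugeSolOn J g v a b) (hβ : ∀ u ∈ Icc a b, g'.β u = g.β u)
    (hl : ∀ u ∈ Icc a b, g'.lamt u = g.lamt u) : GaugeSolOn J g' v a b := by
  refine ⟨fun u hu => ?_, fun u hu p hp => ⟨?_, ?_⟩, fun u hu => ?_⟩
  · rw [hβ u hu]; exact h.reeb u hu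
  · rw [GaugeParam.bc_congr (hβ u hu), hl u hu]; exact (h.gaugeEq u hu p hp).eq_X
  · rw [GaugeParam.bc_congr (hβ u hu), hl u hu]
    exact (h.gaugeEq u hu p hp).deriv_β.congr (fun s hs => GaugeParam.bc_congr (hβ s hs) p)
      (GaugeParam.bc_congr (hβ u hu) p)
  · have := h.lamEq u hu
    rw [LamEq, ← hβ u hu] at this
    exact this.congr hl (hl u hu)

lemma GaugeSolOn.glue {g : GaugeParam c} {v : Variation c} {a s b : ℝ} (has : a ≤ s) (hsb : s ≤ b)
    (h1 : GaugeSolOn J g v a s) (h2 : GaugeSolOn J g v s b) : GaugeSolOn J g v a b := by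
  have cases {u} (hu : u ∈ Icc a b) : u ∈ Icc a s ∨ u ∈ Icc s b := by
    rwa [← mem_union, Icc_union_Icc_eq_Icc has hsb]
  refine ⟨fun u hu => ?_, fun u hu p hp => ⟨?_, ?_⟩, fun u hu => ?_⟩
  · exact (cases hu).elim (h1.reeb u) (h2.reeb u)
  · exact (cases hu).elim (fun h => (h1.gaugeEq u h p hp).eq_X)
      (fun h => (h2.gaugeEq u h p hp).eq_X)
  · exact hasDerivWithinAt_Icc_glue has hsb (fun h => (h1.gaugeEq u h p hp).deriv_β)
      (fun h => (h2.gaugeEq u h p hp).deriv_β)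
  · exact hasDerivWithinAt_Icc_glue has hsb (fun h => h1.lamEq u h) (fun h => h2.lamEq u h)

/-- The linear operator of the system `β' = β ∘ D + λ_t B`, `λ_t' = -β(Λζ)` in the chart
around `p`. -/
def gaugeOp (J : JacobiStructure F M) (c : Fields F M) (p : M) (u : ℝ) :
    ((F →L[ℝ] ℝ) × ℝ) →L[ℝ] ((F →L[ℝ] ℝ) × ℝ) :=
  (((ContinuousLinearMap.compL ℝ F F ℝ).flip (c.Dc J p u)).comp (.fst ℝ (F →L[ℝ] ℝ) ℝ)
      + (ContinuousLinearMap.snd ℝ (F →L[ℝ] ℝ) ℝ).smulRight (c.Bc J p u)).prod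
    (-(ContinuousLinearMap.apply ℝ ℝ (c.Λc J p u (c.zc p u))).comp (.fst ℝ (F →L[ℝ] ℝ) ℝ))

lemma gaugeOp_apply (y : (F →L[ℝ] ℝ) × ℝ) : gaugeOp J c p u y =
    (y.1.comp (c.Dc J p u) + y.2 • c.Bc J p u, -y.1 (c.Λc J p u (c.zc p u))) := by
  simp [gaugeOp]

lemma continuousOn_gaugeOp (hc : InConstraintManifold J c) (p : M) :
    ContinuousOn (gaugeOp J c p) (chartPart c p) := by
  have h1 : ContinuousOn (fun u => (ContinuousLinearMap.compL ℝ F F ℝ).flip (c.Dc J p u))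
      (chartPart c p) :=
    (ContinuousLinearMap.continuous _).comp_continuousOn (hc.continuousOn_Dc p)
  have h2 : ContinuousOn (fun u => (ContinuousLinearMap.snd ℝ (F →L[ℝ] ℝ) ℝ).smulRight
      (c.Bc J p u)) (chartPart c p) :=
    ((ContinuousLinearMap.smulRightL ℝ ((F →L[ℝ] ℝ) × ℝ) (F →L[ℝ] ℝ)
      (ContinuousLinearMap.snd ℝ (F →L[ℝ] ℝ) ℝ)).continuous.comp_continuousOn
        (hc.continuousOn_Bc p) :)
  have h3 : ContinuousOn (fun u => ContinuousLinearMap.apply ℝ ℝ (c.Λc J p u (c.zc p u)))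
      (chartPart c p) :=
    (ContinuousLinearMap.apply ℝ ℝ).continuous.comp_continuousOn
      ((hc.continuousOn_Λc p).clm_apply (hc.continuousOn_zc p))
  have h4 := (h1.clm_comp (continuousOn_const
    (c := ContinuousLinearMap.fst ℝ (F →L[ℝ] ℝ) ℝ))).add h2
  have h5 := (h3.clm_comp (continuousOn_const (c := ContinuousLinearMap.fst ℝ (F →L[ℝ] ℝ) ℝ))).neg
  exact (ContinuousLinearMap.prodₗᵢ (𝕜 := ℝ) ℝ).continuous.comp_continuousOn (h4.prodMk h5)

/-- The linear operator of the system `W' = -D W - q Λζ`, `q' = B(W)` for the defects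
`W = X̃ - (Λβ - λ_t E)` and `q = β(E)`. -/
def defectOp (J : JacobiStructure F M) (c : Fields F M) (p : M) (u : ℝ) :
    (F × ℝ) →L[ℝ] (F × ℝ) :=
  (-(c.Dc J p u).comp (.fst ℝ F ℝ)
      - (ContinuousLinearMap.snd ℝ F ℝ).smulRight (c.Λc J p u (c.zc p u))).prod
    ((c.Bc J p u).comp (.fst ℝ F ℝ))

lemma defectOp_apply (y : F × ℝ) : defectOp J c p u y =
    (-c.Dc J p u y.1 - y.2 • c.Λc J p u (c.zc p u), c.Bc J p u y.1) := by
  simp [defectOp]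

lemma continuousOn_defectOp (hc : InConstraintManifold J c) (p : M) :
    ContinuousOn (defectOp J c p) (chartPart c p) := by
  have h2 : ContinuousOn (fun u => (ContinuousLinearMap.snd ℝ F ℝ).smulRight
      (c.Λc J p u (c.zc p u))) (chartPart c p) :=
    ((ContinuousLinearMap.smulRightL ℝ (F × ℝ) F
      (ContinuousLinearMap.snd ℝ F ℝ)).continuous.comp_continuousOn
        ((hc.continuousOn_Λc p).clm_apply (hc.continuousOn_zc p)) :)
  have h4 := ((hc.continuousOn_Dc p).clm_comp
    (continuousOn_const (c := ContinuousLinearMap.fst ℝ F ℝ))).neg.sub h2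
  have h5 := (hc.continuousOn_Bc p).clm_comp
    (continuousOn_const (c := ContinuousLinearMap.fst ℝ F ℝ))
  exact (ContinuousLinearMap.prodₗᵢ (𝕜 := ℝ) ℝ).continuous.comp_continuousOn (h4.prodMk h5)

lemma exists_gaugeSolOn_chart [CompleteSpace F] (hc : InConstraintManifold J c) {v : Variation c}
    (hv : IsTangent J c v) {s s' : ℝ} (hss : s ≤ s') (hp : Icc s s' ⊆ chartPart c p)
    {b₀ : F →L[ℝ] ℝ} {l₀ : ℝ} (hX : (v.rep p s).1 = c.Λc J p s b₀ - l₀ • c.Ec J p s)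
    (hb : b₀ (c.Ec J p s) = 0) :
    ∃ g : GaugeParam c, g.bc p s = b₀ ∧ g.lamt s = l₀ ∧ GaugeSolOn J g v s s' := by
  have hI : Icc s s' ⊆ Icc 0 1 := fun u hu => (hp hu).1
  obtain ⟨-, -, hv3, hv4, hv5⟩ := isTangent_iff.1 hv
  have hs : s ∈ Icc s s' := ⟨le_rfl, hss⟩
  obtain ⟨y, hy0, hy⟩ := exists_solution_linear hss ((continuousOn_gaugeOp hc p).mono hp)
    (((hv3 p).snd.neg.mono hp).prodMk (hv4.neg.mono hI)) (b₀, l₀)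
  have hy1 (t) (ht : t ∈ Icc s s') : HasDerivWithinAt (fun u => (y u).1)
      (-(v.rep p t).2 + ((y t).1).comp (c.Dc J p t) + (y t).2 • c.Bc J p t) (Icc s s') t := by
    refine (hasFDerivAt_fst.comp_hasDerivWithinAt t (hy t ht)).congr_deriv ?_
    simp only [gaugeOp_apply, ContinuousLinearMap.coe_fst', Prod.fst_add, Pi.neg_apply]
    abel
  have hy2 (t) (ht : t ∈ Icc s s') : HasDerivWithinAt (fun u => (y u).2)
      (-v.2 t - (y t).1 (c.Λc J p t (c.zc p t))) (Icc s s') t := by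
    refine (hasFDerivAt_snd.comp_hasDerivWithinAt t (hy t ht)).congr_deriv ?_
    simp only [gaugeOp_apply, ContinuousLinearMap.coe_snd', Prod.snd_add, Pi.neg_apply]
    ring
  have hdef : ∀ t ∈ Icc s s', (((v.rep p t).1 - (c.Λc J p t (y t).1 - (y t).2 • c.Ec J p t),
      (y t).1 (c.Ec J p t)) : F × ℝ) = 0 := by
    refine linear_solution_eq_zero ((continuousOn_defectOp hc p).mono hp) (fun t ht => ?_) ?_
    · have d1 := ((hv5 p t (hp ht)).deriv_X.mono hI).sub
        (hc.hasDerivWithinAt_gauge (b := fun u => (y u).1) (l := fun u => (y u).2) (hp ht) hI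
          (hy1 t ht) (hy2 t ht))
      have d2 := hc.hasDerivWithinAt_gauge_reeb (b := fun u => (y u).1) (l := fun u => (y u).2)
        (hp ht) hI (hy1 t ht)
      refine HasDerivWithinAt.congr_deriv (d1.prodMk d2) ?_
      rw [defectOp_apply]
      refine Prod.ext ?_ ?_
      · simp only [map_sub, map_smul]
        abel
      · have := (hv5 p t (hp ht)).eq_ζ
        simp only [map_sub] at this ⊢
        linarith
    · rw [hy0, hX, sub_self, hb]; rfl
  let g : GaugeParam c := ⟨fun u => ((y u).1).comp (tangentCoord F p (c.X u)), fun u => (y u).2⟩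
  have hg : ∀ u ∈ Icc s s', g.bc p u = (y u).1 := fun u hu => g.bc_eq_of_comp (hp hu) rfl
  refine ⟨g, by rw [hg s hs, hy0], by simp only [g, hy0], fun u hu => ?_, fun u hu q hq => ?_,
    fun u hu => ?_⟩
  · rw [g.β_reeb J (hp hu), hg u hu]
    exact (Prod.ext_iff.1 (hdef u hu)).2
  · refine GaugeEq.trans hc hI (hp hu) hq ⟨?_, ?_⟩
    · rw [hg u hu]
      exact sub_eq_zero.1 (Prod.ext_iff.1 (hdef u hu)).1
    · rw [hg u hu]
      exact (hy1 u hu).congr hg (hg u hu)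
  · rw [LamEq, g.β_bivector J (hp hu), hg u hu]
    exact hy2 u hu

lemma exists_gaugeSolOn [CompleteSpace F] (hc : InConstraintManifold J c)
    (hE : ∀ x : M, J.E x ≠ 0) {v : Variation c} (hv : IsTangent J c v) {p : M}
    (hp : 0 ∈ chartPart c p) {r : ℝ} (hX : (v.rep p 0).1 = r • c.Ec J p 0) :
    ∃ g : GaugeParam c, g.β 0 = 0 ∧ GaugeSolOn J g v 0 1 := by
  classical
  refine path_induction hc hE (P := fun s => ∃ g : GaugeParam c, g.β 0 = 0 ∧ GaugeSolOn J g v 0 s)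
    ?_ ?_
  · obtain ⟨g, hg, -, hg'⟩ := exists_gaugeSolOn_chart hc hv (le_refl (0 : ℝ)) (p := p) (b₀ := 0)
      (l₀ := -r) (by rw [Icc_self, singleton_subset_iff]; exact hp) (by simp [hX]) (by simp)
    exact ⟨g, (g.bc_eq_zero_iff hp).1 hg, hg'⟩
  · rintro s s' h0s hss - p hp - - ⟨g₁, hg0, hg₁⟩
    have hs : s ∈ Icc s s' := ⟨le_rfl, hss⟩
    have hs0 : s ∈ Icc 0 s := ⟨h0s, le_rfl⟩
    obtain ⟨g₂, hb, hl, hg₂⟩ := exists_gaugeSolOn_chart hc hv hss hp (b₀ := g₁.bc p s)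
      (l₀ := g₁.lamt s) (hg₁.gaugeEq s hs0 p (hp hs)).eq_X
      ((g₁.β_reeb J (hp hs)).symm.trans (hg₁.reeb s hs0))
    have hβ : g₂.β s = g₁.β s := by rw [← g₂.bc_comp (hp hs), hb, g₁.bc_comp (hp hs)]
    let g : GaugeParam c := ⟨fun u => if u ≤ s then g₁.β u else g₂.β u,
      fun u => if u ≤ s then g₁.lamt u else g₂.lamt u⟩
    refine ⟨g, by simp [g, h0s, hg0], ?_⟩
    refine (hg₁.congr (fun u hu => if_pos hu.2) (fun u hu => if_pos hu.2)).glue h0s hss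
      (hg₂.congr (fun u hu => ?_) fun u hu => ?_)
    · rcases hu.1.eq_or_lt with rfl | h
      · simp [g, hβ]
      · simp [g, h.not_ge]
    · rcases hu.1.eq_or_lt with rfl | h
      · simp [g, hl]
      · simp [g, h.not_ge]

/-- A tangent vector whose component `X̃(0)` is a multiple of the Reeb field is the gauge variation
of a gauge parameter with `β(0) = 0` (but in general `β(1) ≠ 0`). -/
lemma exists_gauge_of_isTangent [CompleteSpace F] (hc : InConstraintManifold J c)
    (hE : ∀ x : M, J.E x ≠ 0) {v : Variation c} (hv : IsTangent J c v) {p : M}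
    (hp : 0 ∈ chartPart c p) {r : ℝ} (hX : (v.rep p 0).1 = r • c.Ec J p 0) :
    ∃ g : GaugeParam c, g.IsC1 ∧ (∀ u ∈ Icc (0 : ℝ) 1, g.β u (J.E (c.X u)) = 0) ∧ g.β 0 = 0 ∧
      IsGaugeVariation J g v := by
  obtain ⟨g, h0, hg⟩ := exists_gaugeSolOn hc hE hv hp hX
  have h1 : g.IsC1 := GaugeParam.isC1_of_gaugeEq hc hv (fun p u hp => hg.gaugeEq u hp.1 p hp)
    hg.lamEq
  exact ⟨g, h1, hg.reeb, h0, (isGaugeVariation_iff hc h1).2 ⟨hv.zero_fst, hv.zero_snd,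
    fun p u hp => hg.gaugeEq u hp.1 p hp, hg.lamEq⟩⟩

/-! ### Tangent vectors with prescribed initial value -/

lemma Variation.rep_congr {v w : Variation c} (h : v.1 u = w.1 u) (p : M) :
    v.rep p u = w.rep p u := by
  rw [Variation.rep, h]; rfl

/-- `v` solves the linearised constraints on `[a, b]`, with `λ̃_u = 0`. -/
structure TangentSolOn (J : JacobiStructure F M) (v : Variation c) (a b : ℝ) : Prop where
  tangentEq : ∀ u ∈ Icc a b, ∀ p : M, u ∈ chartPart c p → TangentEq J v p (Icc a b) u
  continuous_rep : ∀ u ∈ Icc a b, ∀ p : M, u ∈ chartPart c p →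
    ContinuousWithinAt (v.rep p) (Icc a b) u
  lam_zero : ∀ u ∈ Icc a b, v.2 u = 0

lemma TangentSolOn.congr {v w : Variation c} {a b : ℝ} (h : TangentSolOn J v a b)
    (h1 : ∀ u ∈ Icc a b, w.1 u = v.1 u) (h2 : ∀ u ∈ Icc a b, w.2 u = v.2 u) :
    TangentSolOn J w a b := by
  have hr {u} (hu : u ∈ Icc a b) (p : M) : w.rep p u = v.rep p u := Variation.rep_congr (h1 u hu) p
  refine ⟨fun u hu p hp => ⟨?_, ?_⟩, fun u hu p hp => ?_, fun u hu => ?_⟩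
  · rw [hr hu, h2 u hu]
    exact (h.tangentEq u hu p hp).deriv_X.congr (fun s hs => by rw [hr hs]) (by rw [hr hu])
  · rw [hr hu]; exact (h.tangentEq u hu p hp).eq_ζ
  · exact (h.continuous_rep u hu p hp).congr (fun s hs => hr hs p) (hr hu p)
  · rw [h2 u hu, h.lam_zero u hu]

lemma TangentSolOn.glue {v : Variation c} {a s b : ℝ} (has : a ≤ s) (hsb : s ≤ b)
    (h1 : TangentSolOn J v a s) (h2 : TangentSolOn J v s b) : TangentSolOn J v a b := by
  have cases {u} (hu : u ∈ Icc a b) : u ∈ Icc a s ∨ u ∈ Icc s b := by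
    rwa [← mem_union, Icc_union_Icc_eq_Icc has hsb]
  refine ⟨fun u hu p hp => ⟨?_, ?_⟩, fun u hu p hp => ?_, fun u hu => ?_⟩
  · exact hasDerivWithinAt_Icc_glue has hsb (fun h => (h1.tangentEq u h p hp).deriv_X)
      (fun h => (h2.tangentEq u h p hp).deriv_X)
  · exact (cases hu).elim (fun h => (h1.tangentEq u h p hp).eq_ζ)
      (fun h => (h2.tangentEq u h p hp).eq_ζ)
  · exact continuousWithinAt_Icc_glue has hsb (fun h => h1.continuous_rep u h p hp)
      (fun h => h2.continuous_rep u h p hp)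
  · exact (cases hu).elim (h1.lam_zero u) (h2.lam_zero u)

lemma continuousWithinAt_rep_trans (hc : InConstraintManifold J c) {v : Variation c}
    {σ : Set ℝ} (hσ : σ ⊆ Icc 0 1) (hp : u ∈ chartPart c p) (hq : u ∈ chartPart c q)
    (h : ContinuousWithinAt (v.rep p) σ u) : ContinuousWithinAt (v.rep q) σ u := by
  have hy := xc_mem_overlap hp hq
  have hx : ContinuousWithinAt (c.xc p) σ u :=
    (hc.hasDerivWithinAt_xc hp).continuousWithinAt.mono hσ
  have hz : ContinuousWithinAt (c.zc p) σ u :=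
    ((hc.continuousOn_zc p u hp).mono_of_mem_nhdsWithin (hc.chartPart_mem hp)).mono hσ
  have h1 := ContinuousAt.comp_continuousWithinAt (contDiffAt_jac hy).continuousAt hx
  have h2 := ContinuousAt.comp_continuousWithinAt (contDiffAt_invJac hy).continuousAt hx
  have h3 := ContinuousAt.comp_continuousWithinAt
    ((contDiffAt_invJac hy).fderiv_right (m := ∞) (by simp)).continuousAt hx
  have h4 := (h1.clm_apply h.fst).prodMk
    ((h.snd.clm_comp h2).add (hz.clm_comp (h3.clm_apply h.fst)))
  have e {s} (hs : s ∈ chartPart c p) (hs' : s ∈ chartPart c q) : v.rep q s =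
      (jac p q (c.xc p s) (v.rep p s).1, (v.rep p s).2.comp (invJac p q (c.xc p s))
        + (c.zc p s).comp (fderiv ℝ (invJac p q) (c.xc p s) (v.rep p s).1)) :=
    Prod.ext (v.rep_chart hs hs').1 (v.rep_chart hs hs').2
  refine h4.congr_of_eventuallyEq ?_ (e hp hq)
  filter_upwards [nhdsWithin_mono u hσ (hc.chartPart_mem hp),
    nhdsWithin_mono u hσ (hc.chartPart_mem hq)] with s hs hs' using e hs hs'

lemma exists_tangentSolOn_chart [CompleteSpace F] (hc : InConstraintManifold J c)
    {s s' : ℝ} (hss : s ≤ s') (hp : Icc s s' ⊆ chartPart c p) {e : F →L[ℝ] ℝ}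
    (he : ∀ u ∈ Icc s s', e (c.Ec J p u) ≠ 0) {w : F × (F →L[ℝ] ℝ)}
    (hw : w.2 (c.Ec J p s) + c.Bc J p s w.1 = 0) :
    ∃ v : Variation c, v.rep p s = w ∧ TangentSolOn J v s s' := by
  classical
  have hI : Icc s s' ⊆ Icc 0 1 := fun u hu => (hp hu).1
  have hs : s ∈ Icc s s' := ⟨le_rfl, hss⟩
  -- a covector field with `ε(E) = 1`; with `ζ̃ = κ - (κ(E) + B(X̃)) ε` for a constant `κ`, the
  -- second linearised constraint holds identically
  let ε : ℝ → F →L[ℝ] ℝ := fun u => (e (c.Ec J p u))⁻¹ • e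
  have hε : ∀ u ∈ Icc s s', ε u (c.Ec J p u) = 1 := fun u hu => by
    simp only [ε, smul_apply, smul_eq_mul]
    exact inv_mul_cancel₀ (he u hu)
  have cE := (hc.continuousOn_Ec (J := J) p).mono hp
  have cB := (hc.continuousOn_Bc (J := J) p).mono hp
  have cΛ := (hc.continuousOn_Λc (J := J) p).mono hp
  have cD := (hc.continuousOn_Dc (J := J) p).mono hp
  have cε : ContinuousOn ε (Icc s s') :=
    ((e.continuous.comp_continuousOn cE).inv₀ he).smul continuousOn_const
  have cA : ContinuousOn (fun u => -c.Dc J p u + (c.Bc J p u).smulRight (c.Λc J p u (ε u)))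
      (Icc s s') := by
    refine cD.neg.add ?_
    have := (ContinuousLinearMap.smulRightL ℝ F F).continuous.comp_continuousOn cB
    exact this.clm_apply (cΛ.clm_apply cε)
  obtain ⟨y, hy0, hy⟩ := exists_solution_linear hss cA
    (((cΛ.clm_apply (continuousOn_const (c := w.2))).neg).add
      (((continuousOn_const (c := w.2)).clm_apply cE).smul (cΛ.clm_apply cε))) w.1
  let z : ℝ → F →L[ℝ] ℝ := fun u => w.2 - (w.2 (c.Ec J p u) + c.Bc J p u (y u)) • ε u
  have cy : ContinuousOn y (Icc s s') := fun u hu => (hy u hu).continuousWithinAt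
  have cz : ContinuousOn z (Icc s s') := continuousOn_const.sub
    ((((continuousOn_const (c := w.2)).clm_apply cE).add (cB.clm_apply cy)).smul cε)
  have hz0 : z s = w.2 := by
    simp only [z, hy0, hw, zero_smul, sub_zero]
  have ht (u : ℝ) : ∃ t : TangentSpace (cotModel F) (c.path u),
      u ∈ Icc s s' → ∀ v : Variation c, v.1 u = t → v.rep p u = (y u, z u) := by
    by_cases hu : u ∈ Icc s s'
    · obtain ⟨t, ht⟩ := exists_tangent_of_rep (hp hu) (y u, z u)
      exact ⟨t, fun _ => ht⟩
    · exact ⟨0, fun h => absurd h hu⟩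
  choose t ht using ht
  let v : Variation c := (t, 0)
  have hv : ∀ u ∈ Icc s s', v.rep p u = (y u, z u) := fun u hu => ht u hu v rfl
  refine ⟨v, by rw [hv s hs, hy0, hz0], fun u hu q hq => ?_, fun u hu q hq => ?_, fun u _ => rfl⟩
  · refine TangentEq.trans hc hI (hp hu) hq ⟨?_, ?_⟩
    · refine HasDerivWithinAt.congr_deriv ((hy u hu).congr (fun s hs => by rw [hv s hs])
        (by rw [hv u hu])) ?_
      rw [hv u hu]
      simp only [v, z, Pi.zero_apply, zero_smul, map_sub, map_smul, add_apply, neg_apply,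
        ContinuousLinearMap.smulRight_apply, Pi.add_apply, Pi.neg_apply, Pi.smul_apply']
      module
    · rw [hv u hu]
      simp only [z, sub_apply, smul_apply, hε u hu, smul_eq_mul]
      ring
  · exact continuousWithinAt_rep_trans hc hI (hp hu) hq
      (((cy.prodMk cz) u hu).congr (fun s hs => hv s hs) (hv u hu))

/-- Every tangent vector of `M` at `X(0)` is the initial value of the component `X̃` of a tangent
vector to the constraint manifold, which can be chosen with `λ̃_u = 0`. -/
lemma exists_isTangent_initial [CompleteSpace F] (hc : InConstraintManifold J c)
    (hE : ∀ x : M, J.E x ≠ 0) {p : M} (hp : 0 ∈ chartPart c p) (w : F) :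
    ∃ v : Variation c, IsTangent J c v ∧ v.2 = 0 ∧ (v.rep p 0).1 = w := by
  classical
  obtain ⟨v, hv0, hv⟩ : ∃ v : Variation c, (v.rep p 0).1 = w ∧ TangentSolOn J v 0 1 := by
    refine path_induction hc hE
      (P := fun s => ∃ v : Variation c, (v.rep p 0).1 = w ∧ TangentSolOn J v 0 s) ?_ ?_
    · obtain ⟨e, he⟩ := SeparatingDual.exists_eq_one (R := ℝ) (Ec_ne_zero hE hp)
      obtain ⟨v, h1, h2⟩ := exists_tangentSolOn_chart hc (le_refl (0 : ℝ)) (p := p) (e := e)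
        (w := (w, -(c.Bc J p 0 w) • e)) (by rw [Icc_self, singleton_subset_iff]; exact hp)
        (by simp [he]) (by simp [he])
      exact ⟨v, by rw [h1], h2⟩
    · rintro s s' h0s hss - p' hp' e he ⟨v₁, h1, hv₁⟩
      have hs : s ∈ Icc s s' := ⟨le_rfl, hss⟩
      obtain ⟨v₂, h2, hv₂⟩ := exists_tangentSolOn_chart hc hss hp' he
        (hv₁.tangentEq s ⟨h0s, le_rfl⟩ p' (hp' hs)).eq_ζ
      have hvs : v₂.1 s = v₁.1 s := Variation.eq_of_rep_eq v₂ v₁ (hp' hs) h2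
      let v : Variation c := (fun u => if u ≤ s then v₁.1 u else v₂.1 u, 0)
      refine ⟨v, ?_, ?_⟩
      · rw [Variation.rep_congr (v := v) (w := v₁) (if_pos h0s), h1]
      refine (hv₁.congr (fun u hu => if_pos hu.2) (fun u hu => (hv₁.lam_zero u hu).symm)).glue
        h0s hss (hv₂.congr (fun u hu => ?_) fun u hu => (hv₂.lam_zero u hu).symm)
      rcases hu.1.eq_or_lt with rfl | h
      · simp [v, hvs]
      · simp [v, h.not_ge]
  let v' : Variation c := (fun u => if u ∈ Icc (0 : ℝ) 1 then v.1 u else 0, 0)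
  have h : TangentSolOn J v' 0 1 :=
    hv.congr (fun u hu => if_pos hu) (fun u hu => (hv.lam_zero u hu).symm)
  refine ⟨v', isTangent_iff.2 ⟨fun u hu => if_neg hu, fun u _ => rfl, fun p u hu => ?_,
    continuousOn_const, fun p u hu => h.tangentEq u hu.1 p hu⟩, rfl, ?_⟩
  · exact (h.continuous_rep u hu.1 p hu).mono fun _ hs => hs.1
  · rw [Variation.rep_congr (v := v') (w := v) (if_pos hp.1), hv0]

/-! ### Gauge parameters with prescribed final value -/

/-- Every covector `a` at `X(1)` with `a(E) = 0` is the final value of the component `β` of a gauge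
parameter with `β(0) = 0` whose gauge variation has `λ̃_u = 0`. -/
lemma exists_gauge_final (hc : InConstraintManifold J c) (hE : ∀ x : M, J.E x ≠ 0) {p : M}
    (hp : 1 ∈ chartPart c p) {a : F →L[ℝ] ℝ} (ha : a (c.Ec J p 1) = 0) :
    ∃ (g : GaugeParam c) (v : Variation c), g.IsC1 ∧
      (∀ u ∈ Icc (0 : ℝ) 1, g.β u (J.E (c.X u)) = 0) ∧ g.β 0 = 0 ∧ g.bc p 1 = a ∧
      IsGaugeVariation J g v ∧ v.2 = 0 := by
  classical
  obtain ⟨e, he⟩ := SeparatingDual.exists_ne_zero (R := ℝ) (Ec_ne_zero hE hp)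
  have hnear : ∀ᶠ u in 𝓝[Icc 0 1] (1 : ℝ), u ∈ chartPart c p ∧ e (c.Ec J p u) ≠ 0 := by
    have h3 : ContinuousWithinAt (fun u => e (c.Ec J p u)) (Icc 0 1) 1 :=
      e.continuous.continuousAt.comp_continuousWithinAt
        ((hc.continuousOn_Ec p 1 hp).mono_of_mem_nhdsWithin (hc.chartPart_mem hp))
    filter_upwards [hc.chartPart_mem hp, h3.eventually_ne he] with s hs hs' using ⟨hs, hs'⟩
  obtain ⟨r, hr, hr'⟩ : ∃ r < (1 : ℝ), ∀ u ∈ Icc (0 : ℝ) 1, r < u →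
      u ∈ chartPart c p ∧ e (c.Ec J p u) ≠ 0 := by
    obtain ⟨δ, hδ, h⟩ := Metric.mem_nhdsWithin_iff.1 hnear
    refine ⟨1 - δ, by linarith, fun u hu hu' => h ⟨?_, hu⟩⟩
    rw [Metric.mem_ball, Real.dist_eq, abs_lt]
    constructor <;> linarith [hu.2]
  -- the component of `β` is `a`, corrected to annihilate `E`, and cut off between `m` and `1`
  obtain ⟨m, hm, hm0, hm1⟩ : ∃ m : ℝ, r < m ∧ 0 < m ∧ m < 1 :=
    ⟨(max r 0 + 1) / 2, by linarith [le_max_left r 0, max_lt hr one_pos],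
      by linarith [le_max_right r 0], by linarith [max_lt hr one_pos]⟩
  let ρ : ℝ → ℝ := fun u => Real.smoothTransition ((u - m) / (1 - m))
  have hρ : ContDiff ℝ 1 ρ := Real.smoothTransition.contDiff.comp
    ((contDiff_id.sub contDiff_const).div_const _)
  have hρ0 : ∀ u ≤ m, ρ u = 0 := fun u hu =>
    Real.smoothTransition.zero_of_nonpos
      (div_nonpos_of_nonpos_of_nonneg (by linarith) (by linarith))
  have hρ1 : ρ 1 = 1 := by
    simp only [ρ]
    rw [div_self (by linarith), Real.smoothTransition.one]
  let b : ℝ → F →L[ℝ] ℝ := fun u => ρ u • (a - (a (c.Ec J p u) / e (c.Ec J p u)) • e)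
  let β : ∀ u : ℝ, Cotangent F M (c.X u) := fun u => (b u).comp (tangentCoord F p (c.X u))
  have hβ0 : ∀ u ≤ m, β u = 0 := fun u hu => by
    simp only [β, b, hρ0 u hu, zero_smul]
    exact ContinuousLinearMap.zero_comp _
  let g₀ : GaugeParam c := ⟨β, 0⟩
  have hbc : ∀ u ∈ Icc (0 : ℝ) 1, r < u → g₀.bc p u = b u := fun u hu hu' =>
    g₀.bc_eq_of_comp (hr' u hu hu').1 rfl
  have hreeb : ∀ u ∈ Icc (0 : ℝ) 1, g₀.β u (J.E (c.X u)) = 0 := by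
    intro u hu
    by_cases hum : u ≤ m
    · change β u _ = 0
      rw [hβ0 u hum]; rfl
    · have hru : r < u := hm.trans (not_le.1 hum)
      rw [g₀.β_reeb J (hr' u hu hru).1, hbc u hu hru]
      simp only [b, smul_apply, sub_apply, smul_eq_mul]
      change ρ u * (a (c.Ec J p u) - a (c.Ec J p u) / e (c.Ec J p u) * e (c.Ec J p u)) = 0
      rw [div_mul_cancel₀ _ (hr' u hu hru).2, sub_self, mul_zero]
  have hC1 : ContMDiffOn 𝓘(ℝ, ℝ) (cotModel F) 1 g₀.path (Icc 0 1) := by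
    intro u hu
    by_cases hum : u < m
    · have hq := mem_chartPart_self (c := c) hu
      rw [g₀.contMDiffWithinAt_path_iff hc hq]
      refine (contDiffWithinAt_const (c := (0 : F →L[ℝ] ℝ))).congr_of_eventuallyEq ?_
        ((g₀.bc_eq_zero_iff hq).2 (hβ0 u hum.le))
      filter_upwards [hc.chartPart_mem hq, mem_nhdsWithin_of_mem_nhds (Iio_mem_nhds hum)] with s hs
        hs' using (g₀.bc_eq_zero_iff hs).2 (hβ0 s (mem_Iio.1 hs').le)
    · have hru : r < u := hm.trans_le (not_lt.1 hum)
      rw [g₀.contMDiffWithinAt_path_iff hc (hr' u hu hru).1]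
      have hEc : ContDiffWithinAt ℝ 1 (c.Ec J p) (Icc 0 1) u := by
        have h1 : ContMDiffAt 𝓘(ℝ, F) 𝓘(ℝ, F) 1 (extChartAt 𝓘(ℝ, F) p) (c.X u) :=
          contMDiffAt_extChartAt' (by simpa using (hr' u hu hru).1.2)
        have h2 : ContDiffWithinAt ℝ 1 (c.xc p) (Icc 0 1) u :=
          contMDiffWithinAt_iff_contDiffWithinAt.1
            (h1.comp_contMDiffWithinAt u (hc.contMDiffOn_X u hu))
        exact ((J.contDiffAt_vectorRep (xc_mem_target (hr' u hu hru).1)).of_le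
          (by simp)).comp_contDiffWithinAt u h2
      have hb : ContDiffWithinAt ℝ 1 b (Icc 0 1) u :=
        hρ.contDiffWithinAt.smul (contDiffWithinAt_const.sub
          (((contDiffWithinAt_const.clm_apply hEc).div (contDiffWithinAt_const.clm_apply hEc)
            (hr' u hu hru).2).smul contDiffWithinAt_const))
      refine hb.congr_of_eventuallyEq ?_ (hbc u hu hru)
      filter_upwards [self_mem_nhdsWithin, mem_nhdsWithin_of_mem_nhds (Ioi_mem_nhds hru)] with s hs
        hs' using hbc s hs hs'
  have hpair : ContinuousOn (fun u => g₀.β u (J.Λ (c.X u) (c.ζ u))) (Icc 0 1) :=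
    continuousOn_pairing hc g₀ fun q u hu => by
      have := (g₀.contMDiffWithinAt_path_iff hc hu).1 (hC1 u hu.1)
      exact this.continuousWithinAt.mono fun _ hs => hs.1
  -- `λ_t` is a primitive of `-Λⁱʲ βᵢ ζⱼ`
  obtain ⟨l, -, hl⟩ := exists_solution_linear (A := fun _ => (0 : ℝ →L[ℝ] ℝ)) zero_le_one
    continuousOn_const hpair.neg 0
  let g : GaugeParam c := ⟨β, l⟩
  have hg : g.IsC1 := by
    refine ⟨hC1, fun u hu => contDiffWithinAt_one_of_hasDerivWithinAt self_mem_nhdsWithin subset_rfl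
      hu (fun t ht => (hl t ht).congr_deriv (zero_add _)) hpair.neg⟩
  obtain ⟨v, hv, -⟩ := existsUnique_isGaugeVariation hc hg
  refine ⟨g, v, hg, hreeb, hβ0 0 hm0.le, ?_, hv, funext fun u => ?_⟩
  · have h1 := hbc 1 ⟨zero_le_one, le_rfl⟩ hr
    change g₀.bc p 1 = a
    rw [h1]
    simp [b, hρ1, ha]
  · by_cases hu : u ∈ Icc (0 : ℝ) 1
    · rw [hv.eq_lam u hu, (hl u hu).derivWithin (uniqueDiffWithinAt_Icc01 hu)]
      change -(0 + -(g₀.β u (J.Λ (c.X u) (c.ζ u))) + g₀.β u (J.Λ (c.X u) (c.ζ u))) = 0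
      ring
    · exact hv.zero_snd u hu

/-! ### The linear relation between gauge parameters and variations -/

/-- `v` is the gauge variation of `g`, where `g` satisfies all conditions on gauge parameters
except `β(1) = 0`. -/
structure GaugeRel (J : JacobiStructure F M) {c : Fields F M} (g : GaugeParam c)
    (v : Variation c) : Prop where
  isC1 : g.IsC1
  reeb : ∀ u ∈ Icc (0 : ℝ) 1, g.β u (J.E (c.X u)) = 0
  β_zero : g.β 0 = 0
  isGaugeVariation : IsGaugeVariation J g v

lemma GaugeRel.isTangent (hc : InConstraintManifold J c) {g : GaugeParam c} {v : Variation c}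
    (h : GaugeRel J g v) : IsTangent J c v :=
  isTangent_of_isGaugeVariation hc h.isC1 h.reeb h.isGaugeVariation

lemma GaugeRel.gaugeEq (hc : InConstraintManifold J c) {g : GaugeParam c} {v : Variation c}
    (h : GaugeRel J g v) (hp : u ∈ chartPart c p) : GaugeEq J g v p (Icc 0 1) u :=
  ((isGaugeVariation_iff hc h.isC1).1 h.isGaugeVariation).2.2.1 p u hp

lemma GaugeRel.lamEq (hc : InConstraintManifold J c) {g : GaugeParam c} {v : Variation c}
    (h : GaugeRel J g v) (hu : u ∈ Icc (0 : ℝ) 1) : LamEq J g v (Icc 0 1) u :=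
  ((isGaugeVariation_iff hc h.isC1).1 h.isGaugeVariation).2.2.2 u hu

/-- Gauge parameters as elements of a vector space. -/
abbrev GaugePair (c : Fields F M) : Type _ := (∀ u : ℝ, Cotangent F M (c.X u)) × (ℝ → ℝ)

/-- The gauge parameter given by a pair of fields. -/
def GaugePair.toParam (x : GaugePair c) : GaugeParam c := ⟨x.1, x.2⟩

lemma GaugePair.bc_add (x y : GaugePair c) (hp : u ∈ chartPart c p) :
    (x + y).toParam.bc p u = x.toParam.bc p u + y.toParam.bc p u := by
  refine (x + y).toParam.bc_eq_of_comp hp ?_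
  rw [ContinuousLinearMap.add_comp, GaugeParam.bc_comp _ hp, GaugeParam.bc_comp _ hp]
  rfl

lemma GaugePair.bc_smul (r : ℝ) (x : GaugePair c) (hp : u ∈ chartPart c p) :
    (r • x).toParam.bc p u = r • x.toParam.bc p u := by
  refine (r • x).toParam.bc_eq_of_comp hp ?_
  rw [ContinuousLinearMap.smul_comp, GaugeParam.bc_comp _ hp]
  rfl

lemma GaugeRel.mk_of_gaugeEq (hc : InConstraintManifold J c) {g : GaugeParam c}
    {v : Variation c} (hv : IsTangent J c v)
    (hβ : ∀ u ∈ Icc (0 : ℝ) 1, g.β u (J.E (c.X u)) = 0) (h0 : g.β 0 = 0)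
    (h : ∀ p : M, ∀ u ∈ chartPart c p, GaugeEq J g v p (Icc 0 1) u)
    (hl : ∀ u ∈ Icc (0 : ℝ) 1, LamEq J g v (Icc 0 1) u) : GaugeRel J g v :=
  have h1 := GaugeParam.isC1_of_gaugeEq hc hv h hl
  ⟨h1, hβ, h0, (isGaugeVariation_iff hc h1).2 ⟨hv.zero_fst, hv.zero_snd, h, hl⟩⟩

lemma GaugeRel.add (hc : InConstraintManifold J c) {x y : GaugePair c} {v w : Variation c}
    (h : GaugeRel J x.toParam v) (h' : GaugeRel J y.toParam w) :
    GaugeRel J (x + y).toParam (v + w) := by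
  refine .mk_of_gaugeEq hc ((tangentSpaceC J c).add_mem (h.isTangent hc) (h'.isTangent hc))
    (fun u hu => ?_) ?_ (fun p u hu => ⟨?_, ?_⟩) fun u hu => ?_
  · exact (congrArg₂ (· + ·) (h.reeb u hu) (h'.reeb u hu)).trans (add_zero 0)
  · exact (congrArg₂ (· + ·) h.β_zero h'.β_zero).trans (add_zero _)
  · rw [Variation.rep_add, Prod.fst_add, (h.gaugeEq hc hu).eq_X, (h'.gaugeEq hc hu).eq_X,
      GaugePair.bc_add x y hu, map_add]
    change _ = _ - (x.toParam.lamt u + y.toParam.lamt u) • _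
    module
  · have := (h.gaugeEq hc hu).deriv_β.add (h'.gaugeEq hc hu).deriv_β
    refine (this.congr_of_eventuallyEq ?_ (GaugePair.bc_add x y hu)).congr_deriv ?_
    · filter_upwards [hc.chartPart_mem hu] with s hs using GaugePair.bc_add x y hs
    · rw [Variation.rep_add, Prod.snd_add, GaugePair.bc_add x y hu, ContinuousLinearMap.add_comp]
      change _ = _ + (x.toParam.lamt u + y.toParam.lamt u) • _
      module
  · refine HasDerivWithinAt.congr_deriv (HasDerivWithinAt.add (h.lamEq hc hu) (h'.lamEq hc hu)) ?_
    change _ = -(v.2 u + w.2 u) - (x.toParam.β u _ + y.toParam.β u _)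
    ring

lemma GaugeRel.smul (hc : InConstraintManifold J c) (r : ℝ) {x : GaugePair c} {v : Variation c}
    (h : GaugeRel J x.toParam v) : GaugeRel J (r • x).toParam (r • v) := by
  refine .mk_of_gaugeEq hc ((tangentSpaceC J c).smul_mem r (h.isTangent hc))
    (fun u hu => ?_) ?_ (fun p u hu => ⟨?_, ?_⟩) fun u hu => ?_
  · exact (congrArg (r • ·) (h.reeb u hu)).trans (smul_zero r)
  · exact (congrArg (r • ·) h.β_zero).trans (smul_zero r)
  · rw [Variation.rep_smul, Prod.smul_fst, (h.gaugeEq hc hu).eq_X,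
      GaugePair.bc_smul r x hu, map_smul]
    change _ = _ - (r * x.toParam.lamt u) • _
    module
  · have := (h.gaugeEq hc hu).deriv_β.const_smul r
    refine (this.congr_of_eventuallyEq ?_ (GaugePair.bc_smul r x hu)).congr_deriv ?_
    · filter_upwards [hc.chartPart_mem hu] with s hs using GaugePair.bc_smul r x hs
    · rw [Variation.rep_smul, Prod.smul_snd, GaugePair.bc_smul r x hu,
        ContinuousLinearMap.smul_comp]
      change _ = _ + (r * x.toParam.lamt u) • _
      module
  · refine HasDerivWithinAt.congr_deriv (HasDerivWithinAt.const_smul r (h.lamEq hc hu)) ?_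
    change r * _ = -(r * v.2 u) - (r * x.toParam.β u _)
    ring

lemma GaugeRel.zero (hc : InConstraintManifold J c) :
    GaugeRel J (0 : GaugePair c).toParam (0 : Variation c) := by
  have hb : ∀ {p u}, u ∈ chartPart c p → (0 : GaugePair c).toParam.bc p u = 0 :=
    fun hu => (GaugeParam.bc_eq_zero_iff _ hu).2 rfl
  refine .mk_of_gaugeEq hc (tangentSpaceC J c).zero_mem
    (fun u hu => rfl) rfl (fun p u hu => ⟨?_, ?_⟩) fun u hu => ?_
  · rw [Variation.rep_zero, hb hu, map_zero]
    change _ = _ - (0 : ℝ) • _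
    simp
  · refine ((hasDerivWithinAt_const u _ (0 : F →L[ℝ] ℝ)).congr_of_eventuallyEq ?_
      (hb hu)).congr_deriv ?_
    · filter_upwards [hc.chartPart_mem hu] with s hs using hb hs
    · rw [Variation.rep_zero, hb hu]
      change _ = _ + (0 : ℝ) • _
      simp
  · refine HasDerivWithinAt.congr_deriv (hasDerivWithinAt_const u _ (0 : ℝ)) ?_
    change 0 = -(0 : ℝ) - 0
    ring

/-- The relation between gauge parameters and those of their gauge variations that lie in `W`. -/
def gaugeGraph (hc : InConstraintManifold J c) (W : Submodule ℝ (Variation c)) :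
    Submodule ℝ (GaugePair c × Variation c) where
  carrier := {x | GaugeRel J x.1.toParam x.2 ∧ x.2 ∈ W}
  zero_mem' := ⟨.zero hc, W.zero_mem⟩
  add_mem' h h' := ⟨h.1.add hc h'.1, W.add_mem h.2 h'.2⟩
  smul_mem' r _ h := ⟨h.1.smul hc r, W.smul_mem r h.2⟩

/-- The gauge variations in `W` of admissible gauge parameters form a subspace. -/
lemma mem_span_gauge_iff (hc : InConstraintManifold J c) {W : Submodule ℝ (Variation c)}
    {v : Variation c} :
    v ∈ Submodule.span ℝ {v | ∃ g : GaugeParam c, g.Admissible J ∧ IsGaugeVariation J g v ∧ v ∈ W} ↔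
      ∃ x : GaugePair c, (x, v) ∈ gaugeGraph hc W ∧ x.1 1 = 0 := by
  let ev : GaugePair c × Variation c →ₗ[ℝ] Cotangent F M (c.X 1) :=
    (LinearMap.proj 1).comp ((LinearMap.fst ℝ _ _).comp (LinearMap.fst ℝ _ _))
  let S : Submodule ℝ (Variation c) :=
    (gaugeGraph hc W ⊓ LinearMap.ker ev).map (LinearMap.snd ℝ _ _)
  have hS : ∀ w, w ∈ S ↔ ∃ x : GaugePair c, (x, w) ∈ gaugeGraph hc W ∧ x.1 1 = 0 := by
    intro w
    constructor
    · rintro ⟨⟨x, w'⟩, ⟨h1, h2⟩, rfl⟩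
      exact ⟨x, h1, h2⟩
    · rintro ⟨x, h1, h2⟩
      exact ⟨(x, w), ⟨h1, h2⟩, rfl⟩
  rw [← hS]
  suffices h : {v | ∃ g : GaugeParam c, g.Admissible J ∧ IsGaugeVariation J g v ∧ v ∈ W}
      = (S : Set (Variation c)) by rw [h, Submodule.span_eq]
  ext w
  rw [SetLike.mem_coe, hS]
  constructor
  · rintro ⟨g, h1, h2, h3⟩
    exact ⟨(g.β, g.lamt), ⟨⟨⟨h1.1, h1.2⟩, h1.3, h1.4, h2⟩, h3⟩, h1.5⟩
  · rintro ⟨x, ⟨h1, h2⟩, h3⟩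
    exact ⟨x.toParam, ⟨h1.isC1.1, h1.isC1.2, h1.reeb, h1.β_zero, h3⟩, h1.isGaugeVariation, h2⟩

/-! ### Estimates for gauge parameters -/

/-- The neighbourhoods of a variation in the topology of uniform convergence. -/
def variationNhds (v₀ : Variation c) : Filter (Variation c) := @nhds _ (variationTopology c) v₀

lemma eventually_rep_lt (v₀ : Variation c) {K : Set ℝ} (hK : IsCompact K)
    (hp : K ⊆ chartPart c p) {ε : ℝ} (hε : 0 < ε) :
    ∀ᶠ v in variationNhds v₀, ∀ u ∈ K, ‖(v - v₀).rep p u‖ < ε := by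
  have h1 : variationTopology c ≤ TopologicalSpace.induced
      (fun v : Variation c =>
        UniformOnFun.ofFun {K : Set ℝ | IsCompact K ∧ K ⊆ chartPart c p} (v.rep p))
      inferInstance := inf_le_left.trans (iInf_le _ p)
  have h2 := nhds_mono (a := v₀) h1
  rw [nhds_induced] at h2
  have h3 := UniformOnFun.tendsto_iff_tendstoUniformlyOn.1 (Filter.map_le_iff_le_comap.2 h2) K
    ⟨hK, hp⟩
  filter_upwards [Metric.tendstoUniformlyOn_iff.1 h3 ε hε] with v hv u hu
  have := hv u hu
  rw [sub_eq_add_neg, ← neg_one_smul ℝ v₀, Variation.rep_add, Variation.rep_smul, neg_one_smul,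
    ← sub_eq_add_neg, ← dist_eq_norm, dist_comm]
  exact this

lemma eventually_snd_lt (v₀ : Variation c) {ε : ℝ} (hε : 0 < ε) :
    ∀ᶠ v in variationNhds v₀, ∀ u ∈ Icc (0 : ℝ) 1, ‖(v - v₀).2 u‖ < ε := by
  have h1 : variationTopology c ≤ TopologicalSpace.induced
      (fun v : Variation c => UniformOnFun.ofFun {Icc (0 : ℝ) 1} v.2) inferInstance := inf_le_right
  have h2 := nhds_mono (a := v₀) h1
  rw [nhds_induced] at h2
  have h3 := UniformOnFun.tendsto_iff_tendstoUniformlyOn.1 (Filter.map_le_iff_le_comap.2 h2) _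
    (mem_singleton _)
  filter_upwards [Metric.tendstoUniformlyOn_iff.1 h3 ε hε] with v hv u hu
  have := hv u hu
  rw [dist_comm, dist_eq_norm] at this
  exact this

/-- Variations close to `v₀` differ from `v₀` by variations whose gauge parameters, as far as they
exist, have a small value at `u = 1`: they solve a linear differential equation with small
inhomogeneity, and `β(0) = 0` makes the initial value small as well. -/
lemma eventually_bc_one_le (hc : InConstraintManifold J c) (hE : ∀ x : M, J.E x ≠ 0)
    (v₀ : Variation c) (hp : 1 ∈ chartPart c p) {ε : ℝ} (hε : 0 < ε) :
    ∀ᶠ v in variationNhds v₀, ∀ g : GaugeParam c, GaugeRel J g (v - v₀) → ‖g.bc p 1‖ ≤ ε := by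
  suffices h : ∀ q : M, 1 ∈ chartPart c q → ∀ ε > 0, ∀ᶠ v in variationNhds v₀,
      ∀ g : GaugeParam c, GaugeRel J g (v - v₀) → ‖g.bc q 1‖ ≤ ε ∧ ‖g.lamt 1‖ ≤ ε from
    (h p hp ε hε).mono fun v hv g hg => (hv g hg).1
  refine path_induction hc hE (P := fun s => ∀ q : M, s ∈ chartPart c q → ∀ ε > 0,
    ∀ᶠ v in variationNhds v₀, ∀ g : GaugeParam c, GaugeRel J g (v - v₀) →
      ‖g.bc q s‖ ≤ ε ∧ ‖g.lamt s‖ ≤ ε) ?_ ?_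
  · intro q hq ε hε
    have hE0 : 0 < ‖c.Ec J q 0‖ := norm_pos_iff.2 (Ec_ne_zero hE hq)
    filter_upwards [eventually_rep_lt v₀ (isCompact_singleton (x := (0 : ℝ)))
      (singleton_subset_iff.2 hq) (mul_pos hε hE0)] with v hv g hg
    have hb : g.bc q 0 = 0 := (g.bc_eq_zero_iff hq).2 hg.β_zero
    refine ⟨by rw [hb, norm_zero]; exact hε.le, ?_⟩
    have h1 := (hg.gaugeEq hc hq).eq_X
    rw [hb, map_zero, zero_sub] at h1
    have h2 := (norm_fst_le _).trans_lt (hv 0 (mem_singleton _))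
    rw [h1, norm_neg, norm_smul] at h2
    exact (lt_of_mul_lt_mul_right h2 hE0.le).le
  · intro s s' h0s hss _ p hp _ _ ih q hq ε hε
    have hs : s ∈ Icc s s' := ⟨le_rfl, hss⟩
    have hs' : s' ∈ Icc s s' := ⟨hss, le_rfl⟩
    have hI : Icc s s' ⊆ Icc 0 1 := fun u hu => (hp hu).1
    obtain ⟨C, hC, hbound⟩ := exists_linear_bound hss ((continuousOn_gaugeOp (J := J) hc p).mono hp)
    set N : ℝ := ‖invJac p q (c.xc p s')‖ with hN
    have hN0 : 0 ≤ N := norm_nonneg _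
    have hδ : 0 < ε / (C * (N + 1)) := div_pos hε (mul_pos hC (by linarith))
    set δ := ε / (C * (N + 1)) with hδ_def
    have hδε : C * δ * (N + 1) = ε := by rw [hδ_def]; field_simp
    filter_upwards [ih p (hp hs) δ hδ, eventually_rep_lt v₀ isCompact_Icc hp hδ,
      eventually_snd_lt v₀ hδ] with v h1 h2 h3 g hg
    have key : ‖(g.bc p s', g.lamt s')‖ ≤ C * δ := by
      refine hbound (fun u => (g.bc p u, g.lamt u))
        (fun u => (-((v - v₀).rep p u).2, -(v - v₀).2 u)) δ hδ.le (fun t ht => ?_) ?_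
        (fun t ht => ?_) s' hs'
      · refine HasDerivWithinAt.congr_deriv (((hg.gaugeEq hc (hp ht)).deriv_β.mono hI).prodMk
          ((hg.lamEq hc (hI ht)).mono hI)) ?_
        rw [gaugeOp_apply, g.β_bivector J (hp ht)]
        refine Prod.ext ?_ ?_
        · simp only [Prod.fst_add]
          abel
        · simp only [Prod.snd_add]
          change _ - g.bc p t (c.Λc J p t (c.zc p t)) = _
          ring
      · exact norm_prod_le_iff.2 (h1 g hg)
      · refine norm_prod_le_iff.2 ⟨?_, ?_⟩
        · rw [norm_neg]
          exact (norm_snd_le _).trans (h2 t ht).le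
        · rw [norm_neg]
          exact (h3 t (hI ht)).le
    obtain ⟨k1, k2⟩ := norm_prod_le_iff.1 key
    have hCδ : 0 ≤ C * δ := by positivity
    refine ⟨?_, ?_⟩
    · rw [g.bc_trans (hp hs') hq]
      calc _ ≤ ‖g.bc p s'‖ * N := ContinuousLinearMap.opNorm_comp_le _ _
        _ ≤ C * δ * N := by gcongr
        _ ≤ ε := by nlinarith
    · exact k2.trans (by nlinarith)

/-! ### The codimension -/

/-- Dimension count: `𝒢` is a linear relation between parameters in `G` and vectors in `T`; the
vectors that have a parameter form the kernel of the surjection `f : T → Q`, and those that have a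
parameter in the kernel of `ev` form `S`. -/
lemma rank_quotient_of_relation {V G Q A : Type*} [AddCommGroup V] [Module ℝ V]
    [AddCommGroup G] [Module ℝ G] [AddCommGroup Q] [Module ℝ Q] [FiniteDimensional ℝ Q]
    [AddCommGroup A] [Module ℝ A] [FiniteDimensional ℝ A] {T S : Submodule ℝ V}
    {𝒢 : Submodule ℝ (G × V)} {f : V →ₗ[ℝ] Q} {ev : G →ₗ[ℝ] A} {A₀ : Submodule ℝ A}
    (mem_T : ∀ g v, (g, v) ∈ 𝒢 → v ∈ T)
    (f_eq_zero : ∀ v ∈ T, f v = 0 ↔ ∃ g, (g, v) ∈ 𝒢)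
    (f_surj : ∀ y, ∃ v ∈ T, f v = y)
    (ev_eq_zero : ∀ g, (g, 0) ∈ 𝒢 → ev g = 0)
    (ev_mem : ∀ g v, (g, v) ∈ 𝒢 → ev g ∈ A₀)
    (ev_surj : ∀ a ∈ A₀, ∃ g v, (g, v) ∈ 𝒢 ∧ ev g = a)
    (mem_S : ∀ v, v ∈ S ↔ ∃ g, (g, v) ∈ 𝒢 ∧ ev g = 0) :
    Module.rank ℝ (T ⧸ S.submoduleOf T) = (Module.finrank ℝ Q + Module.finrank ℝ A₀ : ℕ) := by
  have hST : S.submoduleOf T ≤ LinearMap.ker (f.comp T.subtype) := by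
    rintro ⟨v, hv⟩ hvS
    obtain ⟨g, hg, -⟩ := (mem_S v).1 hvS
    exact (f_eq_zero v hv).2 ⟨g, hg⟩
  let fbar : (T ⧸ S.submoduleOf T) →ₗ[ℝ] Q := (S.submoduleOf T).liftQ (f.comp T.subtype) hST
  have hf : Function.Surjective fbar := fun y => by
    obtain ⟨v, hv, rfl⟩ := f_surj y
    exact ⟨(S.submoduleOf T).mkQ ⟨v, hv⟩, rfl⟩
  let ψ : 𝒢 →ₗ[ℝ] (T ⧸ S.submoduleOf T) := (S.submoduleOf T).mkQ.comp
    (((LinearMap.snd ℝ G V).comp 𝒢.subtype).codRestrict T fun x => mem_T x.1.1 x.1.2 x.2)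
  let φ : 𝒢 →ₗ[ℝ] A₀ :=
    ((ev.comp (LinearMap.fst ℝ G V)).comp 𝒢.subtype).codRestrict A₀
      fun x => ev_mem x.1.1 x.1.2 x.2
  have hφ : LinearMap.range φ = ⊤ := LinearMap.range_eq_top.2 fun a => by
    obtain ⟨g, v, h, ha⟩ := ev_surj a.1 a.2
    exact ⟨⟨(g, v), h⟩, Subtype.ext ha⟩
  have hψ : LinearMap.range ψ = LinearMap.ker fbar := by
    ext y
    obtain ⟨⟨v, hv⟩, rfl⟩ := (S.submoduleOf T).mkQ_surjective y
    constructor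
    · rintro ⟨⟨⟨g, w⟩, h⟩, hw⟩
      rw [← hw]
      exact (f_eq_zero w (mem_T g w h)).2 ⟨g, h⟩
    · intro h
      obtain ⟨g, hg⟩ := (f_eq_zero v hv).1 h
      exact ⟨⟨(g, v), hg⟩, rfl⟩
  have hker : LinearMap.ker ψ = LinearMap.ker φ := by
    ext ⟨⟨g, v⟩, h⟩
    have e1 : (⟨(g, v), h⟩ : 𝒢) ∈ LinearMap.ker ψ ↔ v ∈ S :=
      Submodule.Quotient.mk_eq_zero (S.submoduleOf T)
    have e2 : (⟨(g, v), h⟩ : 𝒢) ∈ LinearMap.ker φ ↔ ev g = 0 := by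
      rw [LinearMap.mem_ker, Subtype.ext_iff]; rfl
    rw [e1, e2, mem_S]
    refine ⟨fun ⟨g', h', h0⟩ => ?_, fun h0 => ⟨g, h, h0⟩⟩
    have := ev_eq_zero (g - g') (by simpa using 𝒢.sub_mem h h')
    rwa [map_sub, h0, sub_zero] at this
  let e : LinearMap.ker fbar ≃ₗ[ℝ] A₀ :=
    ((LinearEquiv.ofEq _ _ hψ).symm.trans ψ.quotKerEquivRange.symm).trans
      ((Submodule.quotEquivOfEq _ _ hker).trans
        (φ.quotKerEquivRange.trans (LinearEquiv.ofTop _ hφ)))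
  let e' : ((T ⧸ S.submoduleOf T) ⧸ LinearMap.ker fbar) ≃ₗ[ℝ] Q :=
    fbar.quotKerEquivOfSurjective hf
  have : Module.Finite ℝ (LinearMap.ker fbar) := Module.Finite.equiv e.symm
  have : Module.Finite ℝ ((T ⧸ S.submoduleOf T) ⧸ LinearMap.ker fbar) := Module.Finite.equiv e'.symm
  have : Module.Finite ℝ (T ⧸ S.submoduleOf T) :=
    Module.Finite.of_submodule_quotient (LinearMap.ker fbar)
  rw [← Module.finrank_eq_rank, ← Submodule.finrank_quotient_add_finrank (LinearMap.ker fbar),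
    e.finrank_eq, e'.finrank_eq]

/-! ### The gauge directions are closed and of finite codimension -/

lemma finrank_quotient_span_singleton {V : Type*} [AddCommGroup V] [Module ℝ V]
    [FiniteDimensional ℝ V] {e : V} (he : e ≠ 0) :
    Module.finrank ℝ (V ⧸ Submodule.span ℝ {e}) + 1 = Module.finrank ℝ V := by
  rw [← Submodule.finrank_quotient_add_finrank (Submodule.span ℝ {e}), finrank_span_singleton he]

instance [FiniteDimensional ℝ F] (x : M) : FiniteDimensional ℝ (Cotangent F M x) :=
  inferInstanceAs (FiniteDimensional ℝ (F →L[ℝ] ℝ))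

/-- The covectors at `x` that annihilate the tangent vector `e`. -/
def annihilator (x : M) (e : TangentSpace 𝓘(ℝ, F) x) : Submodule ℝ (Cotangent F M x) where
  carrier := {a | a e = 0}
  zero_mem' := rfl
  add_mem' h h' := (congrArg₂ (· + ·) h h').trans (add_zero 0)
  smul_mem' r _ h := (congrArg (r • ·) h).trans (smul_zero r)

lemma finrank_annihilator [FiniteDimensional ℝ F] (x : M) {e : TangentSpace 𝓘(ℝ, F) x}
    (he : e ≠ 0) : Module.finrank ℝ (annihilator x e) + 1 = Module.finrank ℝ F := by
  let e₀ : F := e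
  have he₀ : e₀ ≠ 0 := he
  let ev : Module.Dual ℝ (F →L[ℝ] ℝ) := (ContinuousLinearMap.apply ℝ ℝ e₀).toLinearMap
  have hev : ev ≠ 0 := fun h => by
    obtain ⟨a, ha⟩ := SeparatingDual.exists_ne_zero (R := ℝ) he₀
    exact ha (LinearMap.congr_fun h a)
  have h1 : Module.finrank ℝ (F →L[ℝ] ℝ) = Module.finrank ℝ F :=
    (LinearMap.toContinuousLinearMap (𝕜 := ℝ) (E := F) (F' := ℝ)).finrank_eq.symm.trans
      Subspace.dual_finrank_eq
  rw [← h1, ← Module.Dual.finrank_ker_add_one_of_ne_zero hev]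
  rfl

/-- The component `X̃(0)` of a variation. -/
def initialValue (c : Fields F M) (p : M) : Variation c →ₗ[ℝ] F where
  toFun v := (v.rep p 0).1
  map_add' v w := by rw [Variation.rep_add]; rfl
  map_smul' r v := by rw [Variation.rep_smul]; rfl

/-- The class of `X̃(0)` modulo the Reeb field. -/
def initialClass (J : JacobiStructure F M) (c : Fields F M) (p : M) :
    Variation c →ₗ[ℝ] F ⧸ Submodule.span ℝ {c.Ec J p 0} :=
  (Submodule.span ℝ {c.Ec J p 0}).mkQ.comp (initialValue c p)

lemma initialClass_eq_zero_iff_mem {v : Variation c} :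
    initialClass J c p v = 0 ↔ (v.rep p 0).1 ∈ Submodule.span ℝ {c.Ec J p 0} :=
  Submodule.Quotient.mk_eq_zero _

lemma initialClass_eq_zero_iff {v : Variation c} :
    initialClass J c p v = 0 ↔ ∃ r : ℝ, (v.rep p 0).1 = r • c.Ec J p 0 := by
  rw [initialClass_eq_zero_iff_mem, Submodule.mem_span_singleton]
  exact exists_congr fun r => eq_comm

lemma GaugeRel.initialClass_eq_zero (hc : InConstraintManifold J c) (hp : 0 ∈ chartPart c p)
    {g : GaugeParam c} {v : Variation c} (h : GaugeRel J g v) : initialClass J c p v = 0 := by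
  refine initialClass_eq_zero_iff.2 ⟨-g.lamt 0, ?_⟩
  rw [(h.gaugeEq hc hp).eq_X, (g.bc_eq_zero_iff hp).2 h.β_zero, map_zero, zero_sub, neg_smul]

/-- The value at `u = 1` of the component `β` of a gauge parameter. -/
def finalValue (c : Fields F M) : GaugePair c →ₗ[ℝ] Cotangent F M (c.X 1) :=
  (LinearMap.proj 1).comp (LinearMap.fst ℝ (∀ u : ℝ, Cotangent F M (c.X u)) (ℝ → ℝ))

lemma mem_Icc_zero : (0 : ℝ) ∈ Icc (0 : ℝ) 1 := ⟨le_rfl, zero_le_one⟩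

lemma mem_Icc_one : (1 : ℝ) ∈ Icc (0 : ℝ) 1 := ⟨zero_le_one, le_rfl⟩

/-- Uniqueness of the gauge parameter, at the end of the path. -/
lemma GaugeRel.β_one_eq_zero (hc : InConstraintManifold J c) (hE : ∀ x : M, J.E x ≠ 0)
    {g : GaugeParam c} (h : GaugeRel J g (0 : Variation c)) : g.β 1 = 0 := by
  have hp := mem_chartPart_self (c := c) mem_Icc_one
  rw [← g.bc_eq_zero_iff hp, ← norm_le_zero_iff]
  refine le_of_forall_pos_le_add fun ε hε => ?_
  rw [zero_add]
  let _ := variationTopology c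
  exact mem_of_mem_nhds (eventually_bc_one_le hc hE 0 hp hε) g (by rwa [sub_self])

lemma exists_gauge_final_of_annihilator (hc : InConstraintManifold J c)
    (hE : ∀ x : M, J.E x ≠ 0) {a : Cotangent F M (c.X 1)} (ha : a (J.E (c.X 1)) = 0) :
    ∃ (g : GaugeParam c) (v : Variation c), GaugeRel J g v ∧ v.2 = 0 ∧ g.β 1 = a := by
  classical
  have hp := mem_chartPart_self (c := c) mem_Icc_one
  let g₁ : GaugeParam c := ⟨Function.update 0 1 a, 0⟩
  have h1 : g₁.β 1 = a := Function.update_self _ _ _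
  obtain ⟨g, v, hg, hr, h0, hb, hv, hv2⟩ := exists_gauge_final hc hE hp (a := g₁.bc (c.X 1) 1)
    ((g₁.β_reeb J hp).symm.trans (by rw [h1, ha]))
  exact ⟨g, v, ⟨hg, hr, h0, hv⟩, hv2, by rw [← g.bc_comp hp, hb, g₁.bc_comp hp, h1]⟩

lemma mem_gaugeGraph_of_rel (hc : InConstraintManifold J c) {W : Submodule ℝ (Variation c)}
    {g : GaugeParam c} {v : Variation c} (h : GaugeRel J g v) (hv : v ∈ W) :
    ((g.β, g.lamt), v) ∈ gaugeGraph hc W := ⟨h, hv⟩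

/-- The gauge variations in `W` form a closed subspace: a tangent vector that is not one of them
has a component `X̃(0)` that is not a multiple of the Reeb field, or a gauge parameter with
`β(1) ≠ 0`, and either property persists under small perturbations. -/
lemma eventually_notMem_gauge [FiniteDimensional ℝ F] (hc : InConstraintManifold J c)
    (hE : ∀ x : M, J.E x ≠ 0) {W : Submodule ℝ (Variation c)} {v₀ : Variation c}
    (hT : IsTangent J c v₀) (hW : v₀ ∈ W)
    (h₀ : ¬ ∃ x : GaugePair c, (x, v₀) ∈ gaugeGraph hc W ∧ x.1 1 = 0) :
    ∀ᶠ v in variationNhds v₀, ¬ ∃ x : GaugePair c, (x, v) ∈ gaugeGraph hc W ∧ x.1 1 = 0 := by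
  have : CompleteSpace F := FiniteDimensional.complete ℝ F
  have hp := mem_chartPart_self (c := c) mem_Icc_zero
  have hq := mem_chartPart_self (c := c) mem_Icc_one
  by_cases hf : initialClass J c (c.X 0) v₀ = 0
  · obtain ⟨r, hr⟩ := initialClass_eq_zero_iff.1 hf
    obtain ⟨g, hg1, hg2, hg3, hg4⟩ := exists_gauge_of_isTangent hc hE hT hp hr
    have hg := mem_gaugeGraph_of_rel hc ⟨hg1, hg2, hg3, hg4⟩ hW
    have hβ : 0 < ‖g.bc (c.X 1) 1‖ := norm_pos_iff.2 fun h =>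
      h₀ ⟨_, hg, (g.bc_eq_zero_iff hq).1 h⟩
    filter_upwards [eventually_bc_one_le hc hE v₀ hq (half_pos hβ)] with v hv
    rintro ⟨x, hx, hx1⟩
    have h1 := (gaugeGraph hc W).sub_mem hg hx
    have h2 := hv (x - (g.β, g.lamt)).toParam ((gaugeGraph hc W).sub_mem hx hg).1
    have h3 : (x - (g.β, g.lamt)).toParam.bc (c.X 1) 1 = -g.bc (c.X 1) 1 := by
      rw [sub_eq_add_neg, ← neg_one_smul ℝ (g.β, g.lamt), GaugePair.bc_add _ _ hq,
        GaugePair.bc_smul _ _ hq, (GaugeParam.bc_eq_zero_iff _ hq).2 hx1, zero_add, neg_one_smul]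
      rfl
    rw [h3, norm_neg] at h2
    linarith
  · -- the line spanned by the Reeb field is closed in `F`
    have hcl : IsClosed (Submodule.span ℝ {c.Ec J (c.X 0) 0} : Set F) :=
      Submodule.closed_of_finiteDimensional _
    obtain ⟨ε, hε, hball⟩ := Metric.isOpen_iff.1 hcl.isOpen_compl (v₀.rep (c.X 0) 0).1
      (fun h => hf (initialClass_eq_zero_iff_mem.2 h))
    filter_upwards [eventually_rep_lt v₀ (isCompact_singleton (x := (0 : ℝ)))
      (singleton_subset_iff.2 hp) hε] with v hv
    rintro ⟨x, hx, -⟩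
    have h1 := hx.1.initialClass_eq_zero hc hp
    refine hball (a := (v.rep (c.X 0) 0).1) ?_ (initialClass_eq_zero_iff_mem.1 h1)
    have h2 := (norm_fst_le _).trans_lt (hv 0 (mem_singleton _))
    rw [sub_eq_add_neg, ← neg_one_smul ℝ v₀, Variation.rep_add, Variation.rep_smul, neg_one_smul,
      ← sub_eq_add_neg] at h2
    rwa [Metric.mem_ball, dist_eq_norm]

/-- The gauge directions within a space `W` of variations that contains all variations at fixed
`λ_u` are closed and of codimension `2 dim M - 2`. -/
theorem isClosedOfCodim_span_gauge [FiniteDimensional ℝ F] (hc : InConstraintManifold J c)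
    (hE : ∀ x : M, J.E x ≠ 0) {W : Submodule ℝ (Variation c)} (hW : fixedLam c ≤ W) :
    IsClosedOfCodim (tangentSpaceC J c ⊓ W)
      (Submodule.span ℝ {v | ∃ g : GaugeParam c, g.Admissible J ∧ IsGaugeVariation J g v ∧ v ∈ W})
      (2 * Module.finrank ℝ F - 2) := by
  have : CompleteSpace F := FiniteDimensional.complete ℝ F
  have hp := mem_chartPart_self (c := c) mem_Icc_zero
  refine ⟨fun v hv => ?_, ?_, ?_⟩
  · obtain ⟨x, hx, -⟩ := (mem_span_gauge_iff hc).1 hv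
    exact Submodule.mem_inf.2 ⟨hx.1.isTangent hc, hx.2⟩
  · let _ : TopologicalSpace (Variation c) := variationTopology c
    let _ : TopologicalSpace ↥(tangentSpaceC J c ⊓ W) :=
      (variationTopology c).induced Subtype.val
    refine ⟨isOpen_iff_mem_nhds.2 fun v hv => ?_⟩
    rw [nhds_induced]
    refine ⟨_, eventually_notMem_gauge hc hE v.2.1 v.2.2
      (fun h => hv ((mem_span_gauge_iff hc).2 h)), fun w hw h => ?_⟩
    exact hw ((mem_span_gauge_iff hc).1 h)
  · rw [rank_quotient_of_relation (𝒢 := gaugeGraph hc W) (f := initialClass J c (c.X 0))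
      (ev := finalValue c) (A₀ := annihilator (c.X 1) (J.E (c.X 1)))
      (fun g v h => Submodule.mem_inf.2 ⟨h.1.isTangent hc, h.2⟩) (fun v hv => ⟨fun h => ?_, ?_⟩)
      (fun y => ?_)
      (fun g h => h.1.β_one_eq_zero hc hE) (fun g v h => h.1.reeb 1 mem_Icc_one)
      (fun a ha => ?_) (fun v => mem_span_gauge_iff hc)]
    · have h1 := finrank_quotient_span_singleton (Ec_ne_zero hE hp)
      have h2 := finrank_annihilator (c.X 1) (hE (c.X 1))
      congr 1
      omega
    · obtain ⟨r, hr⟩ := initialClass_eq_zero_iff.1 h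
      obtain ⟨g, hg1, hg2, hg3, hg4⟩ := exists_gauge_of_isTangent hc hE hv.1 hp hr
      exact ⟨_, mem_gaugeGraph_of_rel hc ⟨hg1, hg2, hg3, hg4⟩ hv.2⟩
    · rintro ⟨g, hg⟩
      exact hg.1.initialClass_eq_zero hc hp
    · obtain ⟨w, rfl⟩ := Submodule.mkQ_surjective _ y
      obtain ⟨v, hv, hv2, hvw⟩ := exists_isTangent_initial hc hE hp w
      exact ⟨v, ⟨hv, hW hv2⟩, congrArg (Submodule.mkQ _) hvw⟩
    · obtain ⟨g, v, hg, hv, hga⟩ := exists_gauge_final_of_annihilator hc hE ha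
      exact ⟨_, v, mem_gaugeGraph_of_rel hc hg (hW hv), hga⟩

end JacobiSigma
end

open JacobiSigma in
theorem theorem2 {F : Type*} [NormedAddCommGroup F] [NormedSpace ℝ F] [FiniteDimensional ℝ F]
    {M : Type*} [TopologicalSpace M] [ChartedSpace F M] [IsManifold 𝓘(ℝ, F) ∞ M]
    [T2Space M] [SecondCountableTopology M]
    (J : JacobiStructure F M) (hE : ∀ x : M, J.E x ≠ 0)
    (c : Fields F M) (hc : InConstraintManifold J c) :
    (∀ g : GaugeParam c, g.Admissible J → ∃! v : Variation c, IsGaugeVariation J g v) ∧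
    IsClosedOfCodim (tangentSpaceC J c) (gaugeSpan J c) (2 * Module.finrank ℝ F - 2) ∧
    IsClosedOfCodim (tangentSpaceC J c ⊓ fixedLam c) (gaugeSpanFixedLam J c)
      (2 * Module.finrank ℝ F - 2) := by
  refine ⟨fun g hg => existsUnique_isGaugeVariation hc ⟨hg.contMDiffOn_β, hg.contDiffOn_lamt⟩, ?_,
    isClosedOfCodim_span_gauge hc hE le_rfl⟩
  have h := isClosedOfCodim_span_gauge hc hE (W := ⊤) le_top
  simp only [Submodule.mem_top, and_true, inf_top_eq] at h
  exact h
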